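/- Let $\mathfrak g$ be the Lie algebra of a compact simple Lie group $G$, i.e. a finite-dimensional simple real Lie algebra with an $\mathrm{ad}$-invariant positive definite inner product $\langle\cdot,\cdot\rangle$. Let $\mathfrak t\subset\mathfrak g$ be a maximal abelian subalgebra (the Lie algebra of a maximal torus), and fix a Weyl chamber. The roots are the nonzero real functionals $\alpha$ on $\mathfrak t$ for which $\mathfrak g_\alpha=\{X\in\mathfrak g_{\mathbb C}:[H,X]=i\alpha(H)X\ \text{for all } H\in\mathfrak t\}$ is nonzero. Let $\rho_G$ be half the sum of the positive roots, $\alpha_{\max}$ the highest root, and $\mathfrak n_+$ the sum of the positive root spaces. Assume that $\langle\cdot,\cdot\rangle$ is the basic inner product, i.e. $\langle\alpha_{\max},\alpha_{\max}\rangle=2$ for the induced inner product on $\mathfrak t^*$, and extend it complex bilinearly to $\mathfrak g_{\mathbb C}$. Let $L\mathfrak g_{\mathbb C}=\mathfrak g_{\mathbb C}[z,z^{-1}]$, $z=e^{i\theta}$, be the complexified Lie algebra of loops with finite Fourier expansion, with the form $\langle\xi,\eta\rangle=\frac1{2\pi}\int_0^{2\pi}\langle\xi(\theta),\eta(\theta)\rangle\,d\theta$,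 and let $\hat L\mathfrak g=\mathbb C\,\partial_\theta\oplus L\mathfrak g_{\mathbb C}\oplus\mathbb C I$ be the extended Lie algebra: $I$ is central, $[\partial_\theta,\xi]=\partial_\theta\xi$, and the bracket of two loops is $[\xi,\eta]+\langle\xi,\partial_\theta\eta\rangle I$. It acts on loops by $\partial_\theta$, by $\mathrm{ad}$, and with $I$ acting as $0$. For a subspace $V\subset L\mathfrak g_{\mathbb C}$ let $\mathrm{Cl}(V)$ be the Clifford algebra with $\xi\eta+\eta\xi=2\langle\xi,\eta\rangle$. A representation $\mathcal S$ of $\mathrm{Cl}(V)$ is said to have *central charge* (level) $c\in\mathbb R$ if the subalgebra of $\hat L\mathfrak g$ that preserves $V$ has a representation $\pi$ on $\mathcal S$ lifting its action on $V$, i.e. with $[\pi(x),v]=x\cdot v$ (Clifford multiplication by $x\cdot v$) for all $v\in V$, and if in every such representation $\pi(I)=i\,c$. Let $\mathfrak t^\perp\subset L\mathfrak g_{\mathbb C}$ be the orthogonal complement of the constant loops in $\mathfrak t$. The positive energy spin representation $$\mathcal S_{L\mathfrak g/\mathfrak t}=\Lambda^*\Bigl(\mathfrak n_+\oplus\bigoplus_{k>0}\mathfrak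 g_{\mathbb C}z^k\Bigr)$$ (up to a twist by a one-dimensional representation of the torus, which does not affect the Clifford action) is a representation of $\mathrm{Cl}(\mathfrak t^\perp)$, where the elements of $\mathfrak n_+$ and $\mathfrak g_{\mathbb C}z^k$, $k>0$, act by exterior multiplication, and the elements of the negative root spaces and of $\mathfrak g_{\mathbb C}z^{-k}$, $k>0$, by twice the interior multiplication. For an irreducible $\mathrm{Cl}(\mathfrak t_{\mathbb C})$-module $\mathbb S_{\mathfrak t}$, the graded tensor product $\mathcal S_{L\mathfrak g}=\mathbb S_{\mathfrak t}\otimes\mathcal S_{L\mathfrak g/\mathfrak t}$ is a representation of $\mathrm{Cl}(L\mathfrak g_{\mathbb C})$. **Theorem.** There is a real number $c_G$ such that $\mathcal S_{L\mathfrak g/\mathfrak t}$ has central charge $c_G$, and so does $\mathcal S_{L\mathfrak g}$ for every irreducible $\mathbb S_{\mathfrak t}$. It is the value of the quadratic Casimir operator of $\mathfrak g$ in the adjoint representation: for an orthonormal basis $\{X_i\}$ of $\mathfrak g$, the operator $-\frac12\sum_i(\mathrm{ad}\,X_i)^2$ is the scalar $c_G$, and $$c_G=\langle\rho_G,\alpha_{\max}\rangle+1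 .$$ -/

import Mathlib

open scoped TensorProduct

noncomputable section

namespace LoopSpin

/-- An `ad`-invariant (positive definite) inner product on a real Lie algebra. -/
structure InvInner (𝔤 : Type*) [LieRing 𝔤] [LieAlgebra ℝ 𝔤] where
  form : LinearMap.BilinForm ℝ 𝔤
  symm : ∀ X Y : 𝔤, form X Y = form Y X
  pos : ∀ X : 𝔤, X ≠ 0 → 0 < form X X
  inv : ∀ X Y Z : 𝔤, form ⁅X, Y⁆ Z = - form Y ⁅X, Z⁆

section Forms

variable (𝔤 : Type*) [LieRing 𝔤] [LieAlgebra ℝ 𝔤]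

/-- The complexification `𝔤_ℂ`. -/
def Cx := ℂ ⊗[ℝ] 𝔤

instance : LieRing (Cx 𝔤) := inferInstanceAs (LieRing (ℂ ⊗[ℝ] 𝔤))
instance : LieAlgebra ℂ (Cx 𝔤) := inferInstanceAs (LieAlgebra ℂ (ℂ ⊗[ℝ] 𝔤))

/-- The Lie algebra `𝔤_ℂ[z, z⁻¹]` of loops with finite Fourier expansion. -/
def Loop := LieAlgebra.loopAlgebra ℂ ℤ (Cx 𝔤)

instance : LieRing (Loop 𝔤) := inferInstanceAs (LieRing (LieAlgebra.loopAlgebra ℂ ℤ (Cx 𝔤)))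
instance : LieAlgebra ℂ (Loop 𝔤) :=
  inferInstanceAs (LieAlgebra ℂ (LieAlgebra.loopAlgebra ℂ ℤ (Cx 𝔤)))

variable {𝔤}

/-- The element `a X` of `𝔤_ℂ` for `a` complex and `X` in `𝔤`. -/
def cxMk (a : ℂ) (X : 𝔤) : Cx 𝔤 := a ⊗ₜ[ℝ] X

/-- The loop `f X` for a Laurent polynomial `f` and `X` in `𝔤_ℂ`. -/
def loopMk (f : AddMonoidAlgebra ℂ ℤ) (X : Cx 𝔤) : Loop 𝔤 := f ⊗ₜ[ℂ] X

/-- The loop `X z ^ k`. -/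
def mode (k : ℤ) (X : Cx 𝔤) : Loop 𝔤 := loopMk (AddMonoidAlgebra.single k 1) X

theorem Cx.induct {p : Cx 𝔤 → Prop} (X : Cx 𝔤) (h0 : p 0)
    (hadd : ∀ X Y, p X → p Y → p (X + Y)) (hmk : ∀ a X, p (cxMk a X)) : p X :=
  TensorProduct.induction_on X h0 hmk hadd

theorem Loop.induct {p : Loop 𝔤 → Prop} (ξ : Loop 𝔤) (h0 : p 0)
    (hadd : ∀ ξ η, p ξ → p η → p (ξ + η)) (hmk : ∀ f X, p (loopMk f X)) : p ξ :=
  TensorProduct.induction_on ξ h0 hmk hadd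

theorem cxMk_lie (a b : ℂ) (X Y : 𝔤) : ⁅cxMk a X, cxMk b Y⁆ = cxMk (a * b) ⁅X, Y⁆ := rfl

theorem loopMk_lie (f g : AddMonoidAlgebra ℂ ℤ) (X Y : Cx 𝔤) :
    ⁅loopMk f X, loopMk g Y⁆ = loopMk (f * g) ⁅X, Y⁆ := rfl

/-- The Fourier coefficients of a loop. -/
def fourier : Loop 𝔤 ≃ₗ[ℂ] (ℤ →₀ Cx 𝔤) := LieAlgebra.LoopAlgebra.toFinsupp ℂ ℤ (Cx 𝔤)

theorem fourier_mode (k : ℤ) (X : Cx 𝔤) : fourier (mode k X) = Finsupp.single k X :=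
  LieAlgebra.LoopAlgebra.toFinsupp_single_tmul ..

/-- `(f, g) ↦ (2π)⁻¹ ∫ f g dθ`, i.e. the constant term of `f g`. -/
def meanForm : LinearMap.BilinForm ℂ (AddMonoidAlgebra ℂ ℤ) :=
  LinearMap.mk₂ ℂ (fun f g => (f * g).coeff 0)
    (by intros; simp [add_mul]) (by intros; simp)
    (by intros; simp [mul_add]) (by intros; simp)

/-- `d/dθ` on Laurent polynomials in `z = exp (i θ)`: `z ^ k ↦ i k z ^ k`. -/
def dTheta : AddMonoidAlgebra ℂ ℤ →ₗ[ℂ] AddMonoidAlgebra ℂ ℤ :=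
  (AddMonoidAlgebra.basis ℤ ℂ).constr ℂ
    (fun k : ℤ => AddMonoidAlgebra.single k (Complex.I * (k : ℂ)))

/-- The infinitesimal rotation `∂_θ` on loops. -/
def rot : Loop 𝔤 →ₗ[ℂ] Loop 𝔤 := dTheta.rTensor (Cx 𝔤)

variable (B : InvInner 𝔤)

/-- The complex bilinear extension of the inner product to `𝔤_ℂ`. -/
def InvInner.cx : LinearMap.BilinForm ℂ (Cx 𝔤) := LinearMap.BilinForm.baseChange ℂ B.form

/-- `⟨ξ, η⟩ = (2π)⁻¹ ∫ ⟨ξ(θ), η(θ)⟩ dθ`, extended complex bilinearly. -/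
def InvInner.loop : LinearMap.BilinForm ℂ (Loop 𝔤) := LinearMap.BilinForm.tmul meanForm B.cx

theorem dTheta_single (k : ℤ) (a : ℂ) :
    dTheta (AddMonoidAlgebra.single k a) = AddMonoidAlgebra.single k (Complex.I * k * a) := by
  have h : AddMonoidAlgebra.single k a = a • AddMonoidAlgebra.basis ℤ ℂ k := by
    rw [AddMonoidAlgebra.basis_apply, AddMonoidAlgebra.smul_single, smul_eq_mul, mul_one]
  rw [h, map_smul, dTheta, Module.Basis.constr_basis, AddMonoidAlgebra.smul_single, smul_eq_mul,
    mul_comm]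

theorem dTheta_mul (f g : AddMonoidAlgebra ℂ ℤ) :
    dTheta (f * g) = dTheta f * g + f * dTheta g := by
  induction f using AddMonoidAlgebra.induction_linear with
  | zero => simp
  | add a b ha hb => simp only [add_mul, map_add, ha, hb]; abel
  | single j a =>
    induction g using AddMonoidAlgebra.induction_linear with
    | zero => simp
    | add x y hx hy => simp only [mul_add, map_add, hx, hy]; abel
    | single k b =>
      simp only [AddMonoidAlgebra.single_mul_single, dTheta_single, ← AddMonoidAlgebra.single_add]
      congr 1
      push_cast; ring

theorem dTheta_mean (f : AddMonoidAlgebra ℂ ℤ) : (dTheta f).coeff 0 = 0 := by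
  induction f using AddMonoidAlgebra.induction_linear with
  | zero => simp
  | add a b ha hb => simp [map_add, ha, hb]
  | single j a =>
    rw [dTheta_single, AddMonoidAlgebra.coeff_single, Finsupp.single_apply]
    split_ifs with h
    · simp [h]
    · rfl

theorem meanForm_dTheta (f g : AddMonoidAlgebra ℂ ℤ) :
    (dTheta f * g).coeff 0 = - (f * dTheta g).coeff 0 := by
  have h := dTheta_mean (f * g)
  rw [dTheta_mul, AddMonoidAlgebra.coeff_add, Finsupp.add_apply] at h
  exact eq_neg_of_add_eq_zero_left h

theorem InvInner.cx_mk (a b : ℂ) (X Y : 𝔤) :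
    B.cx (cxMk a X) (cxMk b Y) = (B.form X Y : ℂ) * (a * b) := by
  change LinearMap.BilinForm.baseChange ℂ B.form (a ⊗ₜ[ℝ] X) (b ⊗ₜ[ℝ] Y) = _
  rw [LinearMap.BilinForm.baseChange_tmul, Complex.real_smul]

theorem InvInner.cx_symm (X Y : Cx 𝔤) : B.cx X Y = B.cx Y X := by
  induction X using Cx.induct with
  | h0 => simp
  | hadd a b ha hb => simp only [map_add, LinearMap.add_apply, ha, hb]
  | hmk a x =>
    induction Y using Cx.induct with
    | h0 => simp
    | hadd a b ha hb => simp only [map_add, LinearMap.add_apply, ha, hb]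
    | hmk b y => rw [B.cx_mk, B.cx_mk, B.symm x y, mul_comm a b]

theorem InvInner.cx_inv (X Y Z : Cx 𝔤) : B.cx ⁅X, Y⁆ Z = - B.cx Y ⁅X, Z⁆ := by
  induction X using Cx.induct with
  | h0 => simp
  | hadd a b ha hb => simp only [add_lie, map_add, LinearMap.add_apply, ha, hb, neg_add]
  | hmk a x =>
    induction Y using Cx.induct with
    | h0 => simp
    | hadd a b ha hb => simp only [lie_add, map_add, LinearMap.add_apply, ha, hb, neg_add]
    | hmk b y =>
      induction Z using Cx.induct with
      | h0 => simp
      | hadd a b ha hb => simp only [lie_add, map_add, ha, hb, neg_add]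
      | hmk c w =>
        simp only [cxMk_lie, B.cx_mk, B.inv]
        push_cast; ring

theorem InvInner.loop_mk (f g : AddMonoidAlgebra ℂ ℤ) (X Y : Cx 𝔤) :
    B.loop (loopMk f X) (loopMk g Y) = (f * g).coeff 0 * B.cx X Y := by
  change LinearMap.BilinForm.tmul meanForm B.cx (f ⊗ₜ[ℂ] X) (g ⊗ₜ[ℂ] Y) = _
  rw [LinearMap.BilinForm.tensorDistrib_tmul, smul_eq_mul, mul_comm]; rfl

theorem InvInner.loop_mode (j k : ℤ) (X Y : Cx 𝔤) :
    B.loop (mode j X) (mode k Y) = if j + k = 0 then B.cx X Y else 0 := by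
  rw [mode, mode, B.loop_mk, AddMonoidAlgebra.single_mul_single, AddMonoidAlgebra.coeff_single,
    Finsupp.single_apply]
  simp

theorem InvInner.loop_symm (ξ η : Loop 𝔤) : B.loop ξ η = B.loop η ξ := by
  induction ξ using Loop.induct with
  | h0 => simp
  | hadd a b ha hb => simp only [map_add, LinearMap.add_apply, ha, hb]
  | hmk f x =>
    induction η using Loop.induct with
    | h0 => simp
    | hadd a b ha hb => simp only [map_add, LinearMap.add_apply, ha, hb]
    | hmk g y => rw [B.loop_mk, B.loop_mk, B.cx_symm x y, mul_comm f g]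

theorem InvInner.loop_inv (ξ η ζ : Loop 𝔤) : B.loop ⁅ξ, η⁆ ζ = - B.loop η ⁅ξ, ζ⁆ := by
  induction ξ using Loop.induct with
  | h0 => simp
  | hadd a b ha hb => simp only [add_lie, map_add, LinearMap.add_apply, ha, hb, neg_add]
  | hmk f x =>
    induction η using Loop.induct with
    | h0 => simp
    | hadd a b ha hb => simp only [lie_add, map_add, LinearMap.add_apply, ha, hb, neg_add]
    | hmk g y =>
      induction ζ using Loop.induct with
      | h0 => simp
      | hadd a b ha hb => simp only [lie_add, map_add, ha, hb, neg_add]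
      | hmk h w =>
        simp only [loopMk_lie, B.loop_mk, B.cx_inv]
        rw [show f * g * h = g * (f * h) by ring]; ring

theorem rot_mk (f : AddMonoidAlgebra ℂ ℤ) (X : Cx 𝔤) : rot (loopMk f X) = loopMk (dTheta f) X := rfl

theorem rot_mode (k : ℤ) (X : Cx 𝔤) : rot (mode k X) = (Complex.I * k) • mode k X := by
  rw [mode, rot_mk, dTheta_single]
  change _ ⊗ₜ[ℂ] _ = (Complex.I * k) • (_ ⊗ₜ[ℂ] _)
  rw [TensorProduct.smul_tmul', AddMonoidAlgebra.smul_single, smul_eq_mul]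

theorem rot_lie (ξ η : Loop 𝔤) : rot ⁅ξ, η⁆ = ⁅rot ξ, η⁆ + ⁅ξ, rot η⁆ := by
  induction ξ using Loop.induct with
  | h0 => simp
  | hadd a b ha hb => simp only [add_lie, map_add, ha, hb]; abel
  | hmk f x =>
    induction η using Loop.induct with
    | h0 => simp
    | hadd a b ha hb => simp only [lie_add, map_add, ha, hb]; abel
    | hmk g y =>
      simp only [loopMk_lie, rot_mk, dTheta_mul]
      exact TensorProduct.add_tmul ..

theorem InvInner.loop_rot (ξ η : Loop 𝔤) : B.loop (rot ξ) η = - B.loop ξ (rot η) := by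
  induction ξ using Loop.induct with
  | h0 => simp
  | hadd a b ha hb => simp only [map_add, LinearMap.add_apply, ha, hb, neg_add]
  | hmk f x =>
    induction η using Loop.induct with
    | h0 => simp
    | hadd a b ha hb => simp only [map_add, ha, hb, neg_add]
    | hmk g y => simp only [rot_mk, B.loop_mk, meanForm_dTheta, neg_mul]

theorem InvInner.loop_self_rot (ξ : Loop 𝔤) : B.loop ξ (rot ξ) = 0 := by
  have h := B.loop_rot ξ ξ
  rw [B.loop_symm (rot ξ) ξ] at h
  exact self_eq_neg.mp h

/-- The complexification of the extended Lie algebra `ℝ ∂_θ ⊕ L𝔤 ⊕ ℝ I`: the element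
`⟨a, ξ, x⟩` is `a ∂_θ + ξ + x I`. The bracket depends on the inner product. -/
@[ext] structure Affine (B : InvInner 𝔤) where
  rotPart : ℂ
  loopPart : Loop 𝔤
  centPart : ℂ

namespace Affine

variable {B}

/-- The underlying vector space of the extended Lie algebra is a product. -/
def equivProd : Affine B ≃ ℂ × Loop 𝔤 × ℂ where
  toFun x := (x.rotPart, x.loopPart, x.centPart)
  invFun x := ⟨x.1, x.2.1, x.2.2⟩

instance : AddCommGroup (Affine B) := equivProd.addCommGroup
instance : Module ℂ (Affine B) := equivProd.module ℂ

@[simp] theorem zero_rotPart : (0 : Affine B).rotPart = 0 := rfl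
@[simp] theorem zero_loopPart : (0 : Affine B).loopPart = 0 := rfl
@[simp] theorem zero_centPart : (0 : Affine B).centPart = 0 := rfl
@[simp] theorem add_rotPart (x y : Affine B) : (x + y).rotPart = x.rotPart + y.rotPart := rfl
@[simp] theorem add_loopPart (x y : Affine B) : (x + y).loopPart = x.loopPart + y.loopPart := rfl
@[simp] theorem add_centPart (x y : Affine B) : (x + y).centPart = x.centPart + y.centPart := rfl
@[simp] theorem smul_rotPart (c : ℂ) (x : Affine B) : (c • x).rotPart = c * x.rotPart := rfl
@[simp] theorem smul_loopPart (c : ℂ) (x : Affine B) : (c • x).loopPart = c • x.loopPart := rfl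
@[simp] theorem smul_centPart (c : ℂ) (x : Affine B) : (c • x).centPart = c * x.centPart := rfl

/-- `[a ∂_θ + ξ + x I, b ∂_θ + η + y I] = ([ξ, η] + a ∂_θ η - b ∂_θ ξ) + ⟨ξ, ∂_θ η⟩ I`. -/
instance : Bracket (Affine B) (Affine B) where
  bracket x y :=
    ⟨0, ⁅x.loopPart, y.loopPart⁆ + x.rotPart • rot y.loopPart - y.rotPart • rot x.loopPart,
      B.loop x.loopPart (rot y.loopPart)⟩

@[simp] theorem lie_rotPart (x y : Affine B) : ⁅x, y⁆.rotPart = 0 := rfl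
@[simp] theorem lie_loopPart (x y : Affine B) : ⁅x, y⁆.loopPart =
    ⁅x.loopPart, y.loopPart⁆ + x.rotPart • rot y.loopPart - y.rotPart • rot x.loopPart := rfl
@[simp] theorem lie_centPart (x y : Affine B) :
    ⁅x, y⁆.centPart = B.loop x.loopPart (rot y.loopPart) := rfl

instance : LieRing (Affine B) where
  add_lie x y z := by
    ext1
    · simp
    · simp only [lie_loopPart, add_loopPart, add_rotPart, add_lie, add_smul, smul_add, map_add]
      abel
    · simp
  lie_add x y z := by
    ext1
    · simp
    · simp only [lie_loopPart, add_loopPart, add_rotPart, lie_add, add_smul, smul_add, map_add]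
      abel
    · simp
  lie_self x := by
    ext1
    · simp
    · simp
    · simp [B.loop_self_rot]
  leibniz_lie x y z := by
    ext1
    · simp
    · simp only [lie_loopPart, add_loopPart, lie_rotPart, lie_add, lie_sub, add_lie, sub_lie,
        zero_smul, sub_zero, map_add, map_sub, map_smul, rot_lie, smul_add, smul_sub,
        lie_smul, smul_lie, leibniz_lie x.loopPart y.loopPart z.loopPart]
      rw [← lie_skew (rot x.loopPart) y.loopPart]
      module
    · have h1 : B.loop x.loopPart (rot ⁅y.loopPart, z.loopPart⁆) =
          B.loop y.loopPart ⁅rot x.loopPart, z.loopPart⁆ := by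
        rw [← neg_eq_iff_eq_neg.mpr (B.loop_rot x.loopPart ⁅y.loopPart, z.loopPart⁆),
          ← neg_eq_iff_eq_neg.mpr (B.loop_inv y.loopPart (rot x.loopPart) z.loopPart),
          ← lie_skew, map_neg, LinearMap.neg_apply, B.loop_inv, neg_neg, neg_neg]
      have h2 := B.loop_inv x.loopPart y.loopPart (rot z.loopPart)
      have h3 := B.loop_rot y.loopPart (rot z.loopPart)
      have h4 := B.loop_rot x.loopPart (rot z.loopPart)
      have h5 : B.loop x.loopPart (rot (rot y.loopPart)) =
          B.loop y.loopPart (rot (rot x.loopPart)) := by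
        rw [← neg_eq_iff_eq_neg.mpr (B.loop_rot x.loopPart _),
          ← neg_eq_iff_eq_neg.mpr (B.loop_rot y.loopPart _), B.loop_symm (rot x.loopPart)]
      simp only [lie_loopPart, lie_centPart, add_centPart, map_add, map_sub, map_smul,
        LinearMap.add_apply, LinearMap.sub_apply, LinearMap.smul_apply, smul_eq_mul, h1, h2, h3,
        h4, h5]
      rw [rot_lie x.loopPart z.loopPart, map_add]
      ring

instance : LieAlgebra ℂ (Affine B) where
  lie_smul c x y := by
    ext1
    · simp
    · simp only [lie_loopPart, smul_loopPart, smul_rotPart, lie_smul, map_smul, smul_add, smul_sub,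
        mul_smul, smul_comm x.rotPart c]
    · simp

end Affine

end Forms

section Roots

variable {𝔤 : Type*} [LieRing 𝔤] [LieAlgebra ℝ 𝔤]

/-- The joint eigenspace in `𝔤_ℂ` on which `H` in `𝔱` acts by `i α(H)`, i.e. on which the torus
acts with the weight `exp (i α)`. -/
def rootSpace (𝔱 : LieSubalgebra ℝ 𝔤) (α : Module.Dual ℝ 𝔱) : Submodule ℂ (Cx 𝔤) where
  carrier := {X | ∀ H : 𝔱, ⁅cxMk 1 (H : 𝔤), X⁆ = (Complex.I * (α H : ℂ)) • X}
  add_mem' := by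
    intro X Y hX hY H
    rw [lie_add, hX H, hY H, smul_add]
  zero_mem' := by intro H; simp
  smul_mem' := by
    intro c X hX H
    rw [lie_smul, hX H, smul_comm]

/-- Roots, as real linear functionals on `𝔱`. -/
def IsRoot (𝔱 : LieSubalgebra ℝ 𝔤) (α : Module.Dual ℝ 𝔱) : Prop :=
  α ≠ 0 ∧ rootSpace 𝔱 α ≠ ⊥

variable (𝔤) in
/-- A maximal abelian subalgebra `𝔱` (the Lie algebra of a maximal torus) together with a Weyl
chamber, given by a regular element of `𝔱` in its interior. -/
structure CartanChoice where
  torus : LieSubalgebra ℝ 𝔤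
  abelian : ∀ H ∈ torus, ∀ K ∈ torus, ⁅H, K⁆ = 0
  maximal : ∀ X : 𝔤, (∀ H ∈ torus, ⁅H, X⁆ = 0) → X ∈ torus
  reg : torus
  regular : ∀ α, IsRoot torus α → α reg ≠ 0

namespace CartanChoice

variable (D : CartanChoice 𝔤)

/-- The positive roots: those that are positive on the chosen Weyl chamber. -/
def posRoots : Set (Module.Dual ℝ D.torus) := {α | IsRoot D.torus α ∧ 0 < α D.reg}

/-- The negative roots. -/
def negRoots : Set (Module.Dual ℝ D.torus) := {α | IsRoot D.torus α ∧ α D.reg < 0}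

/-- The highest root: a root `θ` such that `θ - β` is a sum of positive roots for each root `β`. -/
def IsHighestRoot (θ : Module.Dual ℝ D.torus) : Prop :=
  IsRoot D.torus θ ∧ ∀ β, IsRoot D.torus β → θ - β ∈ AddSubmonoid.closure D.posRoots

/-- The complexification of `𝔱` inside `𝔤_ℂ`. -/
def torusCx : Submodule ℂ (Cx 𝔤) := Submodule.span ℂ {X | ∃ H ∈ D.torus, X = cxMk 1 H}

/-- The sum of the positive root spaces. -/
def nPlus : Submodule ℂ (Cx 𝔤) := ⨆ α ∈ D.posRoots, rootSpace D.torus α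

/-- The sum of the negative root spaces. -/
def nMinus : Submodule ℂ (Cx 𝔤) := ⨆ α ∈ D.negRoots, rootSpace D.torus α

end CartanChoice

/-! Helper facts: the root space decomposition. -/

/-- Real part of an element of `𝔤_ℂ`. -/
def cxRe : Cx 𝔤 →ₗ[ℝ] 𝔤 := (TensorProduct.lid ℝ 𝔤).toLinearMap ∘ₗ Complex.reLm.rTensor 𝔤

/-- Imaginary part of an element of `𝔤_ℂ`. -/
def cxIm : Cx 𝔤 →ₗ[ℝ] 𝔤 := (TensorProduct.lid ℝ 𝔤).toLinearMap ∘ₗ Complex.imLm.rTensor 𝔤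

theorem cxRe_mk (a : ℂ) (X : 𝔤) : cxRe (cxMk a X) = a.re • X := rfl
theorem cxIm_mk (a : ℂ) (X : 𝔤) : cxIm (cxMk a X) = a.im • X := rfl

theorem cxMk_add (a : ℂ) (X Y : 𝔤) : cxMk a (X + Y) = cxMk a X + cxMk a Y :=
  TensorProduct.tmul_add ..
theorem cxMk_add' (a b : ℂ) (X : 𝔤) : cxMk (a + b) X = cxMk a X + cxMk b X :=
  TensorProduct.add_tmul ..
theorem cxMk_smul (a : ℂ) (r : ℝ) (X : 𝔤) : cxMk a (r • X) = cxMk (r * a) X := by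
  change a ⊗ₜ[ℝ] (r • X) = ((r : ℂ) * a) ⊗ₜ[ℝ] X
  rw [← TensorProduct.smul_tmul, Complex.real_smul]
theorem smul_cxMk (c a : ℂ) (X : 𝔤) : c • cxMk a X = cxMk (c * a) X := rfl

theorem cxRe_smul (c : ℂ) (X : Cx 𝔤) : cxRe (c • X) = c.re • cxRe X - c.im • cxIm X := by
  induction X using Cx.induct with
  | h0 => simp
  | hadd a b ha hb => simp only [smul_add, map_add, ha, hb]; abel
  | hmk a x => simp only [smul_cxMk, cxRe_mk, cxIm_mk, Complex.mul_re]; module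

theorem cxIm_smul (c : ℂ) (X : Cx 𝔤) : cxIm (c • X) = c.re • cxIm X + c.im • cxRe X := by
  induction X using Cx.induct with
  | h0 => simp
  | hadd a b ha hb => simp only [smul_add, map_add, ha, hb]; abel
  | hmk a x => simp only [smul_cxMk, cxRe_mk, cxIm_mk, Complex.mul_im]; module

theorem cxRe_lie (H : 𝔤) (X : Cx 𝔤) : cxRe ⁅cxMk 1 H, X⁆ = ⁅H, cxRe X⁆ := by
  induction X using Cx.induct with
  | h0 => simp
  | hadd a b ha hb => simp only [lie_add, map_add, ha, hb]
  | hmk a x => simp only [cxMk_lie, cxRe_mk, one_mul, lie_smul]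

theorem cxIm_lie (H : 𝔤) (X : Cx 𝔤) : cxIm ⁅cxMk 1 H, X⁆ = ⁅H, cxIm X⁆ := by
  induction X using Cx.induct with
  | h0 => simp
  | hadd a b ha hb => simp only [lie_add, map_add, ha, hb]
  | hmk a x => simp only [cxMk_lie, cxIm_mk, one_mul, lie_smul]

theorem cx_eq (X : Cx 𝔤) : X = cxMk 1 (cxRe X) + cxMk Complex.I (cxIm X) := by
  induction X using Cx.induct with
  | h0 => simp [cxMk]; rfl
  | hadd a b ha hb =>
    nth_rewrite 1 [ha, hb]
    simp only [map_add, cxMk_add]; abel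
  | hmk a x =>
    simp only [cxRe_mk, cxIm_mk, cxMk_smul]
    rw [← cxMk_add', mul_one, Complex.re_add_im]

variable (B : InvInner 𝔤)

/-- The real inner product on `𝔤_ℂ = 𝔤 ⊕ i 𝔤`. -/
def InvInner.re (X Y : Cx 𝔤) : ℝ := B.form (cxRe X) (cxRe Y) + B.form (cxIm X) (cxIm Y)

theorem InvInner.nonneg (X : 𝔤) : 0 ≤ B.form X X := by
  by_cases h : X = 0
  · simp [h]
  · exact (B.pos X h).le

theorem InvInner.eq_zero_of_re (X : Cx 𝔤) (h : B.re X X = 0) : X = 0 := by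
  have h1 := B.nonneg (cxRe X)
  have h2 := B.nonneg (cxIm X)
  unfold InvInner.re at h
  have h3 : cxRe X = 0 := by
    by_contra hne; have := B.pos _ hne; linarith
  have h4 : cxIm X = 0 := by
    by_contra hne; have := B.pos _ hne; linarith
  rw [cx_eq X, h3, h4]
  simp [cxMk]; rfl

theorem InvInner.re_lie (H : 𝔤) (X Y : Cx 𝔤) :
    B.re ⁅cxMk 1 H, X⁆ Y = - B.re X ⁅cxMk 1 H, Y⁆ := by
  simp only [InvInner.re, cxRe_lie, cxIm_lie, B.inv]; ring

theorem InvInner.re_smul (c : ℂ) (X Y : Cx 𝔤) :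
    B.re (c • X) Y = B.re X ((starRingEnd ℂ c) • Y) := by
  simp only [InvInner.re, cxRe_smul, cxIm_smul, map_add, map_sub, map_smul, LinearMap.add_apply,
    LinearMap.sub_apply, LinearMap.smul_apply, smul_eq_mul, Complex.conj_re, Complex.conj_im]
  ring

theorem InvInner.re_comm (X Y : Cx 𝔤) : B.re X Y = B.re Y X := by
  simp only [InvInner.re, B.symm (cxRe X), B.symm (cxIm X)]

theorem InvInner.re_sub_left (X Y Z : Cx 𝔤) : B.re (X - Y) Z = B.re X Z - B.re Y Z := by
  simp only [InvInner.re, map_sub, LinearMap.sub_apply]; ring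

theorem InvInner.re_sub_right (X Y Z : Cx 𝔤) : B.re Z (X - Y) = B.re Z X - B.re Z Y := by
  simp only [InvInner.re, map_sub]; ring

/-- The operator `ad H` on `𝔤_ℂ`. -/
def adCx (H : 𝔤) : Module.End ℂ (Cx 𝔤) where
  toFun X := ⁅cxMk 1 H, X⁆
  map_add' := lie_add _
  map_smul' c X := lie_smul c _ X

theorem eigen_imag (B : InvInner 𝔤) (H : 𝔤) (c : ℂ) (X : Cx 𝔤) (h : adCx H X = c • X) (hX : X ≠ 0) :
    c.re = 0 := by
  have h1 : B.re (adCx H X) X = - B.re X (adCx H X) := B.re_lie H X X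
  rw [B.re_comm X] at h1
  have h2 : B.re (c • X) X = 0 := by rw [← h]; linarith
  have h3 : B.re (c • X) X = c.re * B.re X X := by
    simp only [InvInner.re, cxRe_smul, cxIm_smul, map_add, map_sub, map_smul, LinearMap.add_apply,
      LinearMap.sub_apply, LinearMap.smul_apply, smul_eq_mul, B.symm (cxIm X) (cxRe X)]
    ring
  rw [h3] at h2
  exact (mul_eq_zero.mp h2).resolve_right fun h => hX (B.eq_zero_of_re X h)

theorem eigen_sq (B : InvInner 𝔤) (H : 𝔤) (c : ℂ) (X : Cx 𝔤)
    (h : adCx H (adCx H X - c • X) = c • (adCx H X - c • X)) : adCx H X = c • X := by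
  by_contra hne
  have hne' : adCx H X - c • X ≠ 0 := sub_ne_zero.mpr hne
  have hc := eigen_imag B H c _ h hne'
  apply hne'
  apply B.eq_zero_of_re
  have hconj : (starRingEnd ℂ c) = - c := by
    apply Complex.ext <;> simp [hc]
  have h1 : B.re (adCx H X) (adCx H X - c • X) = - B.re X (adCx H (adCx H X - c • X)) :=
    B.re_lie H X _
  have h2 := B.re_smul c X (adCx H X - c • X)
  rw [hconj, neg_smul] at h2
  have h4 (Z : Cx 𝔤) : B.re X (-Z) = - B.re X Z := by
    simp only [InvInner.re, map_neg]; ring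
  rw [h4] at h2
  rw [B.re_sub_left, h1, h2, h]; ring

theorem maxGen_eq (B : InvInner 𝔤) (H : 𝔤) (c : ℂ) :
    (adCx H).maxGenEigenspace c = (adCx (𝔤 := 𝔤) H).eigenspace c := by
  apply le_antisymm
  · intro X hX
    obtain ⟨k, hk⟩ := (Module.End.mem_maxGenEigenspace _ _ _).mp hX
    rw [Module.End.mem_eigenspace_iff]
    have key : ∀ k X, ((adCx (𝔤 := 𝔤) H - c • 1 : Module.End ℂ (Cx 𝔤)) ^ k) X = 0 → adCx H X = c • X := by
      intro k
      induction k with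
      | zero => intro X h; simp at h; simp [h]
      | succ k ih =>
        intro X h
        rw [pow_succ, Module.End.mul_apply] at h
        exact eigen_sq B H c X (ih _ h)
    exact key k X hk
  · exact (adCx H).genEigenspace_le_maximal c 1

theorem mem_rootSpace (𝔱 : LieSubalgebra ℝ 𝔤) (α : Module.Dual ℝ 𝔱) (X : Cx 𝔤) :
    X ∈ rootSpace 𝔱 α ↔ ∀ H : 𝔱, adCx (H : 𝔤) X = (Complex.I * (α H : ℂ)) • X := Iff.rfl

theorem rootSpace_eq (B : InvInner 𝔤) (𝔱 : LieSubalgebra ℝ 𝔤) (α : Module.Dual ℝ 𝔱) :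
    rootSpace 𝔱 α = ⨅ H : 𝔱, (adCx (H : 𝔤)).maxGenEigenspace (Complex.I * (α H : ℂ)) := by
  ext X
  simp only [mem_rootSpace, Submodule.mem_iInf, maxGen_eq B, Module.End.mem_eigenspace_iff]

namespace CartanChoice
variable (D : CartanChoice 𝔤)

theorem commute_ad (H K : D.torus) : Commute (adCx (H : 𝔤)) (adCx (K : 𝔤)) := by
  ext X
  change ⁅cxMk 1 (H : 𝔤), ⁅cxMk 1 (K : 𝔤), X⁆⁆ = ⁅cxMk 1 (K : 𝔤), ⁅cxMk 1 (H : 𝔤), X⁆⁆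
  rw [leibniz_lie, cxMk_lie, D.abelian H H.2 K K.2]
  have : cxMk (1 * 1) (0 : 𝔤) = 0 := TensorProduct.tmul_zero ..
  rw [this, zero_lie, zero_add]

theorem iSupIndep_rootSpace (B : InvInner 𝔤) : iSupIndep (rootSpace D.torus) := by
  have h := Module.End.independent_iInf_maxGenEigenspace_of_forall_mapsTo
    (fun H : D.torus => adCx (H : 𝔤))
    (fun H K c => Module.End.mapsTo_maxGenEigenspace_of_comm (D.commute_ad K H) c)
  have h2 := h.comp (f := fun (α : Module.Dual ℝ D.torus) (H : D.torus) =>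
    (Complex.I * (α H : ℂ))) (by
      intro α β hαβ
      ext H
      have := congrFun hαβ H
      simpa using this)
  convert h2 using 1
  ext1 α
  exact rootSpace_eq B D.torus α

theorem finite_roots (B : InvInner 𝔤) [FiniteDimensional ℝ 𝔤] : {α | IsRoot D.torus α}.Finite := by
  have : FiniteDimensional ℂ (Cx 𝔤) := inferInstanceAs (FiniteDimensional ℂ (ℂ ⊗[ℝ] 𝔤))
  exact (WellFoundedGT.finite_ne_bot_of_iSupIndep (D.iSupIndep_rootSpace B)).subset
    fun α hα => hα.2

theorem mem_torusCx_of_zero (X : Cx 𝔤) (h : ∀ H : D.torus, adCx (H : 𝔤) X = 0) :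
    X ∈ D.torusCx := by
  have h1 : cxRe X ∈ D.torus := D.maximal _ fun H hH => by
    rw [← cxRe_lie]
    have := h ⟨H, hH⟩
    change ⁅cxMk 1 H, X⁆ = 0 at this
    rw [this, map_zero]
  have h2 : cxIm X ∈ D.torus := D.maximal _ fun H hH => by
    rw [← cxIm_lie]
    have := h ⟨H, hH⟩
    change ⁅cxMk 1 H, X⁆ = 0 at this
    rw [this, map_zero]
  rw [cx_eq X]
  refine add_mem (Submodule.subset_span ⟨_, h1, rfl⟩) ?_
  have : cxMk Complex.I (cxIm X) = Complex.I • cxMk 1 (cxIm X) := by rw [smul_cxMk, mul_one]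
  rw [this]
  exact Submodule.smul_mem _ _ (Submodule.subset_span ⟨_, h2, rfl⟩)

theorem rootSpace_le (α : Module.Dual ℝ D.torus) :
    rootSpace D.torus α ≤ (adCx (D.reg : 𝔤)).eigenspace (Complex.I * (α D.reg : ℂ)) :=
  fun _ hX => Module.End.mem_eigenspace_iff.mpr (hX D.reg)

theorem torusCx_le : D.torusCx ≤ (adCx (D.reg : 𝔤)).eigenspace 0 := by
  refine Submodule.span_le.mpr ?_
  rintro _ ⟨H, hH, rfl⟩
  rw [SetLike.mem_coe, Module.End.mem_eigenspace_iff, zero_smul]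
  change ⁅cxMk 1 (D.reg : 𝔤), cxMk 1 H⁆ = 0
  rw [cxMk_lie, D.abelian _ D.reg.2 _ hH]
  exact TensorProduct.tmul_zero ..

theorem nPlus_le : D.nPlus ≤ ⨆ c ∈ {c : ℂ | 0 < c.im}, (adCx (D.reg : 𝔤)).eigenspace c :=
  iSup₂_le fun α hα => (D.rootSpace_le α).trans <|
    le_biSup (fun c => (adCx (D.reg : 𝔤)).eigenspace c)
      (show Complex.I * (α D.reg : ℂ) ∈ {c : ℂ | 0 < c.im} by simpa using hα.2)

theorem nMinus_le : D.nMinus ≤ ⨆ c ∈ {c : ℂ | c.im < 0}, (adCx (D.reg : 𝔤)).eigenspace c :=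
  iSup₂_le fun α hα => (D.rootSpace_le α).trans <|
    le_biSup (fun c => (adCx (D.reg : 𝔤)).eigenspace c)
      (show Complex.I * (α D.reg : ℂ) ∈ {c : ℂ | c.im < 0} by simpa using hα.2)

theorem disjoint_aux {S T : Set ℂ} (hST : Disjoint S T) {p q : Submodule ℂ (Cx 𝔤)}
    (hp : p ≤ ⨆ c ∈ S, (adCx (D.reg : 𝔤)).eigenspace c)
    (hq : q ≤ ⨆ c ∈ T, (adCx (D.reg : 𝔤)).eigenspace c) : Disjoint p q :=
  (((adCx (D.reg : 𝔤)).eigenspaces_iSupIndep).disjoint_biSup_biSup hST).mono hp hq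

theorem torusCx_le' : D.torusCx ≤ ⨆ c ∈ ({0} : Set ℂ), (adCx (D.reg : 𝔤)).eigenspace c := by
  rw [iSup_singleton]; exact D.torusCx_le

theorem sup_eq_top (B : InvInner 𝔤) [FiniteDimensional ℝ 𝔤] : D.torusCx ⊔ D.nPlus ⊔ D.nMinus = ⊤ := by
  have : FiniteDimensional ℂ (Cx 𝔤) := inferInstanceAs (FiniteDimensional ℂ (ℂ ⊗[ℝ] 𝔤))
  have h := Module.End.iSup_iInf_maxGenEigenspace_eq_top_of_iSup_maxGenEigenspace_eq_top_of_commute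
    (fun H : D.torus => adCx (H : 𝔤)) (fun H K _ => D.commute_ad H K)
    (fun H => Module.End.iSup_maxGenEigenspace_eq_top _)
  rw [eq_top_iff, ← h]
  refine iSup_le fun χ X hX => ?_
  simp only [Submodule.mem_iInf, maxGen_eq B, Module.End.mem_eigenspace_iff] at hX
  by_cases hX0 : X = 0
  · rw [hX0]; exact zero_mem _
  have him : ∀ H, χ H = Complex.I * ((χ H).im : ℂ) := by
    intro H
    have := eigen_imag B (H : 𝔤) _ X (hX H) hX0
    apply Complex.ext <;> simp [this]
  let α : Module.Dual ℝ D.torus :=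
    { toFun := fun H => (χ H).im
      map_add' := by
        intro H K
        have h1 : χ (H + K) • X = (χ H + χ K) • X := by
          rw [← hX, add_smul, ← hX, ← hX]
          change ⁅cxMk 1 ((H : 𝔤) + (K : 𝔤)), X⁆ = _
          rw [cxMk_add, add_lie]; rfl
        rw [smul_left_injective ℂ hX0 h1, Complex.add_im]
      map_smul' := by
        intro r H
        have h1 : χ (r • H) • X = ((r : ℂ) * χ H) • X := by
          rw [← hX, mul_smul, ← hX]
          change ⁅cxMk 1 (r • (H : 𝔤)), X⁆ = _
          rw [cxMk_smul, ← smul_cxMk, smul_lie]; rfl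
        rw [smul_left_injective ℂ hX0 h1]
        simp }
  have hα : X ∈ rootSpace D.torus α := fun H => by
    have := hX H
    rw [him H] at this
    exact this
  by_cases h0 : α = 0
  · refine Submodule.mem_sup_left (Submodule.mem_sup_left (D.mem_torusCx_of_zero X fun H => ?_))
    have := hα H
    rw [h0] at this
    change adCx (H : 𝔤) X = _ at this
    rw [this]; simp
  · have hr : IsRoot D.torus α := ⟨h0, fun hb => hX0 (by rw [hb] at hα; exact hα)⟩
    rcases lt_or_gt_of_ne (D.regular α hr) with hlt | hgt
    · exact Submodule.mem_sup_right (Submodule.mem_iSup_of_mem α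
        (Submodule.mem_iSup_of_mem ⟨hr, hlt⟩ hα))
    · exact Submodule.mem_sup_left (Submodule.mem_sup_right (Submodule.mem_iSup_of_mem α
        (Submodule.mem_iSup_of_mem ⟨hr, hgt⟩ hα)))

theorem isCompl_nPlus (B : InvInner 𝔤) [FiniteDimensional ℝ 𝔤] : IsCompl D.nPlus (D.torusCx ⊔ D.nMinus) := by
  constructor
  · refine D.disjoint_aux (S := {c | 0 < c.im}) (T := {c | c.im ≤ 0}) ?_ D.nPlus_le ?_
    · rw [Set.disjoint_left]; intro c hc hc'; exact absurd (show 0 < c.im from hc) (not_lt_of_ge hc')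
    · refine sup_le (D.torusCx_le'.trans ?_) (D.nMinus_le.trans ?_)
      · exact biSup_mono fun c hc => by rw [Set.mem_singleton_iff.mp hc]; simp
      · exact biSup_mono fun c hc => (show c.im < 0 from hc).le
  · rw [codisjoint_iff, ← D.sup_eq_top B, sup_left_comm, sup_assoc]

theorem isCompl_torusCx (B : InvInner 𝔤) [FiniteDimensional ℝ 𝔤] : IsCompl D.torusCx (D.nPlus ⊔ D.nMinus) := by
  constructor
  · refine D.disjoint_aux (S := {0}) (T := {c | c.im ≠ 0}) ?_ D.torusCx_le' ?_
    · rw [Set.disjoint_left]; intro c hc hc'; exact hc' (by rw [Set.mem_singleton_iff.mp hc]; simp)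
    · refine sup_le (D.nPlus_le.trans ?_) (D.nMinus_le.trans ?_)
      · exact biSup_mono fun c hc => ne_of_gt hc
      · exact biSup_mono fun c hc => ne_of_lt hc
  · rw [codisjoint_iff, ← D.sup_eq_top B, sup_assoc]

end CartanChoice
end Roots

section Spin
variable {𝔤 : Type*} [LieRing 𝔤] [LieAlgebra ℝ 𝔤]

theorem Loop.induct_mode {p : Loop 𝔤 → Prop} (ξ : Loop 𝔤) (h0 : p 0)
    (hadd : ∀ ξ η, p ξ → p η → p (ξ + η)) (hmk : ∀ k X, p (mode k X)) : p ξ := by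
  obtain ⟨f, rfl⟩ := (fourier (𝔤 := 𝔤)).symm.surjective ξ
  induction f using Finsupp.induction_linear with
  | zero => simpa using h0
  | add f g hf hg => rw [map_add]; exact hadd _ _ hf hg
  | single k X =>
    have : fourier.symm (Finsupp.single k X) = mode k X := by
      rw [LinearEquiv.symm_apply_eq, fourier_mode]
    rw [this]; exact hmk k X

theorem loop_const (B : InvInner 𝔤) (X : Cx 𝔤) (ξ : Loop 𝔤) : B.loop (mode 0 X) ξ = B.cx X (fourier ξ 0) := by
  induction ξ using Loop.induct_mode with
  | h0 => simp
  | hadd a b ha hb => simp only [map_add, Finsupp.add_apply, ha, hb]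
  | hmk k Y =>
    rw [B.loop_mode, fourier_mode, Finsupp.single_apply]
    by_cases h : k = 0 <;> simp [h]

variable [FiniteDimensional ℝ 𝔤]

namespace CartanChoice

variable (D : CartanChoice 𝔤) (B : InvInner 𝔤)

/-- The inner product on `𝔱`. -/
def torusForm : LinearMap.BilinForm ℝ D.torus :=
  B.form.compl₁₂ D.torus.toSubmodule.subtype D.torus.toSubmodule.subtype

theorem torusForm_nondegenerate : (D.torusForm B).Nondegenerate := by
  have hsep : ∀ H : D.torus, (∀ K, D.torusForm B H K = 0) → H = 0 := by
    intro H hH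
    by_contra hne
    have h1 : B.form (H : 𝔤) (H : 𝔤) = 0 := hH H
    have h2 := B.pos (H : 𝔤) fun h => hne (Subtype.ext h)
    exact h2.ne' h1
  refine ⟨hsep, fun H hH => hsep H fun K => ?_⟩
  have h1 : B.form (K : 𝔤) (H : 𝔤) = 0 := hH K
  exact (B.symm _ _).trans h1

/-- The inner product on the dual of `𝔱` obtained by identifying `𝔱` with its dual. -/
def dualInner (α β : Module.Dual ℝ D.torus) : ℝ :=
  D.torusForm B (((D.torusForm B).toDual (D.torusForm_nondegenerate B)).symm α)
    (((D.torusForm B).toDual (D.torusForm_nondegenerate B)).symm β)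

theorem finite_posRoots (B : InvInner 𝔤) : D.posRoots.Finite := (D.finite_roots B).subset fun _ h => h.1

/-- Half the sum of the positive roots. -/
def rho : Module.Dual ℝ D.torus := (1 / 2 : ℝ) • ∑ α ∈ (D.finite_posRoots B).toFinset, α

/-- The orthogonal complement of the constant loops in `𝔱` inside the complexified loop algebra. -/
def loopModTorus : Submodule ℂ (Loop 𝔤) where
  carrier := {ξ | ∀ H ∈ D.torus, B.loop (mode 0 (cxMk 1 H)) ξ = 0}
  add_mem' := by
    intro ξ η hξ hη H hH
    rw [map_add, hξ H hH, hη H hH, add_zero]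
  zero_mem' := by intro H _; simp
  smul_mem' := by
    intro c ξ hξ H hH
    rw [map_smul, hξ H hH, smul_zero]

/-- The sum of the positive affine root spaces: the constant loops in the sum of the positive root
spaces, and the spaces `𝔤_ℂ z ^ k` for `k > 0`. -/
def posLoops : Submodule ℂ (Loop 𝔤) where
  carrier := {ξ | fourier ξ 0 ∈ D.nPlus ∧ ∀ k < 0, fourier ξ k = 0}
  add_mem' := by
    rintro ξ η ⟨h1, h2⟩ ⟨h3, h4⟩
    refine ⟨?_, fun k hk => ?_⟩
    · rw [map_add, Finsupp.add_apply]; exact add_mem h1 h3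
    · rw [map_add, Finsupp.add_apply, h2 k hk, h4 k hk, add_zero]
  zero_mem' := by simp
  smul_mem' := by
    rintro c ξ ⟨h1, h2⟩
    refine ⟨?_, fun k hk => ?_⟩
    · rw [map_smul, Finsupp.smul_apply]; exact Submodule.smul_mem _ _ h1
    · rw [map_smul, Finsupp.smul_apply, h2 k hk, smul_zero]

/-- The projection of `𝔤_ℂ` to the sum of the positive root spaces along the other root spaces and
`𝔱_ℂ`. -/
def projPlus : Cx 𝔤 →ₗ[ℂ] Cx 𝔤 := Submodule.projection _ _ (D.isCompl_nPlus B)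

/-- The projection of `𝔤_ℂ` to `𝔱_ℂ` along all root spaces. -/
def projTorus : Cx 𝔤 →ₗ[ℂ] D.torusCx := Submodule.projectionOnto _ _ (D.isCompl_torusCx B)

/-- The effect of `projLoop` on the coefficient of `z ^ k`. -/
def projCoeff (k : ℤ) : Cx 𝔤 →ₗ[ℂ] Cx 𝔤 :=
  if 0 < k then LinearMap.id else if k = 0 then D.projPlus B else 0

/-- The projection of the loop algebra to the sum of the positive affine root spaces along the
remaining affine root spaces and `𝔱_ℂ`. -/
def projLoop : Loop 𝔤 →ₗ[ℂ] Loop 𝔤 :=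
  fourier.symm.toLinearMap ∘ₗ
    Finsupp.lsum ℂ (fun k => Finsupp.lsingle k ∘ₗ D.projCoeff B k) ∘ₗ fourier.toLinearMap

theorem fourier_projLoop (ξ : Loop 𝔤) (k : ℤ) :
    fourier (D.projLoop B ξ) k = D.projCoeff B k (fourier ξ k) := by
  simp only [projLoop, LinearMap.comp_apply, LinearEquiv.coe_coe, LinearEquiv.apply_symm_apply]
  generalize fourier ξ = f
  induction f using Finsupp.induction_linear with
  | zero => simp
  | add f g hf hg => simp only [map_add, Finsupp.add_apply, hf, hg]
  | single j X =>
    rw [Finsupp.lsum_single]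
    by_cases h : j = k
    · subst h; simp
    · simp [Finsupp.single_apply, h]

theorem projLoop_mem (ξ : Loop 𝔤) : D.projLoop B ξ ∈ D.posLoops := by
  refine ⟨?_, fun k hk => ?_⟩
  · rw [fourier_projLoop]
    simp [projCoeff, projPlus]
  · rw [fourier_projLoop]
    simp [projCoeff, hk.ne, not_lt_of_gt hk]

/-- The exterior algebra of the sum of the positive affine root spaces. The one-dimensional factor
(the inverse square root of the determinant of the positive root spaces) by which it is often
twisted, to fix the action of the torus, carries no Clifford action and is left out. -/
abbrev Fock : Type _ := ExteriorAlgebra ℂ D.posLoops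

/-- Exterior multiplication by the positive energy part plus (twice) interior multiplication by the
negative energy part. The factor 2 gives `ξ η + η ξ = 2 ⟨ξ, η⟩`, and the interior multiplication
by `ξ` pairs only the part of `ξ` in the negative affine root spaces with the positive ones. -/
def fockOp : Loop 𝔤 →ₗ[ℂ] Module.End ℂ D.Fock :=
  LinearMap.mul ℂ D.Fock ∘ₗ ExteriorAlgebra.ι ℂ ∘ₗ
      (D.projLoop B).codRestrict D.posLoops (D.projLoop_mem B)
    + (2 : ℂ) • (CliffordAlgebra.contractLeft ∘ₗ B.loop.compl₂ D.posLoops.subtype)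

/-! The Clifford relation for `fockOp`. -/

theorem cx_rootSpace (B : InvInner 𝔤) {α β : Module.Dual ℝ D.torus} {X Y : Cx 𝔤}
    (hX : X ∈ rootSpace D.torus α) (hY : Y ∈ rootSpace D.torus β) (h : α D.reg + β D.reg ≠ 0) :
    B.cx X Y = 0 := by
  have h1 := B.cx_inv (cxMk 1 (D.reg : 𝔤)) X Y
  rw [hX D.reg, hY D.reg, map_smul, map_smul, LinearMap.smul_apply, smul_eq_mul, smul_eq_mul] at h1
  have h2 : Complex.I * ((α D.reg + β D.reg : ℝ) : ℂ) * B.cx X Y = 0 := by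
    push_cast; linear_combination h1
  refine (mul_eq_zero.mp h2).resolve_left (mul_ne_zero Complex.I_ne_zero ?_)
  exact_mod_cast h

theorem torusCx_le_rootSpace : D.torusCx ≤ rootSpace D.torus 0 := by
  refine Submodule.span_le.mpr ?_
  rintro _ ⟨K, hK, rfl⟩ H
  rw [cxMk_lie, D.abelian _ H.2 _ hK]
  have : cxMk (1 * 1) (0 : 𝔤) = 0 := TensorProduct.tmul_zero ..
  rw [this]; simp

theorem cx_iSup {S T : Set (Module.Dual ℝ D.torus)}
    (h : ∀ α ∈ S, ∀ β ∈ T, α D.reg + β D.reg ≠ 0) {X Y : Cx 𝔤}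
    (hX : X ∈ ⨆ α ∈ S, rootSpace D.torus α) (hY : Y ∈ ⨆ α ∈ T, rootSpace D.torus α) :
    B.cx X Y = 0 := by
  have h1 : (⨆ α ∈ S, rootSpace D.torus α) ≤ LinearMap.ker (B.cx.flip Y) := by
    refine iSup₂_le fun α hα Z hZ => ?_
    have h2 : (⨆ α ∈ T, rootSpace D.torus α) ≤ LinearMap.ker (B.cx Z) :=
      iSup₂_le fun β hβ Z' hZ' => D.cx_rootSpace B hZ hZ' (h α hα β hβ)
    exact h2 hY
  exact h1 hX

theorem cx_nPlus {X Y : Cx 𝔤} (hX : X ∈ D.nPlus) (hY : Y ∈ D.nPlus) : B.cx X Y = 0 :=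
  D.cx_iSup B (fun _ hα _ hβ => (add_pos hα.2 hβ.2).ne') hX hY

theorem cx_nMinus {X Y : Cx 𝔤} (hX : X ∈ D.nMinus) (hY : Y ∈ D.nMinus) : B.cx X Y = 0 :=
  D.cx_iSup B (fun _ hα _ hβ => (add_neg hα.2 hβ.2).ne) hX hY

theorem mem_iSup_zero {X : Cx 𝔤} (hX : X ∈ D.torusCx) :
    X ∈ ⨆ α ∈ ({0} : Set (Module.Dual ℝ D.torus)), rootSpace D.torus α := by
  rw [iSup_singleton]; exact D.torusCx_le_rootSpace hX

theorem cx_torus_nPlus {X Y : Cx 𝔤} (hX : X ∈ D.torusCx) (hY : Y ∈ D.nPlus) : B.cx X Y = 0 := by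
  refine D.cx_iSup B (fun α hα β hβ => ?_) (D.mem_iSup_zero hX) hY
  rw [Set.mem_singleton_iff.mp hα]
  simpa using hβ.2.ne'

theorem cx_torus_nMinus {X Y : Cx 𝔤} (hX : X ∈ D.torusCx) (hY : Y ∈ D.nMinus) :
    B.cx X Y = 0 := by
  refine D.cx_iSup B (fun α hα β hβ => ?_) (D.mem_iSup_zero hX) hY
  rw [Set.mem_singleton_iff.mp hα]
  simpa using hβ.2.ne

theorem projPlus_mem (X : Cx 𝔤) : D.projPlus B X ∈ D.nPlus := by simp [projPlus]

/-- The decomposition of an element of `𝔤_ℂ`. -/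
theorem exists_decomp (X : Cx 𝔤) :
    ∃ N ∈ D.nMinus, X = (D.projTorus B X : Cx 𝔤) + D.projPlus B X + N := by
  have hX : X ∈ D.torusCx ⊔ D.nPlus ⊔ D.nMinus := by rw [D.sup_eq_top B]; trivial
  obtain ⟨Y, hY, N, hN, rfl⟩ := Submodule.mem_sup.mp hX
  obtain ⟨T, hT, P, hP, rfl⟩ := Submodule.mem_sup.mp hY
  refine ⟨N, hN, ?_⟩
  have h1 : D.projPlus B P = P := by
    simp only [projPlus]
    exact Submodule.projection_apply_left (D.isCompl_nPlus B) ⟨P, hP⟩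
  have h2 : D.projPlus B T = 0 := by
    simp only [projPlus]
    exact (Submodule.projection_apply_eq_zero_iff _).mpr (Submodule.mem_sup_left hT)
  have h3 : D.projPlus B N = 0 := by
    simp only [projPlus]
    exact (Submodule.projection_apply_eq_zero_iff _).mpr (Submodule.mem_sup_right hN)
  have h4 : (D.projTorus B T : Cx 𝔤) = T := by
    simp only [projTorus]
    exact congrArg Subtype.val (Submodule.projectionOnto_apply_left (D.isCompl_torusCx B) ⟨T, hT⟩)
  have h5 : D.projTorus B P = 0 := by
    simp only [projTorus]
    exact (Submodule.projectionOnto_apply_eq_zero_iff _).mpr (Submodule.mem_sup_left hP)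
  have h6 : D.projTorus B N = 0 := by
    simp only [projTorus]
    exact (Submodule.projectionOnto_apply_eq_zero_iff _).mpr (Submodule.mem_sup_right hN)
  simp only [map_add, h1, h2, h3, h4, h5, h6, Submodule.coe_add, ZeroMemClass.coe_zero]
  abel

theorem cx_proj (X Y : Cx 𝔤) :
    B.cx X (D.projPlus B Y) + B.cx (D.projPlus B X) Y
      + B.cx (D.projTorus B X) (D.projTorus B Y) = B.cx X Y := by
  obtain ⟨N, hN, hX⟩ := D.exists_decomp B X
  obtain ⟨M, hM, hY⟩ := D.exists_decomp B Y
  have hP := D.projPlus_mem B X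
  have hQ := D.projPlus_mem B Y
  have hT := (D.projTorus B X).2
  have hU := (D.projTorus B Y).2
  set P := D.projPlus B X
  set Q := D.projPlus B Y
  set T := (D.projTorus B X : Cx 𝔤)
  set U := (D.projTorus B Y : Cx 𝔤)
  rw [hX, hY]
  simp only [map_add, LinearMap.add_apply, D.cx_nPlus B hP hQ, D.cx_nMinus B hN hM,
    D.cx_torus_nPlus B hT hQ, D.cx_torus_nMinus B hT hM, B.cx_symm P U, B.cx_symm N U,
    D.cx_torus_nPlus B hU hP, D.cx_torus_nMinus B hU hN]
  ring

theorem projLoop_mode (k : ℤ) (X : Cx 𝔤) :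
    D.projLoop B (mode k X) = mode k (D.projCoeff B k X) := by
  apply fourier.injective
  ext1 j
  rw [fourier_projLoop, fourier_mode, fourier_mode]
  by_cases h : k = j
  · subst h; simp
  · simp [Finsupp.single_apply, h]

theorem loop_proj (ξ η : Loop 𝔤) :
    B.loop ξ (D.projLoop B η) + B.loop (D.projLoop B ξ) η
      + B.cx (D.projTorus B (fourier ξ 0)) (D.projTorus B (fourier η 0)) = B.loop ξ η := by
  induction ξ using Loop.induct_mode with
  | h0 => simp
  | hadd a b ha hb =>
    simp only [map_add, LinearMap.add_apply, Finsupp.add_apply, Submodule.coe_add, ← ha, ← hb]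
    ring
  | hmk j X =>
    induction η using Loop.induct_mode with
    | h0 => simp
    | hadd a b ha hb =>
      simp only [map_add, Finsupp.add_apply, Submodule.coe_add, ← ha, ← hb]
      ring
    | hmk k Y =>
      simp only [projLoop_mode, B.loop_mode, fourier_mode, Finsupp.single_apply]
      by_cases hjk : j + k = 0
      · rcases lt_trichotomy k 0 with hk | hk | hk
        · have hj : 0 < j := by omega
          simp [projCoeff, hjk, hj, hj.ne', hk.ne, not_lt_of_gt hk]
        · have hj : j = 0 := by omega
          subst hk; subst hj
          simpa [projCoeff] using D.cx_proj B X Y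
        · have hj : j < 0 := by omega
          simp [projCoeff, hjk, hj.ne, hk, hk.ne', not_lt_of_gt hj]
      · by_cases hj : j = 0
        · have hk : k ≠ 0 := by omega
          simp [hj, hk]
        · simp [hjk, hj]

theorem fockOp_apply (ξ : Loop 𝔤) (x : D.Fock) :
    D.fockOp B ξ x = ExteriorAlgebra.ι ℂ ⟨D.projLoop B ξ, D.projLoop_mem B ξ⟩ * x
      + (2 : ℂ) • CliffordAlgebra.contractLeft (B.loop ξ ∘ₗ D.posLoops.subtype) x := rfl

theorem contract_ι_mul (f : Module.Dual ℂ D.posLoops) (w : D.posLoops) (x : D.Fock) :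
    CliffordAlgebra.contractLeft f (ExteriorAlgebra.ι ℂ w * x)
      = f w • x - ExteriorAlgebra.ι ℂ w * CliffordAlgebra.contractLeft f x :=
  CliffordAlgebra.contractLeft_ι_mul f w x

theorem fockOp_sq (ξ : Loop 𝔤) (x : D.Fock) :
    D.fockOp B ξ (D.fockOp B ξ x) = (2 * B.loop ξ (D.projLoop B ξ)) • x := by
  set w : D.posLoops := ⟨D.projLoop B ξ, D.projLoop_mem B ξ⟩ with hw
  set f : Module.Dual ℂ D.posLoops := B.loop ξ ∘ₗ D.posLoops.subtype with hf
  have hfw : f w = B.loop ξ (D.projLoop B ξ) := rfl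
  have h0 : ExteriorAlgebra.ι ℂ w * (ExteriorAlgebra.ι ℂ w * x) = 0 := by
    rw [← mul_assoc, ExteriorAlgebra.ι_sq_zero, zero_mul]
  have h1 : CliffordAlgebra.contractLeft f (CliffordAlgebra.contractLeft f x) = 0 :=
    CliffordAlgebra.contractLeft_contractLeft f x
  have h2 := D.contract_ι_mul f w x
  rw [fockOp_apply, fockOp_apply, ← hw, ← hf, map_add, map_smul, h1, h2, mul_add, h0, hfw]
  rw [mul_smul_comm, smul_zero, zero_add, add_zero, smul_sub, mul_smul]
  abel

/-- The operator `(-1) ^ F`. -/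
def parity : Module.End ℂ D.Fock :=
  (CliffordAlgebra.involute (Q := (0 : QuadraticForm ℂ D.posLoops))).toLinearMap

theorem parity_sq (x : D.Fock) : D.parity (D.parity x) = x := CliffordAlgebra.involute_involute x

theorem parity_ι_mul (w : D.posLoops) (x : D.Fock) :
    D.parity (ExteriorAlgebra.ι ℂ w * x) = - (ExteriorAlgebra.ι ℂ w * D.parity x) := by
  have h : D.parity (ExteriorAlgebra.ι ℂ w * x) = CliffordAlgebra.involute
    (CliffordAlgebra.ι (0 : QuadraticForm ℂ D.posLoops) w) * D.parity x :=
    map_mul (CliffordAlgebra.involute (Q := (0 : QuadraticForm ℂ D.posLoops))) _ _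
  rw [h, CliffordAlgebra.involute_ι, neg_mul]

theorem parity_contract (f : Module.Dual ℂ D.posLoops) (x : D.Fock) :
    D.parity (CliffordAlgebra.contractLeft f x) = - CliffordAlgebra.contractLeft f (D.parity x) := by
  induction x using CliffordAlgebra.left_induction with
  | algebraMap r =>
    have h1 : D.parity (algebraMap ℂ _ r) = algebraMap ℂ _ r :=
      AlgHom.commutes (CliffordAlgebra.involute (Q := (0 : QuadraticForm ℂ D.posLoops))) r
    rw [h1, CliffordAlgebra.contractLeft_algebraMap, map_zero, neg_zero]
  | add x y hx hy => rw [map_add, map_add, map_add, map_add, hx, hy, neg_add]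
  | ι_mul x m hx =>
    have h1 := D.contract_ι_mul f m x
    have h2 := D.parity_ι_mul m x
    have h3 := D.contract_ι_mul f m (D.parity x)
    have h4 := D.parity_ι_mul m (CliffordAlgebra.contractLeft f x)
    change D.parity (CliffordAlgebra.contractLeft f (ExteriorAlgebra.ι ℂ m * x)) =
      - CliffordAlgebra.contractLeft f (D.parity (ExteriorAlgebra.ι ℂ m * x))
    rw [h1, h2, map_sub, map_smul, h4, map_neg, h3, hx, mul_neg]
    abel

theorem parity_fockOp (ξ : Loop 𝔤) (x : D.Fock) :
    D.parity (D.fockOp B ξ x) = - D.fockOp B ξ (D.parity x) := by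
  rw [fockOp_apply, fockOp_apply, map_add, map_smul, parity_ι_mul, parity_contract, neg_add,
    smul_neg]

end CartanChoice

/-- The quadratic form `v ↦ ⟨v, v⟩` on a space of loops. In its Clifford algebra
`ξ η + η ξ = 2 ⟨ξ, η⟩`. -/
def InvInner.quad (B : InvInner 𝔤) (V : Submodule ℂ (Loop 𝔤)) : QuadraticForm ℂ V :=
  LinearMap.BilinMap.toQuadraticMap (B.loop.compl₁₂ V.subtype V.subtype)

namespace CartanChoice

variable (D : CartanChoice 𝔤) (B : InvInner 𝔤)

/-- The quadratic form `H ↦ ⟨H, H⟩` on `𝔱_ℂ`. -/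
def torusQuad : QuadraticForm ℂ D.torusCx :=
  LinearMap.BilinMap.toQuadraticMap (B.cx.compl₁₂ D.torusCx.subtype D.torusCx.subtype)

theorem cx_projTorus_eq_zero (ξ : Loop 𝔤) (h : ξ ∈ D.loopModTorus B) :
    B.cx (D.projTorus B (fourier ξ 0)) (D.projTorus B (fourier ξ 0)) = 0 := by
  have h1 : ∀ T ∈ D.torusCx, B.cx T (D.projTorus B (fourier ξ 0)) = 0 := by
    intro T hT
    induction hT using Submodule.span_induction with
    | zero => simp
    | add _ _ _ _ ha hb => rw [map_add, LinearMap.add_apply, ha, hb, add_zero]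
    | smul c _ _ ha => rw [map_smul, LinearMap.smul_apply, ha, smul_zero]
    | mem _ hT =>
      obtain ⟨H, hH, rfl⟩ := hT
      have hmem : cxMk 1 H ∈ D.torusCx := Submodule.subset_span ⟨H, hH, rfl⟩
      have h2 := h H hH
      obtain ⟨N, hN, hdec⟩ := D.exists_decomp B (fourier ξ 0)
      rw [loop_const, hdec, map_add, map_add, D.cx_torus_nMinus B hmem hN,
        D.cx_torus_nPlus B hmem (D.projPlus_mem B _), add_zero, add_zero] at h2
      exact h2
  exact h1 _ (D.projTorus B _).2

theorem two_mul_loop_proj (ξ : Loop 𝔤) :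
    2 * B.loop ξ (D.projLoop B ξ)
      + B.cx (D.projTorus B (fourier ξ 0)) (D.projTorus B (fourier ξ 0)) = B.loop ξ ξ := by
  have h := D.loop_proj B ξ ξ
  rw [B.loop_symm (D.projLoop B ξ)] at h
  rw [← h]; ring

/-- The positive energy spin representation `S_{L𝔤/𝔱}`: the Clifford algebra of the complement of
`𝔱` in the loop algebra acts on the exterior algebra of the sum of the positive affine root
spaces. -/
def spinModTorus : CliffordAlgebra (B.quad (D.loopModTorus B)) →ₐ[ℂ] Module.End ℂ D.Fock :=
  CliffordAlgebra.lift _ ⟨D.fockOp B ∘ₗ (D.loopModTorus B).subtype, fun ξ => LinearMap.ext fun x => by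
    have h := D.two_mul_loop_proj B (ξ : Loop 𝔤)
    rw [D.cx_projTorus_eq_zero B _ ξ.2, add_zero] at h
    rw [Module.algebraMap_end_apply]
    refine (D.fockOp_sq B (ξ : Loop 𝔤) x).trans ?_
    rw [h]; rfl⟩

section Full

variable (S : Type*) [AddCommGroup S] [Module ℂ S] [Module (CliffordAlgebra (D.torusQuad B)) S]
  [IsScalarTower ℂ (CliffordAlgebra (D.torusQuad B)) S]

/-- The action of a constant loop in `𝔱_ℂ` on a Clifford module of `𝔱_ℂ`. -/
def torusOp : D.torusCx →ₗ[ℂ] Module.End ℂ S :=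
  (Algebra.lsmul ℂ ℂ S).toLinearMap ∘ₗ CliffordAlgebra.ι (D.torusQuad B)

theorem torusOp_sq (T : D.torusCx) (s : S) :
    D.torusOp B S T (D.torusOp B S T s) = B.cx T T • s := by
  change CliffordAlgebra.ι (D.torusQuad B) T • CliffordAlgebra.ι (D.torusQuad B) T • s = _
  rw [smul_smul, CliffordAlgebra.ι_sq_scalar, algebraMap_smul]; rfl

/-- Clifford multiplication on `S ⊗ S_{L𝔤/𝔱}` for a Clifford module `S` of `𝔱_ℂ`. -/
def fullOp : Loop 𝔤 →ₗ[ℂ] Module.End ℂ (S ⊗[ℂ] D.Fock) :=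
  (TensorProduct.mapBilinear (RingHom.id ℂ) S D.Fock S D.Fock).flip D.parity ∘ₗ
      D.torusOp B S ∘ₗ D.projTorus B ∘ₗ Finsupp.lapply 0 ∘ₗ fourier.toLinearMap
    + TensorProduct.mapBilinear (RingHom.id ℂ) S D.Fock S D.Fock LinearMap.id ∘ₗ D.fockOp B

theorem fullOp_tmul (ξ : Loop 𝔤) (s : S) (x : D.Fock) :
    D.fullOp B S ξ (s ⊗ₜ x) = D.torusOp B S (D.projTorus B (fourier ξ 0)) s ⊗ₜ D.parity x
      + s ⊗ₜ D.fockOp B ξ x := rfl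

theorem fullOp_sq (ξ : Loop 𝔤) (x : S ⊗[ℂ] D.Fock) :
    D.fullOp B S ξ (D.fullOp B S ξ x) = B.loop ξ ξ • x := by
  induction x using TensorProduct.induction_on with
  | zero => simp
  | add x y hx hy => rw [map_add, map_add, hx, hy, smul_add]
  | tmul s x =>
    rw [fullOp_tmul, map_add, fullOp_tmul, fullOp_tmul, torusOp_sq, parity_sq, parity_fockOp,
      fockOp_sq, TensorProduct.tmul_neg, TensorProduct.tmul_smul, ← TensorProduct.smul_tmul',
      ← D.two_mul_loop_proj B ξ, add_smul]
    abel

/-- The spin representation `S_{L𝔤} = S_𝔱 ⊗ S_{L𝔤/𝔱}` of the Clifford algebra of the whole loop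
algebra, for a Clifford module `S` of `𝔱_ℂ`. -/
def spinFull : CliffordAlgebra (B.quad ⊤) →ₐ[ℂ] Module.End ℂ (S ⊗[ℂ] D.Fock) :=
  CliffordAlgebra.lift _ ⟨D.fullOp B S ∘ₗ (⊤ : Submodule ℂ (Loop 𝔤)).subtype,
    fun ξ => LinearMap.ext fun x => by
      rw [Module.algebraMap_end_apply]
      exact D.fullOp_sq B S (ξ : Loop 𝔤) x⟩

end Full

end CartanChoice

end Spin

section Level

variable {𝔤 : Type*} [LieRing 𝔤] [LieAlgebra ℝ 𝔤] {B : InvInner 𝔤}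

/-- The action of the extended Lie algebra on loops: `a ∂_θ + ξ + x I` sends `η` to
`a ∂_θ η + [ξ, η]`. -/
def Affine.act (x : Affine B) (η : Loop 𝔤) : Loop 𝔤 := x.rotPart • rot η + ⁅x.loopPart, η⁆

theorem Affine.act_lie (x y : Affine B) (η : Loop 𝔤) :
    ⁅x, y⁆.act η = x.act (y.act η) - y.act (x.act η) := by
  simp only [Affine.act, lie_rotPart, lie_loopPart, map_add, map_smul, rot_lie, lie_add, add_lie,
    sub_lie, lie_smul, smul_lie, leibniz_lie x.loopPart y.loopPart η]
  module

/-- The subalgebra of the extended Lie algebra that preserves a space `V` of loops. For the space of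
all loops it is the whole extended Lie algebra; for the orthogonal complement of `𝔱` it consists of
`∂_θ`, the loops in `𝔱_ℂ` and `I`. -/
def stab (B : InvInner 𝔤) (V : Submodule ℂ (Loop 𝔤)) : LieSubalgebra ℂ (Affine B) where
  carrier := {x | ∀ η ∈ V, x.act η ∈ V}
  add_mem' := by
    intro x y hx hy η hη
    have : (x + y).act η = x.act η + y.act η := by
      simp only [Affine.act, Affine.add_rotPart, Affine.add_loopPart, add_smul, add_lie]; abel
    rw [this]; exact add_mem (hx η hη) (hy η hη)
  zero_mem' := by intro η _; simp [Affine.act]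
  smul_mem' := by
    intro c x hx η hη
    have : (c • x).act η = c • x.act η := by
      simp only [Affine.act, Affine.smul_rotPart, Affine.smul_loopPart, mul_smul, smul_lie, smul_add]
    rw [this]; exact Submodule.smul_mem _ _ (hx η hη)
  lie_mem' := by
    intro x y hx hy η hη
    rw [Affine.act_lie]
    exact sub_mem (hx _ (hy η hη)) (hy _ (hx η hη))

/-- The generator `I` of the centre. -/
def centre (B : InvInner 𝔤) (V : Submodule ℂ (Loop 𝔤)) : stab B V :=
  ⟨⟨0, 0, 1⟩, fun η _ => by simp [Affine.act]⟩

/-- A representation of (the stabilizer of `V` in) the extended Lie algebra on a Clifford module of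
`V` that lifts the action on `V`: the commutator of the operator of `x` with Clifford
multiplication by `v` is Clifford multiplication by `x · v`. -/
structure SpinLift {V : Submodule ℂ (Loop 𝔤)} {S : Type*} [AddCommGroup S] [Module ℂ S]
    (c : CliffordAlgebra (B.quad V) →ₐ[ℂ] Module.End ℂ S) where
  op : stab B V →ₗ[ℂ] Module.End ℂ S
  map_lie : ∀ x y, op ⁅x, y⁆ = op x * op y - op y * op x
  equivariant : ∀ (x : stab B V) (v : V),
    op x * c (CliffordAlgebra.ι _ v) - c (CliffordAlgebra.ι _ v) * op x =
      c (CliffordAlgebra.ι _ ⟨(x : Affine B).act v, x.2 v v.2⟩)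

/-- A spin representation has central charge `h` if the extended Lie algebra acts on it, and in each
such action the generator `I` of the central circle acts by `i h`. -/
def HasCentralCharge {V : Submodule ℂ (Loop 𝔤)} {S : Type*} [AddCommGroup S] [Module ℂ S]
    (c : CliffordAlgebra (B.quad V) →ₐ[ℂ] Module.End ℂ S) (h : ℝ) : Prop :=
  Nonempty (SpinLift c) ∧
    ∀ π : SpinLift c, π.op (centre B V) = (Complex.I * (h : ℂ)) • LinearMap.id

end Level
end LoopSpin

end

/-! The Clifford algebra has only scalars as its commutant on each of the two spin representations.
Two operators with the same commutators with Clifford multiplication therefore differ by a scalar,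
so any two lifts agree on brackets. For `H ≠ 0` in `𝔱` the loops `H z` and `H z⁻¹` lie in the
stabilizer in both cases, and their bracket is a nonzero multiple of `I`. Hence the central charge
can be read off from any one lift (`SpinLift.op_centre_eq`, `SpinModule.hasCentralCharge`).

Such a lift is explicit. For an orthonormal basis `X_a`, a loop `ξ` acts by `1/4 ∑_n ∑_a [ξ, X_a
z^n] · X_a z^(-n)` and `∂_θ` by `i/2 ∑_{n>0} n ∑_a X_a z^n · X_a z^(-n)`. On each vector the sums
are finite; for loops this needs no normal ordering, since `⟨[Y, X_a], X_a⟩ = 0`. The commutator of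
the operators of `Y z^k` and `Z z^l` equals the operator of their bracket plus `∑_n (u_n -
u_(n-k))`. Here `u_n` vanishes for large `n` but is a constant `e` near `-∞`, so the sum is `-k e`
rather than zero. This anomaly is the central term (`loopOp_lie`). The constant `e` is a multiple of
`tr (ad Z ad Y)`, and since the Casimir operator is a scalar `c` this trace is `-2 c ⟨Y, Z⟩`; the
level is thus `c`.

The scalar `c` is found on a unit vector `E` of the highest root space: `c = -1/2 tr (ad Ē ad E)`.
In the root decomposition this operator is, up to sign, of rank one on `𝔱_ℂ`, zero on `𝔫_+`, and the
scalar `⟨α, θ⟩` on the root space of `-α`. So its trace is `-(2 + 2 ⟨ρ, θ⟩)` (`ad_conj_ad_eq`,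
`casimir_eq`).

`SpinModule` treats both representations at once: `ε = 1` for the exterior algebra, on which `𝔱`
acts by zero, and `ε = 0` for the full module. A number operator identifies the vectors killed by
all annihilation operators with the vacuum (`mem_vac`). Commuting operators preserve it, and it is
either a line or a copy of the irreducible module `S` of the Clifford algebra of `𝔱_ℂ`, where
Schur's lemma applies. -/

noncomputable section

set_option linter.unusedSectionVars false

namespace LoopSpin

/-! ### Complex conjugation, and the Casimir operator on `𝔤_ℂ`. -/

section Conjugation

variable {𝔤 : Type*} [LieRing 𝔤] [LieAlgebra ℝ 𝔤]

instance [FiniteDimensional ℝ 𝔤] : FiniteDimensional ℂ (Cx 𝔤) :=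
  inferInstanceAs (FiniteDimensional ℂ (ℂ ⊗[ℝ] 𝔤))

/-- Complex conjugation on `𝔤_ℂ`. -/
def conjCx : Cx 𝔤 →+ Cx 𝔤 := (Complex.conjAe.toLinearMap.rTensor 𝔤).toAddMonoidHom

theorem conjCx_mk (a : ℂ) (X : 𝔤) : conjCx (cxMk a X) = cxMk (starRingEnd ℂ a) X := rfl

theorem conjCx_smul (c : ℂ) (X : Cx 𝔤) : conjCx (c • X) = starRingEnd ℂ c • conjCx X := by
  induction X using Cx.induct with
  | h0 => simp
  | hadd a b ha hb => simp only [smul_add, map_add, ha, hb]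
  | hmk a x => simp only [smul_cxMk, conjCx_mk, map_mul]

theorem conjCx_conjCx (X : Cx 𝔤) : conjCx (conjCx X) = X := by
  induction X using Cx.induct with
  | h0 => simp
  | hadd a b ha hb => simp only [map_add, ha, hb]
  | hmk a x => simp only [conjCx_mk, Complex.conj_conj]

theorem conjCx_lie (X Y : Cx 𝔤) : conjCx ⁅X, Y⁆ = ⁅conjCx X, conjCx Y⁆ := by
  induction X using Cx.induct with
  | h0 => simp
  | hadd a b ha hb => simp only [add_lie, map_add, ha, hb]
  | hmk a x =>
    induction Y using Cx.induct with
    | h0 => simp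
    | hadd a b ha hb => simp only [lie_add, map_add, ha, hb]
    | hmk b y => simp only [cxMk_lie, conjCx_mk, map_mul]

theorem cxMk_zero (a : ℂ) : cxMk a (0 : 𝔤) = 0 := TensorProduct.tmul_zero ..

theorem cxMk_sum {ι : Type*} (s : Finset ι) (a : ℂ) (f : ι → 𝔤) :
    cxMk a (∑ i ∈ s, f i) = ∑ i ∈ s, cxMk a (f i) := TensorProduct.tmul_sum ..

variable (B : InvInner 𝔤)

/-- Pairing with the conjugate turns the bilinear form into a positive definite Hermitian one. All
later positivity and nondegeneracy arguments over `ℂ` come from this. -/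
theorem InvInner.cx_conjCx_self (X : Cx 𝔤) : B.cx X (conjCx X) = B.re X X := by
  have h := cx_eq X
  set U := cxRe X with hU
  set V := cxIm X with hV
  have h1 : conjCx X = cxMk 1 U - cxMk Complex.I V := by
    rw [h, map_add, conjCx_mk, conjCx_mk, map_one, Complex.conj_I, sub_eq_add_neg]
    congr 1
  rw [h1]
  conv_lhs => rw [h]
  simp only [map_add, map_sub, LinearMap.add_apply, B.cx_mk, InvInner.re, ← hU, ← hV,
    B.symm V U]
  push_cast
  linear_combination (-(B.form V V : ℂ)) * Complex.I_mul_I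

theorem InvInner.re_pos {X : Cx 𝔤} (hX : X ≠ 0) : 0 < B.re X X := by
  have h : 0 ≤ B.re X X := add_nonneg (B.nonneg _) (B.nonneg _)
  exact lt_of_le_of_ne h fun h0 => hX (B.eq_zero_of_re X h0.symm)

theorem InvInner.cx_nondegenerate (X : Cx 𝔤) (h : ∀ Y, B.cx X Y = 0) : X = 0 := by
  apply B.eq_zero_of_re
  have := h (conjCx X)
  rw [B.cx_conjCx_self] at this
  exact_mod_cast this

variable {B} {ι : Type*} [Fintype ι] [DecidableEq ι] {X : Module.Basis ι ℝ 𝔤}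

theorem form_expand (hX : ∀ i j, B.form (X i) (X j) = if i = j then 1 else 0) (Y : 𝔤) :
    ∑ i, B.form (X i) Y • X i = Y := by
  conv_rhs => rw [← X.sum_repr Y]
  refine Finset.sum_congr rfl fun i _ => ?_
  congr 1
  conv_lhs => rw [← X.sum_repr Y]
  simp only [map_sum, map_smul, hX, smul_eq_mul, mul_ite, mul_one, mul_zero, Finset.sum_ite_eq,
    Finset.mem_univ, if_true]

theorem cx_expand (hX : ∀ i j, B.form (X i) (X j) = if i = j then 1 else 0) (Z : Cx 𝔤) :
    ∑ i, B.cx (cxMk 1 (X i)) Z • cxMk 1 (X i) = Z := by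
  induction Z using Cx.induct with
  | h0 => simp
  | hadd a b ha hb =>
    simp only [map_add, add_smul, Finset.sum_add_distrib, ha, hb]
  | hmk a Y =>
    conv_rhs => rw [← form_expand hX Y, cxMk_sum]
    refine Finset.sum_congr rfl fun i _ => ?_
    rw [B.cx_mk, smul_cxMk, cxMk_smul]
    simp

/-- Inserting the orthonormal expansion of the argument writes `A` as a sum of rank one operators,
whose traces are evident. -/
theorem trace_eq_sum [FiniteDimensional ℝ 𝔤]
    (hX : ∀ i j, B.form (X i) (X j) = if i = j then 1 else 0) (A : Module.End ℂ (Cx 𝔤)) :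
    LinearMap.trace ℂ (Cx 𝔤) A = ∑ i, B.cx (cxMk 1 (X i)) (A (cxMk 1 (X i))) := by
  have h : A = ∑ i, (B.cx (cxMk 1 (X i))).smulRight (A (cxMk 1 (X i))) := by
    ext1 Z
    rw [LinearMap.sum_apply]
    conv_lhs => rw [← cx_expand hX Z, map_sum]
    simp
  conv_lhs => rw [h, map_sum]
  simp only [LinearMap.trace_smulRight]

theorem adCx_apply (H : 𝔤) (Z : Cx 𝔤) : adCx H Z = ⁅cxMk 1 H, Z⁆ := rfl

variable (X) in
/-- The Casimir operator on `𝔤_ℂ` for a basis of `𝔤`. -/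
def casimirCx : Module.End ℂ (Cx 𝔤) := (-(1 / 2) : ℂ) • ∑ i, adCx (X i) * adCx (X i)

/-- Both sides reduce by invariance to `∑ ⟨[X_i, U], [X_i, V]⟩`. The Casimir operator thus
represents the Killing form by means of the inner product. -/
theorem cx_casimirCx [FiniteDimensional ℝ 𝔤]
    (hX : ∀ i j, B.form (X i) (X j) = if i = j then 1 else 0) (U V : Cx 𝔤) :
    B.cx (casimirCx X U) V =
      -(1 / 2) * LinearMap.trace ℂ (Cx 𝔤) (LieAlgebra.ad ℂ (Cx 𝔤) V * LieAlgebra.ad ℂ (Cx 𝔤) U) := by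
  rw [trace_eq_sum hX, casimirCx, LinearMap.smul_apply, map_smul, LinearMap.smul_apply,
    smul_eq_mul, LinearMap.sum_apply, map_sum, LinearMap.sum_apply]
  congr 1
  refine Finset.sum_congr rfl fun i _ => ?_
  rw [Module.End.mul_apply, Module.End.mul_apply, LieAlgebra.ad_apply, LieAlgebra.ad_apply,
    adCx_apply, adCx_apply]
  have h1 : B.cx (cxMk 1 (X i)) ⁅V, ⁅U, cxMk 1 (X i)⁆⁆ =
      - B.cx ⁅V, cxMk 1 (X i)⁆ ⁅U, cxMk 1 (X i)⁆ := by rw [B.cx_inv, neg_neg]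
  rw [B.cx_inv, h1, B.cx_symm ⁅V, _⁆, ← lie_skew V, ← lie_skew U, map_neg, map_neg,
    LinearMap.neg_apply, neg_neg]

/-- The inner product is nondegenerate and the trace form is invariant, so the operator that relates
them commutes with `ad`. -/
theorem casimirCx_lie [FiniteDimensional ℝ 𝔤]
    (hX : ∀ i j, B.form (X i) (X j) = if i = j then 1 else 0) (W U : Cx 𝔤) :
    casimirCx X ⁅W, U⁆ = ⁅W, casimirCx X U⁆ := by
  rw [← sub_eq_zero]
  apply B.cx_nondegenerate
  intro V
  rw [map_sub, LinearMap.sub_apply, B.cx_inv, cx_casimirCx hX, cx_casimirCx hX]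
  have h := LieModule.traceForm_apply_lie_apply ℂ (Cx 𝔤) (Cx 𝔤) V W U
  rw [LieModule.traceForm_apply_apply, LieModule.traceForm_apply_apply] at h
  change LinearMap.trace ℂ (Cx 𝔤) (LieAlgebra.ad ℂ (Cx 𝔤) ⁅V, W⁆ * LieAlgebra.ad ℂ (Cx 𝔤) U) =
    LinearMap.trace ℂ (Cx 𝔤) (LieAlgebra.ad ℂ (Cx 𝔤) V * LieAlgebra.ad ℂ (Cx 𝔤) ⁅W, U⁆) at h
  have h2 : LieAlgebra.ad ℂ (Cx 𝔤) ⁅V, W⁆ = - LieAlgebra.ad ℂ (Cx 𝔤) ⁅W, V⁆ := by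
    rw [← map_neg, lie_skew]
  rw [h2, neg_mul, map_neg] at h
  rw [← h]
  ring

theorem cxRe_casimirCx (Z : Cx 𝔤) : cxRe (casimirCx X Z) =
    ((-(1 / 2) : ℝ) • ∑ i, LieAlgebra.ad ℝ 𝔤 (X i) ∘ₗ LieAlgebra.ad ℝ 𝔤 (X i)) (cxRe Z) := by
  have h : (-(1 / 2) : ℂ) = ((-(1 / 2) : ℝ) : ℂ) := by push_cast; rfl
  rw [casimirCx, LinearMap.smul_apply, LinearMap.sum_apply, h, cxRe_smul, Complex.ofReal_re,
    Complex.ofReal_im, zero_smul, sub_zero, map_sum, LinearMap.smul_apply, LinearMap.sum_apply]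
  congr 1
  refine Finset.sum_congr rfl fun i _ => ?_
  rw [Module.End.mul_apply, adCx_apply, adCx_apply, cxRe_lie, cxRe_lie]; rfl

theorem cxIm_casimirCx (Z : Cx 𝔤) : cxIm (casimirCx X Z) =
    ((-(1 / 2) : ℝ) • ∑ i, LieAlgebra.ad ℝ 𝔤 (X i) ∘ₗ LieAlgebra.ad ℝ 𝔤 (X i)) (cxIm Z) := by
  have h : (-(1 / 2) : ℂ) = ((-(1 / 2) : ℝ) : ℂ) := by push_cast; rfl
  rw [casimirCx, LinearMap.smul_apply, LinearMap.sum_apply, h, cxIm_smul, Complex.ofReal_re,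
    Complex.ofReal_im, zero_smul, add_zero, map_sum, LinearMap.smul_apply, LinearMap.sum_apply]
  congr 1
  refine Finset.sum_congr rfl fun i _ => ?_
  rw [Module.End.mul_apply, adCx_apply, adCx_apply, cxIm_lie, cxIm_lie]; rfl

/-- If the Casimir operator of a simple Lie algebra has a real eigenvalue on `𝔤_ℂ`, then it is that
scalar. -/
theorem casimir_eq_smul [FiniteDimensional ℝ 𝔤] [LieAlgebra.IsSimple ℝ 𝔤]
    (hX : ∀ i j, B.form (X i) (X j) = if i = j then 1 else 0) (c : ℝ) (E : Cx 𝔤) (hE : E ≠ 0)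
    (h : casimirCx X E = (c : ℂ) • E) :
    (-(1 / 2) : ℝ) • ∑ i, LieAlgebra.ad ℝ 𝔤 (X i) ∘ₗ LieAlgebra.ad ℝ 𝔤 (X i)
      = c • LinearMap.id := by
  set C := (-(1 / 2) : ℝ) • ∑ i, LieAlgebra.ad ℝ 𝔤 (X i) ∘ₗ LieAlgebra.ad ℝ 𝔤 (X i) with hC
  have hlie : ∀ W Y : 𝔤, C ⁅W, Y⁆ = ⁅W, C Y⁆ := by
    intro W Y
    have h1 := congrArg cxRe (casimirCx_lie hX (cxMk 1 W) (cxMk 1 Y))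
    rw [cxRe_lie, cxRe_casimirCx, cxRe_casimirCx, cxRe_lie, cxRe_mk, Complex.one_re, one_smul,
      ← hC] at h1
    exact h1
  -- The eigenspace is an ideal of the real Lie algebra. It contains the real and imaginary parts of
  -- `E` because `c` is real, and these do not both vanish.
  let I : LieIdeal ℝ 𝔤 :=
    { LinearMap.ker (C - c • (LinearMap.id : 𝔤 →ₗ[ℝ] 𝔤)) with
      lie_mem := by
        intro W Y hY
        change (C - c • (LinearMap.id : 𝔤 →ₗ[ℝ] 𝔤)) ⁅W, Y⁆ = 0
        have hY : (C - c • (LinearMap.id : 𝔤 →ₗ[ℝ] 𝔤)) Y = 0 := hY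
        rw [LinearMap.sub_apply, sub_eq_zero] at hY
        rw [LinearMap.sub_apply, hlie, hY]
        simp }
  have hmem : ∀ Y, Y ∈ I ↔ C Y = c • Y := fun Y => by
    change (C - c • (LinearMap.id : 𝔤 →ₗ[ℝ] 𝔤)) Y = 0 ↔ _
    rw [LinearMap.sub_apply, sub_eq_zero]; rfl
  have h1 : cxRe E ∈ I := by
    rw [hmem, hC, ← cxRe_casimirCx, h, cxRe_smul]; simp
  have h2 : cxIm E ∈ I := by
    rw [hmem, hC, ← cxIm_casimirCx, h, cxIm_smul]; simp
  rcases LieAlgebra.IsSimple.eq_bot_or_eq_top (R := ℝ) I with hb | ht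
  · rw [hb] at h1 h2
    rw [LieSubmodule.mem_bot] at h1 h2
    exact absurd (by rw [cx_eq E, h1, h2, cxMk_zero, cxMk_zero, add_zero]) hE
  · ext Y
    have : Y ∈ I := by rw [ht]; trivial
    exact (hmem Y).mp this

/-- If the Casimir operator is the scalar `c`, the Killing form of `𝔤_ℂ` is `-2 c` times the inner
product. -/
theorem sum_cx_lie_lie (hX : ∀ i j, B.form (X i) (X j) = if i = j then 1 else 0) {c : ℝ}
    (h : (-(1 / 2) : ℝ) • ∑ i, LieAlgebra.ad ℝ 𝔤 (X i) ∘ₗ LieAlgebra.ad ℝ 𝔤 (X i)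
      = c • LinearMap.id) [FiniteDimensional ℝ 𝔤] (Y Z : Cx 𝔤) :
    ∑ i, B.cx ⁅Z, ⁅Y, cxMk 1 (X i)⁆⁆ (cxMk 1 (X i)) = -2 * c * B.cx Y Z := by
  have h1 : casimirCx X Y = (c : ℂ) • Y := by
    rw [cx_eq (casimirCx X Y), cxRe_casimirCx, cxIm_casimirCx, h]
    conv_rhs => rw [cx_eq Y]
    simp [cxMk_smul, smul_add, smul_cxMk, -Complex.coe_smul]
  have h2 := cx_casimirCx hX Y Z
  rw [h1, trace_eq_sum hX, map_smul, LinearMap.smul_apply, smul_eq_mul] at h2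
  have h3 : ∑ i, B.cx ⁅Z, ⁅Y, cxMk 1 (X i)⁆⁆ (cxMk 1 (X i)) =
      ∑ i, B.cx (cxMk 1 (X i))
        ((LieAlgebra.ad ℂ (Cx 𝔤) Z * LieAlgebra.ad ℂ (Cx 𝔤) Y) (cxMk 1 (X i))) :=
    Finset.sum_congr rfl fun i _ => B.cx_symm _ _
  rw [h3]
  linear_combination 2 * h2

end Conjugation

end LoopSpin

namespace LoopSpin

/-! ### Root vectors, and the Casimir eigenvalue on the highest root space. -/

section RootVectors

variable {𝔤 : Type*} [LieRing 𝔤] [LieAlgebra ℝ 𝔤]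

theorem rootSpace_lie (𝔱 : LieSubalgebra ℝ 𝔤) {α β : Module.Dual ℝ 𝔱} {E F : Cx 𝔤}
    (hE : E ∈ rootSpace 𝔱 α) (hF : F ∈ rootSpace 𝔱 β) : ⁅E, F⁆ ∈ rootSpace 𝔱 (α + β) := by
  intro H
  rw [leibniz_lie, hE H, hF H, smul_lie, lie_smul, ← add_smul, LinearMap.add_apply]
  push_cast
  rw [mul_add]

theorem conjCx_mem_rootSpace (𝔱 : LieSubalgebra ℝ 𝔤) {α : Module.Dual ℝ 𝔱} {E : Cx 𝔤}
    (hE : E ∈ rootSpace 𝔱 α) : conjCx E ∈ rootSpace 𝔱 (-α) := by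
  intro H
  have h : cxMk 1 (H : 𝔤) = conjCx (cxMk 1 (H : 𝔤)) := by rw [conjCx_mk, map_one]
  rw [h, ← conjCx_lie, hE H, conjCx_smul]
  simp

theorem cx_rootSpace_eq_zero (B : InvInner 𝔤) (𝔱 : LieSubalgebra ℝ 𝔤) {α β : Module.Dual ℝ 𝔱}
    {E F : Cx 𝔤} (hE : E ∈ rootSpace 𝔱 α) (hF : F ∈ rootSpace 𝔱 β) (h : α + β ≠ 0) :
    B.cx E F = 0 := by
  obtain ⟨H, hH⟩ : ∃ H, (α + β) H ≠ 0 := by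
    by_contra hne
    push Not at hne
    exact h (LinearMap.ext hne)
  have h1 := B.cx_inv (cxMk 1 (H : 𝔤)) E F
  rw [hE H, hF H, map_smul, map_smul, LinearMap.smul_apply, smul_eq_mul, smul_eq_mul] at h1
  have h2 : Complex.I * (((α + β) H : ℝ) : ℂ) * B.cx E F = 0 := by
    rw [LinearMap.add_apply]
    push_cast; linear_combination h1
  refine (mul_eq_zero.mp h2).resolve_left (mul_ne_zero Complex.I_ne_zero ?_)
  exact_mod_cast hH

theorem IsRoot.neg {𝔱 : LieSubalgebra ℝ 𝔤} {α : Module.Dual ℝ 𝔱} (h : IsRoot 𝔱 α) :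
    IsRoot 𝔱 (-α) := by
  refine ⟨neg_ne_zero.mpr h.1, fun hb => ?_⟩
  obtain ⟨E, hE, hne⟩ := Submodule.exists_mem_ne_zero_of_ne_bot h.2
  have h1 := conjCx_mem_rootSpace 𝔱 hE
  rw [hb, Submodule.mem_bot] at h1
  exact hne (by rw [← conjCx_conjCx E, h1, map_zero])

variable [FiniteDimensional ℝ 𝔤]

namespace CartanChoice

variable (D : CartanChoice 𝔤) (B : InvInner 𝔤)

/-- The element of `𝔱` that represents a linear functional. -/
def dualVec (α : Module.Dual ℝ D.torus) : D.torus :=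
  ((D.torusForm B).toDual (D.torusForm_nondegenerate B)).symm α

theorem form_dualVec (α : Module.Dual ℝ D.torus) (H : D.torus) :
    B.form (D.dualVec B α : 𝔤) (H : 𝔤) = α H :=
  LinearMap.BilinForm.apply_toDual_symm_apply (hB := D.torusForm_nondegenerate B) α H

theorem dualInner_eq (α β : Module.Dual ℝ D.torus) :
    D.dualInner B α β = α (D.dualVec B β) := D.form_dualVec B α (D.dualVec B β)

theorem dualInner_self_pos {α : Module.Dual ℝ D.torus} (h : α ≠ 0) : 0 < α (D.dualVec B α) := by
  rw [← D.form_dualVec B]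
  apply B.pos
  intro h0
  apply h
  ext H
  rw [← D.form_dualVec B, h0]
  simp

/-- The element of `𝔱_ℂ` that represents a linear functional. -/
def dualVecCx (α : Module.Dual ℝ D.torus) : Cx 𝔤 := cxMk 1 (D.dualVec B α : 𝔤)

theorem cxMk_mem_torusCx (H : D.torus) : cxMk 1 (H : 𝔤) ∈ D.torusCx :=
  Submodule.subset_span ⟨H, H.2, rfl⟩

theorem dualVecCx_mem (α : Module.Dual ℝ D.torus) : D.dualVecCx B α ∈ D.torusCx :=
  D.cxMk_mem_torusCx _

theorem cx_dualVecCx (α : Module.Dual ℝ D.torus) (H : D.torus) :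
    B.cx (D.dualVecCx B α) (cxMk 1 (H : 𝔤)) = α H := by
  rw [dualVecCx, B.cx_mk, form_dualVec, mul_one, mul_one]

theorem torusCx_lie {T E : Cx 𝔤} {α : Module.Dual ℝ D.torus} (hT : T ∈ D.torusCx)
    (hE : E ∈ rootSpace D.torus α) : ⁅T, E⁆ = (Complex.I * B.cx (D.dualVecCx B α) T) • E := by
  induction hT using Submodule.span_induction with
  | zero => simp
  | add _ _ _ _ ha hb => rw [add_lie, ha, hb, map_add, mul_add, add_smul]
  | smul c _ _ ha => rw [smul_lie, ha, map_smul, smul_eq_mul, smul_smul]; congr 1; ring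
  | mem _ hT =>
    obtain ⟨H, hH, rfl⟩ := hT
    rw [hE ⟨H, hH⟩, D.cx_dualVecCx B α ⟨H, hH⟩]

theorem mem_torusCx_iff (T : Cx 𝔤) : T ∈ D.torusCx ↔ T ∈ rootSpace D.torus 0 :=
  ⟨fun h => D.torusCx_le_rootSpace h, fun h => D.mem_torusCx_of_zero T fun H => by
    have := h H
    rw [adCx_apply, this]; simp⟩

theorem conjCx_mem_torusCx {T : Cx 𝔤} (hT : T ∈ D.torusCx) : conjCx T ∈ D.torusCx := by
  rw [mem_torusCx_iff] at hT ⊢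
  simpa using conjCx_mem_rootSpace D.torus hT

theorem torusCx_abelian {T U : Cx 𝔤} (hT : T ∈ D.torusCx) (hU : U ∈ D.torusCx) : ⁅T, U⁆ = 0 := by
  induction hT using Submodule.span_induction with
  | zero => simp
  | add _ _ _ _ ha hb => rw [add_lie, ha, hb, add_zero]
  | smul c _ _ ha => rw [smul_lie, ha, smul_zero]
  | mem _ hT =>
    obtain ⟨H, hH, rfl⟩ := hT
    have := (D.mem_torusCx_iff U).mp hU ⟨H, hH⟩
    rw [this]; simp

theorem torusCx_nondegenerate {T : Cx 𝔤} (hT : T ∈ D.torusCx)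
    (h : ∀ H : D.torus, B.cx T (cxMk 1 (H : 𝔤)) = 0) : T = 0 := by
  have h1 : ∀ U ∈ D.torusCx, B.cx T U = 0 := by
    intro U hU
    induction hU using Submodule.span_induction with
    | zero => simp
    | add _ _ _ _ ha hb => rw [map_add, ha, hb, add_zero]
    | smul c _ _ ha => rw [map_smul, ha, smul_zero]
    | mem _ hT =>
      obtain ⟨H, hH, rfl⟩ := hT
      exact h ⟨H, hH⟩
  by_contra hne
  have h2 := h1 _ (D.conjCx_mem_torusCx hT)
  rw [B.cx_conjCx_self] at h2
  exact (B.re_pos hne).ne' (by exact_mod_cast h2)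

/-- The bracket has weight zero, hence lies in `𝔱_ℂ`, and is determined there by its pairings with
`𝔱`, which invariance computes. -/
theorem lie_opposite {E F : Cx 𝔤} {α : Module.Dual ℝ D.torus} (hE : E ∈ rootSpace D.torus α)
    (hF : F ∈ rootSpace D.torus (-α)) : ⁅E, F⁆ = (Complex.I * B.cx E F) • D.dualVecCx B α := by
  have h1 : ⁅E, F⁆ ∈ D.torusCx := by
    rw [mem_torusCx_iff]
    have := rootSpace_lie D.torus hE hF
    rwa [add_neg_cancel] at this
  rw [← sub_eq_zero]
  refine D.torusCx_nondegenerate B (sub_mem h1 (Submodule.smul_mem _ _ (D.dualVecCx_mem B α)))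
    fun H => ?_
  rw [map_sub, LinearMap.sub_apply, map_smul, LinearMap.smul_apply, cx_dualVecCx, B.cx_inv,
    ← lie_skew E, hE H, map_neg, map_smul, B.cx_symm F E, smul_eq_mul, smul_eq_mul]
  ring

/-- A root vector orthogonal to a nonzero root vector for the same root vanishes: root spaces are
one-dimensional. -/
theorem rootSpace_eq_zero {E E' : Cx 𝔤} {α : Module.Dual ℝ D.torus} (hα : α ≠ 0)
    (hE : E ∈ rootSpace D.torus α) (hE' : E' ∈ rootSpace D.torus α) (hne : E ≠ 0)
    (h : B.cx E' (conjCx E) = 0) : E' = 0 := by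
  by_contra hne'
  have hc := conjCx_mem_rootSpace D.torus hE
  have h1 : ⁅conjCx E, E'⁆ = 0 := by
    rw [← lie_skew, D.lie_opposite B hE' hc, h, mul_zero, zero_smul, neg_zero]
  have h2 : ⁅D.dualVecCx B α, E'⁆ = (Complex.I * α (D.dualVec B α)) • E' := hE' (D.dualVec B α)
  have h3 : ⁅conjCx E, ⁅E, E'⁆⁆ = (B.re E E * α (D.dualVec B α) : ℂ) • E' := by
    rw [leibniz_lie, h1, lie_zero, add_zero, ← lie_skew (conjCx E) E, D.lie_opposite B hE hc, neg_lie,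
      smul_lie, h2, B.cx_conjCx_self, smul_smul, ← neg_smul]
    congr 1
    linear_combination (-(B.re E E * α (D.dualVec B α) : ℂ)) * Complex.I_mul_I
  -- Moving `ad Ē` across the form gives the squared norm of `[E, E']` as minus a product of three
  -- positive numbers, a contradiction.
  have h4 : B.cx ⁅E, E'⁆ (conjCx ⁅E, E'⁆) =
      -(B.re E E * α (D.dualVec B α) * B.re E' E' : ℂ) := by
    have h5 := B.cx_inv (conjCx E) ⁅E, E'⁆ (conjCx E')
    rw [h3, map_smul, LinearMap.smul_apply, B.cx_conjCx_self, smul_eq_mul] at h5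
    rw [conjCx_lie]
    linear_combination h5
  rw [B.cx_conjCx_self] at h4
  have h5 : B.re ⁅E, E'⁆ ⁅E, E'⁆ = -(B.re E E * α (D.dualVec B α) * B.re E' E') := by
    exact_mod_cast h4
  have h6 : 0 < B.re E E * α (D.dualVec B α) * B.re E' E' :=
    mul_pos (mul_pos (B.re_pos hne) (D.dualInner_self_pos B hα)) (B.re_pos hne')
  have h7 : 0 ≤ B.re ⁅E, E'⁆ ⁅E, E'⁆ := add_nonneg (B.nonneg _) (B.nonneg _)
  linarith

/-- Two root vectors for the same root are proportional. -/
theorem rootSpace_eq_smul {E E' : Cx 𝔤} {α : Module.Dual ℝ D.torus} (hα : α ≠ 0)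
    (hE : E ∈ rootSpace D.torus α) (hE' : E' ∈ rootSpace D.torus α)
    (hn : B.cx E (conjCx E) = 1) : E' = B.cx E' (conjCx E) • E := by
  have hne : E ≠ 0 := by rintro rfl; simp at hn
  rw [← sub_eq_zero]
  refine D.rootSpace_eq_zero B hα hE (sub_mem hE' (Submodule.smul_mem _ _ hE)) hne ?_
  rw [map_sub, LinearMap.sub_apply, map_smul, LinearMap.smul_apply, hn, smul_eq_mul, mul_one,
    sub_self]

theorem exists_unit_rootVector {α : Module.Dual ℝ D.torus} (h : IsRoot D.torus α) :
    ∃ E ∈ rootSpace D.torus α, B.cx E (conjCx E) = 1 := by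
  obtain ⟨E, hE, hne⟩ := Submodule.exists_mem_ne_zero_of_ne_bot h.2
  have h1 := B.re_pos hne
  refine ⟨((Real.sqrt (B.re E E))⁻¹ : ℂ) • E, Submodule.smul_mem _ _ hE, ?_⟩
  rw [conjCx_smul, map_smul, map_smul, LinearMap.smul_apply, B.cx_conjCx_self, map_inv₀,
    Complex.conj_ofReal, smul_eq_mul, smul_eq_mul, ← mul_assoc, ← mul_inv, ← Complex.ofReal_mul,
    Real.mul_self_sqrt h1.le]
  exact inv_mul_cancel₀ (by exact_mod_cast h1.ne')

/-- A maximal abelian subalgebra of a nonabelian Lie algebra is nonzero. -/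
theorem exists_torus_ne_zero [LieAlgebra.IsSimple ℝ 𝔤] : ∃ H : D.torus, (H : 𝔤) ≠ 0 := by
  by_contra hne
  push Not at hne
  have h0 : ∀ X : 𝔤, X = 0 := fun X =>
    hne ⟨X, D.maximal X fun H hH => by
      have h : H = 0 := hne ⟨H, hH⟩
      rw [h, zero_lie]⟩
  exact LieAlgebra.IsSimple.non_abelian ℝ (L := 𝔤) ⟨fun X Y => h0 _⟩

theorem closure_posRoots_nonneg {γ : Module.Dual ℝ D.torus}
    (h : γ ∈ AddSubmonoid.closure D.posRoots) : 0 ≤ γ D.reg := by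
  induction h using AddSubmonoid.closure_induction with
  | mem x hx => exact hx.2.le
  | zero => simp
  | add x y _ _ hx hy => rw [LinearMap.add_apply]; exact add_nonneg hx hy

theorem IsHighestRoot.pos {D : CartanChoice 𝔤} {θ : Module.Dual ℝ D.torus}
    (hθ : D.IsHighestRoot θ) : 0 < θ D.reg := by
  have h := D.closure_posRoots_nonneg (hθ.2 _ hθ.1.neg)
  rw [sub_neg_eq_add, LinearMap.add_apply] at h
  have := D.regular θ hθ.1
  rcases lt_or_gt_of_ne this with h1 | h1 <;> linarith

/-- A nonzero bracket would make `θ + β` a root, and then `-β = θ - (θ + β)` would be nonnegative on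
the chamber. -/
theorem IsHighestRoot.lie_eq_zero {D : CartanChoice 𝔤} {θ β : Module.Dual ℝ D.torus}
    (hθ : D.IsHighestRoot θ) (hβ : β ∈ D.posRoots) {E F : Cx 𝔤} (hE : E ∈ rootSpace D.torus θ)
    (hF : F ∈ rootSpace D.torus β) : ⁅E, F⁆ = 0 := by
  by_contra hne
  have h1 : 0 < (θ + β) D.reg := by rw [LinearMap.add_apply]; exact add_pos hθ.pos hβ.2
  have h2 : IsRoot D.torus (θ + β) := by
    refine ⟨fun h0 => by rw [h0] at h1; simp at h1, fun hb => hne ?_⟩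
    have := rootSpace_lie D.torus hE hF
    rwa [hb, Submodule.mem_bot] at this
  have h3 := D.closure_posRoots_nonneg (hθ.2 _ h2)
  rw [LinearMap.sub_apply, LinearMap.add_apply] at h3
  linarith [hβ.2]

/-- For a unit vector `E` in the highest root space, `ad Ē ad E` is a sum of rank one operators. -/
theorem ad_conj_ad_eq {θ : Module.Dual ℝ D.torus} (hθ : D.IsHighestRoot θ) {E : Cx 𝔤}
    (hE : E ∈ rootSpace D.torus θ) (hn : B.cx E (conjCx E) = 1)
    (e : Module.Dual ℝ D.torus → Cx 𝔤)
    (he : ∀ α ∈ D.posRoots, e α ∈ rootSpace D.torus α ∧ B.cx (e α) (conjCx (e α)) = 1) :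
    LieAlgebra.ad ℂ (Cx 𝔤) (conjCx E) * LieAlgebra.ad ℂ (Cx 𝔤) E =
      -((B.cx (D.dualVecCx B θ)).smulRight (D.dualVecCx B θ) +
        ∑ α ∈ (D.finite_posRoots B).toFinset, (α (D.dualVec B θ) : ℂ) •
          (B.cx (e α)).smulRight (conjCx (e α))) := by
  have hc := conjCx_mem_rootSpace D.torus hE
  have hEc : ⁅conjCx E, E⁆ = (-Complex.I) • D.dualVecCx B θ := by
    rw [← lie_skew, D.lie_opposite B hE hc, hn, mul_one, neg_smul]
  have key : ∀ Z : Cx 𝔤, ⁅conjCx E, ⁅E, Z⁆⁆ =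
      -(B.cx (D.dualVecCx B θ) Z • D.dualVecCx B θ + ∑ α ∈ (D.finite_posRoots B).toFinset,
        (α (D.dualVec B θ) : ℂ) • B.cx (e α) Z • conjCx (e α)) := by
    have hadd : ∀ Z W : Cx 𝔤, (⁅conjCx E, ⁅E, Z⁆⁆ =
        -(B.cx (D.dualVecCx B θ) Z • D.dualVecCx B θ + ∑ α ∈ (D.finite_posRoots B).toFinset,
          (α (D.dualVec B θ) : ℂ) • B.cx (e α) Z • conjCx (e α))) →
        (⁅conjCx E, ⁅E, W⁆⁆ =
        -(B.cx (D.dualVecCx B θ) W • D.dualVecCx B θ + ∑ α ∈ (D.finite_posRoots B).toFinset,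
          (α (D.dualVec B θ) : ℂ) • B.cx (e α) W • conjCx (e α))) →
        (⁅conjCx E, ⁅E, Z + W⁆⁆ =
        -(B.cx (D.dualVecCx B θ) (Z + W) • D.dualVecCx B θ +
          ∑ α ∈ (D.finite_posRoots B).toFinset,
          (α (D.dualVec B θ) : ℂ) • B.cx (e α) (Z + W) • conjCx (e α))) := by
      intro Z W hZ hW
      simp only [lie_add, hZ, hW, map_add, add_smul, smul_add, Finset.sum_add_distrib]
      abel
    have hzero : ⁅conjCx E, ⁅E, (0 : Cx 𝔤)⁆⁆ =
        -(B.cx (D.dualVecCx B θ) 0 • D.dualVecCx B θ + ∑ α ∈ (D.finite_posRoots B).toFinset,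
          (α (D.dualVec B θ) : ℂ) • B.cx (e α) 0 • conjCx (e α)) := by simp
    intro Z
    have hZ : Z ∈ D.torusCx ⊔ D.nPlus ⊔ D.nMinus := by rw [D.sup_eq_top B]; trivial
    obtain ⟨Y, hY, N, hN, rfl⟩ := Submodule.mem_sup.mp hZ
    obtain ⟨T, hT, P, hP, rfl⟩ := Submodule.mem_sup.mp hY
    refine hadd _ _ (hadd _ _ ?_ ?_) ?_
    -- On `𝔱_ℂ`: `[E, T]` is a multiple of `E`, and `[Ē, E]` is a multiple of the vector dual to
    -- `θ`; the root vectors `e α` are orthogonal to `T`.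
    · rw [Finset.sum_eq_zero, add_zero]
      · rw [← lie_skew E, D.torusCx_lie B hT hE, ← neg_smul, lie_smul, hEc, smul_smul, ← neg_smul]
        congr 1
        linear_combination (B.cx (D.dualVecCx B θ) T) * Complex.I_mul_I
      · intro α hα
        have hα := (D.finite_posRoots B).mem_toFinset.mp hα
        rw [cx_rootSpace_eq_zero B D.torus (he α hα).1 ((D.mem_torusCx_iff T).mp hT) (by
          rw [add_zero]; exact hα.1.1), zero_smul, smul_zero]
    -- On `𝔫_+`: `ad E` is zero because `θ` is the highest root, and the right side vanishes by
    -- orthogonality of weights.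
    · clear hZ hY
      rw [nPlus] at hP
      induction hP using Submodule.iSup_induction' with
      | zero => exact hzero
      | add x y _ _ hx hy => exact hadd _ _ hx hy
      | mem β x hx =>
        by_cases hβ : β ∈ D.posRoots
        swap
        · rw [iSup_neg hβ, Submodule.mem_bot] at hx
          rw [hx]; exact hzero
        rw [iSup_pos hβ] at hx
        rw [hθ.lie_eq_zero hβ hE hx, lie_zero, Finset.sum_eq_zero, cx_rootSpace_eq_zero B D.torus
          ((D.mem_torusCx_iff _).mp (D.dualVecCx_mem B θ)) hx (by rw [zero_add]; exact hβ.1.1)]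
        · simp
        · intro α hα
          have hα := (D.finite_posRoots B).mem_toFinset.mp hα
          rw [cx_rootSpace_eq_zero B D.torus (he α hα).1 hx, zero_smul, smul_zero]
          intro h0
          have h1 := congrArg (fun γ : Module.Dual ℝ D.torus => γ D.reg) h0
          simp only [LinearMap.add_apply, LinearMap.zero_apply] at h1
          linarith [hα.2, hβ.2]
    -- On `𝔫_-`: `ad Ē` kills the root space of `-β`, so `ad Ē ad E` acts there as `ad [Ē, E]`, that
    -- is, by the scalar `-⟨β, θ⟩`.
    · clear hZ
      rw [nMinus] at hN
      induction hN using Submodule.iSup_induction' with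
      | zero => exact hzero
      | add x y _ _ hx hy => exact hadd _ _ hx hy
      | mem γ x hx =>
        by_cases hγ : γ ∈ D.negRoots
        swap
        · rw [iSup_neg hγ, Submodule.mem_bot] at hx
          rw [hx]; exact hzero
        rw [iSup_pos hγ] at hx
        obtain ⟨β, rfl⟩ : ∃ β, γ = -β := ⟨-γ, (neg_neg γ).symm⟩
        have hβ : β ∈ D.posRoots := by
          refine ⟨?_, by simpa using hγ.2⟩
          have := hγ.1.neg
          rwa [neg_neg] at this
        have h1 : ⁅conjCx E, x⁆ = 0 := by
          have h2 := hθ.lie_eq_zero hβ hE (F := conjCx x) (by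
            simpa using conjCx_mem_rootSpace D.torus hx)
          rw [← conjCx_conjCx ⁅conjCx E, x⁆, conjCx_lie, conjCx_conjCx, h2, map_zero]
        have h2 : x = B.cx (e β) x • conjCx (e β) := by
          have h3 := D.rootSpace_eq_smul B (neg_ne_zero.mpr hβ.1.1)
            (conjCx_mem_rootSpace D.torus (he β hβ).1) hx (by
              rw [conjCx_conjCx, B.cx_symm]; exact (he β hβ).2)
          rwa [conjCx_conjCx, B.cx_symm x] at h3
        have h3 : ⁅D.dualVecCx B θ, x⁆ = (Complex.I * (((-β) (D.dualVec B θ) : ℝ) : ℂ)) • x :=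
          hx (D.dualVec B θ)
        rw [cx_rootSpace_eq_zero B D.torus
          ((D.mem_torusCx_iff _).mp (D.dualVecCx_mem B θ)) hx (by rw [zero_add]; exact hγ.1.1),
          Finset.sum_eq_single β, ← h2, leibniz_lie, h1, lie_zero, add_zero, hEc, smul_lie, h3,
          smul_smul, zero_smul, zero_add, ← neg_smul]
        · congr 1
          rw [LinearMap.neg_apply]
          push_cast
          linear_combination ((β (D.dualVec B θ) : ℝ) : ℂ) * Complex.I_mul_I
        · intro α hα hne
          have hα := (D.finite_posRoots B).mem_toFinset.mp hα
          rw [cx_rootSpace_eq_zero B D.torus (he α hα).1 hx, zero_smul, smul_zero]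
          rw [← sub_eq_add_neg]
          exact sub_ne_zero.mpr hne
        · intro hn
          exact absurd ((D.finite_posRoots B).mem_toFinset.mpr hβ) hn
  ext1 Z
  rw [Module.End.mul_apply, LieAlgebra.ad_apply, LieAlgebra.ad_apply, key Z]
  simp

/-- The Casimir operator of a compact simple Lie algebra in the adjoint representation. -/
theorem casimir_eq [LieAlgebra.IsSimple ℝ 𝔤] {θ : Module.Dual ℝ D.torus}
    (hθ : D.IsHighestRoot θ) (hB : D.dualInner B θ θ = 2)
    {ι : Type*} [Fintype ι] [DecidableEq ι] {X : Module.Basis ι ℝ 𝔤}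
    (hX : ∀ i j, B.form (X i) (X j) = if i = j then 1 else 0) :
    (-(1 / 2) : ℝ) • ∑ i, LieAlgebra.ad ℝ 𝔤 (X i) ∘ₗ LieAlgebra.ad ℝ 𝔤 (X i)
        = (D.dualInner B (D.rho B) θ + 1) • LinearMap.id := by
  obtain ⟨E, hE, hn⟩ := D.exists_unit_rootVector B hθ.1
  have hne : E ≠ 0 := by rintro rfl; simp at hn
  refine casimir_eq_smul hX _ E hne ?_
  have h1 : casimirCx X E ∈ rootSpace D.torus θ := by
    intro H
    rw [← casimirCx_lie hX, hE H, map_smul]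
  -- The Casimir operator preserves the highest root space, which is a line, so `E` is an
  -- eigenvector. Its eigenvalue is a pairing with `Ē`, hence a trace.
  rw [D.rootSpace_eq_smul B hθ.1.1 hE h1 hn]
  congr 1
  choose! e he using fun α (hα : α ∈ D.posRoots) => D.exists_unit_rootVector B hα.1
  rw [cx_casimirCx hX, D.ad_conj_ad_eq B hθ hE hn e he, map_neg, map_add, map_sum,
    LinearMap.trace_smulRight, dualVecCx, B.cx_mk, form_dualVec, ← dualInner_eq, hB, rho,
    dualInner_eq]
  have h2 : ∀ α ∈ (D.finite_posRoots B).toFinset, LinearMap.trace ℂ (Cx 𝔤)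
      ((α (D.dualVec B θ) : ℂ) • (B.cx (e α)).smulRight (conjCx (e α))) = α (D.dualVec B θ) := by
    intro α hα
    rw [map_smul, LinearMap.trace_smulRight, (he α ((D.finite_posRoots B).mem_toFinset.mp hα)).2,
      smul_eq_mul, mul_one]
  -- The trace is `-(2 + ∑ ⟨α, θ⟩)` over the positive roots, and that sum is `2 ⟨ρ, θ⟩`. The
  -- normalization `⟨θ, θ⟩ = 2` produces the summand `1`.
  rw [Finset.sum_congr rfl h2, LinearMap.smul_apply, LinearMap.sum_apply, smul_eq_mul]
  push_cast
  ring

end CartanChoice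
end RootVectors
end LoopSpin

namespace LoopSpin

open Filter

/-! ### Locally finite sums over the integers, and the anomaly of a shift. -/

section LocallyFinite

variable {M : Type*} [AddCommGroup M]

/-- A function on the integers vanishes outside a bounded interval. -/
def BddSupport (f : ℤ → M) : Prop := ∃ N : ℤ, ∀ n, N < |n| → f n = 0

/-- The form with "eventually" lets several locally finite sums be compared over one common
symmetric window. -/
theorem BddSupport.eventually_sum {f : ℤ → M} (h : BddSupport f) :
    ∀ᶠ N : ℤ in atTop, ∑ n ∈ Finset.Icc (-N) N, f n = ∑ᶠ n, f n := by
  obtain ⟨N₀, hN₀⟩ := h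
  filter_upwards [eventually_ge_atTop N₀] with N hN
  symm
  apply finsum_eq_sum_of_support_subset
  intro n hn
  rw [Finset.coe_Icc, Set.mem_Icc, ← abs_le]
  by_contra hlt
  exact hn (hN₀ n (by omega))

theorem BddSupport.add {f g : ℤ → M} (hf : BddSupport f) (hg : BddSupport g) :
    BddSupport (fun n => f n + g n) := by
  obtain ⟨N, hN⟩ := hf
  obtain ⟨N', hN'⟩ := hg
  refine ⟨max N N', fun n hn => ?_⟩
  change f n + g n = 0
  rw [hN n (by omega), hN' n (by omega), add_zero]

variable [Module ℂ M] {V : Type*} [AddCommGroup V] [Module ℂ V]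

/-- The sum of a family of linear maps that is finite on each vector. -/
def locSum (f : ℤ → V →ₗ[ℂ] M) (h : ∀ x, BddSupport fun n => f n x) : V →ₗ[ℂ] M where
  toFun x := ∑ᶠ n, f n x
  map_add' x y := by
    obtain ⟨N, h1, h2, h3⟩ := ((h x).eventually_sum.and
      ((h y).eventually_sum.and (h (x + y)).eventually_sum)).exists
    rw [← h1, ← h2, ← h3, ← Finset.sum_add_distrib]
    exact Finset.sum_congr rfl fun n _ => map_add _ _ _
  map_smul' c x := by
    obtain ⟨N, h1, h2⟩ := ((h x).eventually_sum.and (h (c • x)).eventually_sum).exists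
    rw [← h1, ← h2, RingHom.id_apply, Finset.smul_sum]
    exact Finset.sum_congr rfl fun n _ => map_smul _ _ _

theorem locSum_apply (f : ℤ → V →ₗ[ℂ] M) (h : ∀ x, BddSupport fun n => f n x) (x : V) :
    locSum f h x = ∑ᶠ n, f n x := rfl

theorem eventually_locSum (f : ℤ → V →ₗ[ℂ] M) (h : ∀ x, BddSupport fun n => f n x) (x : V) :
    ∀ᶠ N : ℤ in atTop, locSum f h x = ∑ n ∈ Finset.Icc (-N) N, f n x :=
  (h x).eventually_sum.mono fun _ h => h.symm

/-- The sum telescopes to the difference of the limits at the two ends. Comparison with a step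
function reduces it to a finitely supported sequence, for which a shift changes nothing. -/
theorem eventually_sum_sub_pred {u : ℤ → M} {e : M} (h0 : ∀ᶠ n : ℤ in atTop, u n = 0)
    (h1 : ∀ᶠ n : ℤ in atTop, u (-n) = e) :
    ∀ᶠ N : ℤ in atTop, ∑ n ∈ Finset.Icc (-N) N, (u n - u (n - 1)) = -e := by
  obtain ⟨N₀, hN₀⟩ := eventually_atTop.mp h0
  obtain ⟨N₁, hN₁⟩ := eventually_atTop.mp h1
  set g : ℤ → M := fun n => if n < 0 then e else 0 with hg
  set w : ℤ → M := fun n => u n - g n with hw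
  have hwb : BddSupport w := by
    refine ⟨max 0 (max N₀ N₁), fun n hn => ?_⟩
    rcases lt_or_ge n 0 with hneg | hpos
    · rw [abs_of_neg hneg] at hn
      have := hN₁ (-n) (by omega)
      rw [neg_neg] at this
      simp [hw, hg, this, hneg]
    · rw [abs_of_nonneg hpos] at hn
      have := hN₀ n (by omega)
      simp [hw, hg, this, not_lt_of_ge hpos]
  have hwb' : BddSupport fun n => w (n - 1) := by
    obtain ⟨N, hN⟩ := hwb
    refine ⟨N + 1, fun n hn => hN _ ?_⟩
    rcases abs_cases n with h | h <;> rcases abs_cases (n - 1) with h' | h' <;> omega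
  have hshift : ∑ᶠ n, w (n - 1) = ∑ᶠ n, w n := finsum_comp_equiv (Equiv.subRight (1 : ℤ))
  filter_upwards [hwb.eventually_sum, hwb'.eventually_sum, eventually_ge_atTop 0] with N hN hN' hN0
  -- The step function jumps only from `-1` to `0`.
  have hgs : ∀ n, g n - g (n - 1) = if n = 0 then -e else 0 := by
    intro n
    simp only [hg]
    split_ifs <;> first | omega | simp
  have : ∀ n, u n - u (n - 1) = (w n - w (n - 1)) + (if n = 0 then -e else 0) := by
    intro n; rw [← hgs]; simp only [hw]; abel
  simp only [this]
  rw [Finset.sum_add_distrib, Finset.sum_sub_distrib, hN, hN', hshift, sub_self, zero_add,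
    Finset.sum_ite_eq', if_pos (Finset.mem_Icc.mpr ⟨by omega, hN0⟩)]

/-- A shift by `k` is a composite of `k` unit shifts, each contributing `-e`. This is the source of
the factor `k` in the cocycle. -/
theorem eventually_sum_sub_shift {u : ℤ → M} {e : M} (h0 : ∀ᶠ n : ℤ in atTop, u n = 0)
    (h1 : ∀ᶠ n : ℤ in atTop, u (-n) = e) (k : ℤ) :
    ∀ᶠ N : ℤ in atTop, ∑ n ∈ Finset.Icc (-N) N, (u n - u (n - k)) = -(k • e) := by
  have hs : ∀ j : ℤ, ∀ᶠ N : ℤ in atTop,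
      ∑ n ∈ Finset.Icc (-N) N, (u (n - j) - u (n - j - 1)) = -e := by
    intro j
    have := eventually_sum_sub_pred (u := fun n => u (n - j)) (e := e)
      ((tendsto_atTop_add_const_right atTop (-j) tendsto_id).eventually h0) (by
        have := (tendsto_atTop_add_const_right atTop j tendsto_id).eventually h1
        refine this.mono fun n hn => ?_
        rw [← hn]; congr 1; simp only [id]; ring)
    refine this.mono fun N hN => ?_
    rw [← hN]
    refine Finset.sum_congr rfl fun n _ => ?_
    congr 2; ring
  induction k using Int.induction_on with
  | zero => simp
  | succ i ih =>
    filter_upwards [ih, hs i] with N hN hN'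
    rw [add_smul, neg_add, ← hN, one_smul, ← hN', ← Finset.sum_add_distrib]
    refine Finset.sum_congr rfl fun n _ => ?_
    rw [sub_sub n]; abel
  | pred i ih =>
    filter_upwards [ih, hs (-i - 1)] with N hN hN'
    rw [sub_smul, neg_sub', ← hN, one_smul, ← hN', ← Finset.sum_sub_distrib]
    refine Finset.sum_congr rfl fun n _ => ?_
    rw [show n - (-(i : ℤ) - 1) - 1 = n - -i by ring]; abel

end LocallyFinite

/-! ### Fourier modes, and the invariant element `∑ X_a ⊗ X_a`. -/

section Modes

variable {𝔤 : Type*} [LieRing 𝔤] [LieAlgebra ℝ 𝔤]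

/-- The linear map `X ↦ X z ^ k`. -/
def modeHom (k : ℤ) : Cx 𝔤 →ₗ[ℂ] Loop 𝔤 :=
  TensorProduct.mk ℂ (AddMonoidAlgebra ℂ ℤ) (Cx 𝔤) (AddMonoidAlgebra.single k 1)

theorem mode_lie (j k : ℤ) (X Y : Cx 𝔤) : ⁅mode j X, mode k Y⁆ = mode (j + k) ⁅X, Y⁆ := by
  rw [mode, mode, loopMk_lie, AddMonoidAlgebra.single_mul_single, mul_one]; rfl

theorem mode_add (k : ℤ) (X Y : Cx 𝔤) : mode k (X + Y) = mode k X + mode k Y :=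
  map_add (modeHom k) X Y

theorem mode_sub (k : ℤ) (X Y : Cx 𝔤) : mode k (X - Y) = mode k X - mode k Y :=
  map_sub (modeHom k) X Y

theorem mode_smul (k : ℤ) (c : ℂ) (X : Cx 𝔤) : mode k (c • X) = c • mode k X :=
  map_smul (modeHom k) c X

theorem mode_zero (k : ℤ) : mode k (0 : Cx 𝔤) = 0 := map_zero (modeHom k)

theorem sum_mode (ξ : Loop 𝔤) : ∑ k ∈ (fourier ξ).support, mode k (fourier ξ k) = ξ := by
  apply fourier.injective
  rw [map_sum]
  conv_rhs => rw [← Finsupp.sum_single (fourier ξ)]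
  exact Finset.sum_congr rfl fun k _ => fourier_mode k _

theorem fourier_lie_mode (ξ : Loop 𝔤) (k m : ℤ) (X : Cx 𝔤) :
    fourier ⁅ξ, mode k X⁆ m = ⁅fourier ξ (m - k), X⁆ := by
  induction ξ using Loop.induct_mode with
  | h0 => simp
  | hadd a b ha hb => simp only [add_lie, map_add, Finsupp.add_apply, ha, hb]
  | hmk j Y =>
    rw [mode_lie, fourier_mode, fourier_mode, Finsupp.single_apply, Finsupp.single_apply]
    by_cases h : j + k = m
    · rw [if_pos h, if_pos (by omega)]
    · rw [if_neg h, if_neg (by omega), zero_lie]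

variable {B : InvInner 𝔤} {ι : Type*} [Fintype ι] [DecidableEq ι] {X : Module.Basis ι ℝ 𝔤}
  {M : Type*} [AddCommGroup M] [Module ℂ M]

theorem sum_cx_smul_map (hX : ∀ i j, B.form (X i) (X j) = if i = j then 1 else 0)
    (f : Cx 𝔤 →ₗ[ℂ] M) (Z : Cx 𝔤) : ∑ a, B.cx (cxMk 1 (X a)) Z • f (cxMk 1 (X a)) = f Z := by
  conv_rhs => rw [← cx_expand hX Z, map_sum]
  exact Finset.sum_congr rfl fun a _ => (map_smul _ _ _).symm

/-- Invariance of the element `∑ X_a ⊗ X_a`. -/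
theorem sum_lie_right (hX : ∀ i j, B.form (X i) (X j) = if i = j then 1 else 0)
    (f : Cx 𝔤 →ₗ[ℂ] Cx 𝔤 →ₗ[ℂ] M) (Y : Cx 𝔤) :
    ∑ a, f (cxMk 1 (X a)) ⁅Y, cxMk 1 (X a)⁆ = - ∑ a, f ⁅Y, cxMk 1 (X a)⁆ (cxMk 1 (X a)) := by
  have h1 : ∀ a, f (cxMk 1 (X a)) ⁅Y, cxMk 1 (X a)⁆ =
      ∑ b, B.cx (cxMk 1 (X b)) ⁅Y, cxMk 1 (X a)⁆ • f (cxMk 1 (X a)) (cxMk 1 (X b)) := fun a =>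
    (sum_cx_smul_map hX (f (cxMk 1 (X a))) _).symm
  have h2 : ∀ b, f ⁅Y, cxMk 1 (X b)⁆ (cxMk 1 (X b)) =
      ∑ a, B.cx (cxMk 1 (X a)) ⁅Y, cxMk 1 (X b)⁆ • f (cxMk 1 (X a)) (cxMk 1 (X b)) := fun b =>
    (sum_cx_smul_map hX (f.flip (cxMk 1 (X b))) _).symm
  -- In an orthonormal basis `ad Y` has a skew matrix, so interchanging the two indices produces the
  -- sign.
  rw [Finset.sum_congr rfl fun a _ => h1 a, Finset.sum_congr rfl fun b _ => h2 b, Finset.sum_comm,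
    ← Finset.sum_neg_distrib]
  refine Finset.sum_congr rfl fun b _ => ?_
  rw [← Finset.sum_neg_distrib]
  refine Finset.sum_congr rfl fun a _ => ?_
  rw [← neg_smul, B.cx_symm (cxMk 1 (X a)), B.cx_inv, neg_neg]

end Modes

end LoopSpin

/-! ### Positive energy Clifford modules, and the operators of loops. -/

namespace LoopSpin

open Filter

variable {𝔤 : Type*} [LieRing 𝔤] [LieAlgebra ℝ 𝔤] [FiniteDimensional ℝ 𝔤]

namespace CartanChoice

variable (D : CartanChoice 𝔤) (B : InvInner 𝔤)

/-- The form on loops for `ε = 0`, its degeneration on the constant loops in `𝔱` for `ε = 1`. -/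
def modForm (ε : ℂ) (ξ η : Loop 𝔤) : ℂ :=
  B.loop ξ η - ε * B.cx (D.projTorus B (fourier ξ 0)) (D.projTorus B (fourier η 0))

theorem modForm_symm (ε : ℂ) (ξ η : Loop 𝔤) : D.modForm B ε ξ η = D.modForm B ε η ξ := by
  rw [modForm, modForm, B.loop_symm, B.cx_symm (D.projTorus B (fourier ξ 0))]

theorem modForm_mode_of_ne (ε : ℂ) {m : ℤ} (hm : m ≠ 0) (Z : Cx 𝔤) (η : Loop 𝔤) :
    D.modForm B ε (mode m Z) η = B.loop (mode m Z) η := by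
  rw [modForm, fourier_mode, Finsupp.single_apply, if_neg hm]; simp

theorem cx_projTorus_right (U V : Cx 𝔤) :
    B.cx (D.projTorus B U) (D.projTorus B V) = B.cx U (D.projTorus B V) := by
  obtain ⟨N, hN, hU⟩ := D.exists_decomp B U
  have hV := (D.projTorus B V).2
  conv_rhs => rw [hU]
  rw [map_add, map_add, LinearMap.add_apply, LinearMap.add_apply,
    B.cx_symm (D.projPlus B U), D.cx_torus_nPlus B hV (D.projPlus_mem B U),
    B.cx_symm N, D.cx_torus_nMinus B hV hN, add_zero, add_zero]

/-- The loops whose coefficients commute with `𝔱`, and all loops if `ε = 0`. -/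
def loopCentralizer (ε : ℂ) : Submodule ℂ (Loop 𝔤) where
  carrier := {ξ | ∀ k, ∀ T ∈ D.torusCx, ε • ⁅fourier ξ k, T⁆ = 0}
  add_mem' := by
    intro ξ η hξ hη k T hT
    rw [map_add, Finsupp.add_apply, add_lie, smul_add, hξ k T hT, hη k T hT, add_zero]
  zero_mem' := by intro k T _; simp
  smul_mem' := by
    intro c ξ hξ k T hT
    rw [map_smul, Finsupp.smul_apply, smul_lie, smul_comm, hξ k T hT, smul_zero]

variable {D B} {ε : ℂ}

theorem mode_mem_loopCentralizer {k : ℤ} {Y : Cx 𝔤} (hY : ∀ T ∈ D.torusCx, ε • ⁅Y, T⁆ = 0) :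
    mode k Y ∈ D.loopCentralizer ε := by
  intro j T hT
  rw [fourier_mode, Finsupp.single_apply]
  split_ifs
  · exact hY T hT
  · simp

theorem smul_lie_mode_torus {ξ : Loop 𝔤} (hξ : ξ ∈ D.loopCentralizer ε) {T : Cx 𝔤}
    (hT : T ∈ D.torusCx) (k : ℤ) : ε • ⁅ξ, mode k T⁆ = 0 := by
  apply fourier.injective
  ext1 m
  rw [map_smul, Finsupp.smul_apply, fourier_lie_mode, hξ _ T hT]; simp

/-- The correction is `ε` times the pairing of `[ξ, η]` with a constant loop in `𝔱_ℂ`. By invariance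
this is a pairing with `ε [ξ, T] = 0`. -/
theorem modForm_lie {ξ : Loop 𝔤} (hξ : ξ ∈ D.loopCentralizer ε) (η ζ : Loop 𝔤) :
    D.modForm B ε ⁅ξ, η⁆ ζ = B.loop ⁅ξ, η⁆ ζ := by
  set T := D.projTorus B (fourier ζ 0) with hT
  have h1 : B.loop (ε • ⁅ξ, mode 0 (T : Cx 𝔤)⁆) η = 0 := by
    rw [smul_lie_mode_torus hξ T.2, map_zero, LinearMap.zero_apply]
  rw [map_smul, LinearMap.smul_apply, smul_eq_mul, B.loop_inv] at h1
  rw [modForm, cx_projTorus_right, B.cx_symm, ← loop_const B, ← hT]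
  linear_combination h1

/-- The centralizer is graded, so identities linear in `ξ` need only be checked on its homogeneous
elements. -/
theorem loopCentralizer_induct {p : Loop 𝔤 → Prop} {ξ : Loop 𝔤} (hξ : ξ ∈ D.loopCentralizer ε)
    (h0 : p 0) (hadd : ∀ ξ η, p ξ → p η → p (ξ + η))
    (hmk : ∀ k Y, mode k Y ∈ D.loopCentralizer ε → p (mode k Y)) : p ξ := by
  rw [← sum_mode ξ]
  exact Finset.sum_induction _ p hadd h0 fun k _ => hmk k _ (mode_mem_loopCentralizer (hξ k))

end CartanChoice

open CartanChoice

/-- A positive energy module for the Clifford algebra of the form `modForm`, generated by vectors on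
which the Clifford multiplication by negative affine root spaces is zero. -/
structure SpinModule (D : CartanChoice 𝔤) (B : InvInner 𝔤) (ε : ℂ) (M : Type*) [AddCommGroup M]
    [Module ℂ M] where
  op : Loop 𝔤 →ₗ[ℂ] Module.End ℂ M
  sq : ∀ ξ x, op ξ (op ξ x) = D.modForm B ε ξ ξ • x
  vac : Submodule ℂ M
  annih : ∀ ξ, D.projLoop B ξ = 0 → D.projTorus B (fourier ξ 0) = 0 → ∀ v ∈ vac, op ξ v = 0
  gen : ∀ p : Submodule ℂ M, vac ≤ p → (∀ w ∈ D.posLoops, ∀ x ∈ p, op w x ∈ p) → p = ⊤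

namespace SpinModule

variable {D : CartanChoice 𝔤} {B : InvInner 𝔤} {ε : ℂ} {M : Type*} [AddCommGroup M] [Module ℂ M]
  (F : SpinModule D B ε M)

theorem anticomm (ξ η : Loop 𝔤) (x : M) :
    F.op ξ (F.op η x) + F.op η (F.op ξ x) = (2 * D.modForm B ε ξ η) • x := by
  have h := F.sq (ξ + η) x
  have h1 : D.modForm B ε (ξ + η) (ξ + η) = D.modForm B ε ξ ξ + D.modForm B ε η η
      + 2 * D.modForm B ε ξ η := by
    simp only [modForm, map_add, LinearMap.add_apply, Finsupp.add_apply, Submodule.coe_add,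
      B.loop_symm η ξ, B.cx_symm (D.projTorus B (fourier η 0)) (D.projTorus B (fourier ξ 0))]
    ring
  rw [h1, map_add, LinearMap.add_apply, LinearMap.add_apply, map_add, map_add, F.sq, F.sq,
    add_smul, add_smul] at h
  rw [← add_right_inj (D.modForm B ε ξ ξ • x + D.modForm B ε η η • x), ← h]
  abel

theorem swap (ξ η : Loop 𝔤) (x : M) :
    F.op ξ (F.op η x) = (2 * D.modForm B ε ξ η) • x - F.op η (F.op ξ x) :=
  eq_sub_of_add_eq (F.anticomm ξ η x)

theorem projLoop_mode_neg {j : ℤ} (hj : 0 < j) (Z : Cx 𝔤) : D.projLoop B (mode (-j) Z) = 0 := by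
  rw [projLoop_mode, projCoeff, if_neg (by omega), if_neg (by omega), LinearMap.zero_apply,
    mode_zero]

/-- Positive energy: the property holds on the vacuum and survives multiplication by a loop `w`,
since `z^(-j)` pairs to zero with `w` once `j` exceeds all degrees in `w`. -/
theorem eventually_op_mode (x : M) : ∀ᶠ j : ℤ in atTop, ∀ Z, F.op (mode (-j) Z) x = 0 := by
  let p : Submodule ℂ M :=
    { carrier := {x | ∀ᶠ j : ℤ in atTop, ∀ Z, F.op (mode (-j) Z) x = 0}
      add_mem' := by
        intro x y hx hy
        filter_upwards [hx, hy] with j hjx hjy Z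
        rw [map_add, hjx, hjy, add_zero]
      zero_mem' := by simp
      smul_mem' := by
        intro c x hx
        filter_upwards [hx] with j hj Z
        rw [map_smul, hj, smul_zero] }
  have hp : p = ⊤ := by
    refine F.gen p ?_ ?_
    · intro v hv
      filter_upwards [eventually_gt_atTop 0] with j hj Z
      refine F.annih _ (projLoop_mode_neg hj Z) ?_ v hv
      rw [fourier_mode, Finsupp.single_apply, if_neg (by omega), map_zero]
    · intro w _ x hx
      have hx : ∀ᶠ j : ℤ in atTop, ∀ Z, F.op (mode (-j) Z) x = 0 := hx
      obtain ⟨J, hJ⟩ := (fourier w).support.bddAbove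
      change ∀ᶠ j : ℤ in atTop, ∀ Z, F.op (mode (-j) Z) (F.op w x) = 0
      filter_upwards [hx, eventually_gt_atTop J, eventually_gt_atTop 0] with j hj hjJ hj0 Z
      rw [F.swap, hj, map_zero, sub_zero, modForm_mode_of_ne D B ε (by omega)]
      have h1 : B.loop (mode (-j) Z) w = 0 := by
        rw [← sum_mode w, map_sum]
        refine Finset.sum_eq_zero fun k hk => ?_
        have := hJ hk
        rw [B.loop_mode, if_neg (by omega)]
      rw [h1, mul_zero, zero_smul]
  have : x ∈ p := by rw [hp]; trivial
  exact this

theorem eventually_op_mode_add (k : ℤ) (x : M) :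
    ∀ᶠ j : ℤ in atTop, ∀ Z, F.op (mode (k - j) Z) x = 0 := by
  have h := (tendsto_atTop_add_const_right atTop (-k) tendsto_id).eventually (F.eventually_op_mode x)
  filter_upwards [h] with j hj Z
  have := hj Z
  rwa [id, neg_add, neg_neg, add_comm (-j), ← sub_eq_add_neg] at this

variable {ι : Type*} [Fintype ι] [DecidableEq ι] (X : Module.Basis ι ℝ 𝔤)

/-- The contribution of the modes `n` and `-n` to the operator of a loop. -/
def term (n : ℤ) : Loop 𝔤 →ₗ[ℂ] Module.End ℂ M :=
  -- The Clifford relation contributes a factor 2, and each commutator with a mode arises from two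
  -- summation indices, whence the quarter.
  (1 / 4 : ℂ) • ∑ a, LinearMap.mulRight ℂ (F.op (mode (-n) (cxMk 1 (X a)))) ∘ₗ F.op ∘ₗ
    (-LieAlgebra.ad ℂ (Loop 𝔤) (mode n (cxMk 1 (X a))))

theorem term_apply (n : ℤ) (ξ : Loop 𝔤) (x : M) :
    F.term X n ξ x = (1 / 4 : ℂ) • ∑ a, F.op ⁅ξ, mode n (cxMk 1 (X a))⁆
      (F.op (mode (-n) (cxMk 1 (X a))) x) := by
  simp only [term, LinearMap.smul_apply, LinearMap.sum_apply, LinearMap.comp_apply,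
    LinearMap.mulRight_apply, Module.End.mul_apply, LinearMap.neg_apply, LieAlgebra.ad_apply,
    lie_skew]

theorem eventually_bddSupport {f : ℤ → M} (h1 : ∀ᶠ n : ℤ in atTop, f n = 0)
    (h2 : ∀ᶠ n : ℤ in atTop, f (-n) = 0) : BddSupport f := by
  obtain ⟨N, hN⟩ := eventually_atTop.mp (h1.and h2)
  refine ⟨N, fun n hn => ?_⟩
  rcases abs_cases n with ⟨h, _⟩ | ⟨h, _⟩
  · exact (hN n (by omega)).1
  · have := (hN (-n) (by omega)).2
    rwa [neg_neg] at this

theorem cx_lie_self (Y Z : Cx 𝔤) : B.cx ⁅Y, Z⁆ Z = 0 := by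
  have h := B.cx_inv Y Z Z
  rw [B.cx_symm Z] at h
  exact self_eq_neg.mp h

/-- For large `n` the right factor annihilates `x`. For very negative `n` the left one does after
the factors are exchanged, and the scalar so produced is zero because `ad Y` is skew. -/
theorem term_bddSupport (ξ : Loop 𝔤) (x : M) : BddSupport fun n => F.term X n ξ x := by
  induction ξ using Loop.induct_mode with
  | h0 => exact ⟨0, fun n _ => by simp⟩
  | hadd a b ha hb =>
    simp only [map_add, LinearMap.add_apply]
    exact ha.add hb
  | hmk k Y =>
    apply eventually_bddSupport
    · filter_upwards [F.eventually_op_mode x] with n hn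
      rw [term_apply]
      simp only [hn, map_zero, Finset.sum_const_zero, smul_zero]
    · filter_upwards [F.eventually_op_mode_add k x, eventually_gt_atTop 0] with n hn hn0
      rw [term_apply, Finset.sum_eq_zero, smul_zero]
      intro a _
      rw [mode_lie, ← sub_eq_add_neg, neg_neg, F.swap, hn, map_zero, sub_zero, modForm_symm,
        modForm_mode_of_ne D B ε hn0.ne', B.loop_symm, B.loop_mode, cx_lie_self]
      simp

/-- The operator of a loop. -/
def loopOp : Loop 𝔤 →ₗ[ℂ] Module.End ℂ M where
  toFun ξ := locSum (fun n => F.term X n ξ) (F.term_bddSupport X ξ)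
  map_add' ξ η := by
    ext1 x
    obtain ⟨N, h1, h2, h3⟩ := ((F.term_bddSupport X ξ x).eventually_sum.and
      ((F.term_bddSupport X η x).eventually_sum.and
        (F.term_bddSupport X (ξ + η) x).eventually_sum)).exists
    rw [LinearMap.add_apply, locSum_apply, locSum_apply, locSum_apply, ← h1, ← h2, ← h3, ← Finset.sum_add_distrib]
    exact Finset.sum_congr rfl fun n _ => by rw [map_add, LinearMap.add_apply]
  map_smul' c ξ := by
    ext1 x
    obtain ⟨N, h1, h2⟩ := ((F.term_bddSupport X ξ x).eventually_sum.and
        (F.term_bddSupport X (c • ξ) x).eventually_sum).exists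
    rw [RingHom.id_apply, LinearMap.smul_apply, locSum_apply, locSum_apply, ← h1, ← h2, Finset.smul_sum]
    exact Finset.sum_congr rfl fun n _ => by rw [map_smul, LinearMap.smul_apply]

theorem eventually_loopOp (ξ : Loop 𝔤) (x : M) :
    ∀ᶠ N : ℤ in atTop, F.loopOp X ξ x = ∑ n ∈ Finset.Icc (-N) N, F.term X n ξ x :=
  eventually_locSum _ (F.term_bddSupport X ξ) x

variable {X}

/-- A quadratic Clifford element acts on vectors by commutators as an infinitesimal rotation; every
commutator formula below rests on this. -/
theorem comm_pair (ξ η ζ : Loop 𝔤) (x : M) :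
    F.op ξ (F.op η (F.op ζ x)) - F.op ζ (F.op ξ (F.op η x)) =
      (2 * D.modForm B ε η ζ) • F.op ξ x - (2 * D.modForm B ε ξ ζ) • F.op η x := by
  rw [F.swap η ζ, map_sub, map_smul, F.swap ξ ζ (F.op η x)]
  abel

/-- The commutator of one term of the operator of a loop with Clifford multiplication. -/
theorem term_comm (hX : ∀ i j, B.form (X i) (X j) = if i = j then 1 else 0) {ξ : Loop 𝔤}
    (hξ : ξ ∈ D.loopCentralizer ε) (k m n : ℤ) (Y Z : Cx 𝔤) (hY : ξ = mode k Y) (x : M) :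
    F.term X n ξ (F.op (mode m Z) x) - F.op (mode m Z) (F.term X n ξ x) =
      ((if n = m then (1 / 2 : ℂ) else 0) + (if n = -k - m then 1 / 2 else 0)) •
        F.op ⁅ξ, mode m Z⁆ x := by
  rw [term_apply, term_apply, map_smul, map_sum, ← smul_sub, ← Finset.sum_sub_distrib]
  simp only [comm_pair]
  rw [Finset.sum_sub_distrib, smul_sub, add_smul, sub_eq_add_neg]
  congr 1
  · by_cases hnm : n = m
    swap
    · rw [if_neg hnm, zero_smul, Finset.sum_eq_zero, smul_zero]
      intro a _
      have : D.modForm B ε (mode (-n) (cxMk 1 (X a))) (mode m Z) = 0 := by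
        rw [modForm, B.loop_mode, if_neg (by omega), fourier_mode, fourier_mode,
          Finsupp.single_apply, Finsupp.single_apply]
        by_cases hn : n = 0
        · rw [if_neg (c := m = 0) (by omega)]; simp
        · rw [if_neg (c := -n = 0) (by omega)]; simp
      rw [this, mul_zero, zero_smul]
    · subst hnm
      rw [if_pos rfl]
      -- The multiple `ε U` of the `𝔱_ℂ`-part of a constant loop is invisible to `modForm`. It may
      -- be dropped after bracketing with `ξ`, since `ε [ξ, U] = 0`.
      set U : Cx 𝔤 := if n = 0 then (D.projTorus B Z : Cx 𝔤) else 0 with hU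
      have hUt : U ∈ D.torusCx := by
        rw [hU]; split_ifs
        · exact (D.projTorus B Z).2
        · exact zero_mem _
      have h1 : ∀ W : Cx 𝔤, D.modForm B ε (mode (-n) W) (mode n Z) = B.cx W (Z - ε • U) := by
        intro W
        rw [modForm, B.loop_mode, if_pos (by omega), fourier_mode, fourier_mode,
          Finsupp.single_apply, Finsupp.single_apply, hU]
        by_cases hn : n = 0
        · simp only [hn, neg_zero, if_true]
          rw [cx_projTorus_right, map_sub, map_smul, smul_eq_mul]
        · simp [hn]
      have h2 : ∀ a, (2 * D.modForm B ε (mode (-n) (cxMk 1 (X a))) (mode n Z)) •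
          F.op ⁅ξ, mode n (cxMk 1 (X a))⁆ x = (2 : ℂ) • (B.cx (cxMk 1 (X a)) (Z - ε • U) •
            ((F.op.flip x) ∘ₗ (LieAlgebra.ad ℂ (Loop 𝔤) ξ) ∘ₗ modeHom n) (cxMk 1 (X a))) := by
        intro a
        rw [h1, mul_smul]; rfl
      rw [Finset.sum_congr rfl fun a _ => h2 a, ← Finset.smul_sum, sum_cx_smul_map hX, smul_smul]
      have h3 : ⁅ξ, mode n (Z - ε • U)⁆ = ⁅ξ, mode n Z⁆ := by
        rw [mode_sub, mode_smul, lie_sub, lie_smul, smul_lie_mode_torus hξ hUt, sub_zero]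
      change _ • F.op ⁅ξ, mode n (Z - ε • U)⁆ x = _
      rw [h3]
      congr 1; norm_num
  -- The left factor has degree `k + n`, so it pairs with degree `m` only for `n = -k - m`; moving
  -- `ad Y` over to `Z` gives the second half of the bracket.
  · have h1 : ∀ a, (2 * D.modForm B ε ⁅ξ, mode n (cxMk 1 (X a))⁆ (mode m Z)) •
          F.op (mode (-n) (cxMk 1 (X a))) x = (-2 * (if n = -k - m then 1 else 0) : ℂ) •
          (B.cx (cxMk 1 (X a)) ⁅Y, Z⁆ •
            ((F.op.flip x) ∘ₗ modeHom (-n)) (cxMk 1 (X a))) := by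
      intro a
      rw [modForm_lie hξ, hY, mode_lie, B.loop_mode, smul_smul]
      change _ • F.op (mode (-n) (cxMk 1 (X a))) x = _ • F.op (mode (-n) (cxMk 1 (X a))) x
      congr 1
      by_cases h : n = -k - m
      · rw [if_pos h, if_pos (by omega), B.cx_inv]; ring
      · rw [if_neg h, if_neg (by omega)]; ring
    rw [Finset.sum_congr rfl fun a _ => h1 a, ← Finset.smul_sum, sum_cx_smul_map hX, smul_smul]
    change -(_ • F.op (mode (-n) ⁅Y, Z⁆) x) = _
    by_cases h : n = -k - m
    · rw [if_pos h, if_pos h, hY, mode_lie, show -n = k + m by omega, ← neg_smul]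
      congr 1; norm_num
    · rw [if_neg h, if_neg h]; simp

/-- The operator of a loop lifts its adjoint action. -/
theorem loopOp_comm (hX : ∀ i j, B.form (X i) (X j) = if i = j then 1 else 0) {ξ : Loop 𝔤}
    (hξ : ξ ∈ D.loopCentralizer ε) (η : Loop 𝔤) (x : M) :
    F.loopOp X ξ (F.op η x) = F.op ⁅ξ, η⁆ x + F.op η (F.loopOp X ξ x) := by
  refine loopCentralizer_induct (p := fun ξ => F.loopOp X ξ (F.op η x) =
    F.op ⁅ξ, η⁆ x + F.op η (F.loopOp X ξ x)) hξ ?_ ?_ ?_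
  · simp
  · intro a b ha hb
    simp only [map_add, LinearMap.add_apply, add_lie, ha, hb]
    abel
  intro k Y hξ
  induction η using Loop.induct_mode with
  | h0 => simp
  | hadd a b ha hb => simp only [map_add, LinearMap.add_apply, lie_add, ha, hb]; abel
  | hmk m Z =>
    rw [← sub_eq_iff_eq_add]
    -- The window must contain both contributing indices `m` and `-k - m`; their halves then add up
    -- to one.
    obtain ⟨N, h1, h2, h3, h4, h5, h6⟩ := ((F.eventually_loopOp X (mode k Y) (F.op (mode m Z) x)).and
      ((F.eventually_loopOp X (mode k Y) x).and ((eventually_ge_atTop m).and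
        ((eventually_ge_atTop (-m)).and ((eventually_ge_atTop (-k - m)).and
          (eventually_ge_atTop (k + m))))))).exists
    rw [h1, h2, map_sum, ← Finset.sum_sub_distrib,
      Finset.sum_congr rfl fun n _ => F.term_comm hX hξ k m n Y Z rfl x, ← Finset.sum_smul,
      Finset.sum_add_distrib, Finset.sum_ite_eq', Finset.sum_ite_eq',
      if_pos (Finset.mem_Icc.mpr ⟨by omega, by omega⟩),
      if_pos (Finset.mem_Icc.mpr ⟨by omega, by omega⟩)]
    norm_num

end SpinModule
end LoopSpin

/-! ### The rotation operator, and the commutator of two loop operators. -/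

namespace LoopSpin

open Filter CartanChoice

variable {𝔤 : Type*} [LieRing 𝔤] [LieAlgebra ℝ 𝔤] [FiniteDimensional ℝ 𝔤]

namespace SpinModule

variable {D : CartanChoice 𝔤} {B : InvInner 𝔤} {ε : ℂ} {M : Type*} [AddCommGroup M] [Module ℂ M]
  (F : SpinModule D B ε M)

variable {ι : Type*} [Fintype ι] [DecidableEq ι] (X : Module.Basis ι ℝ 𝔤)

/-- The contribution of the modes `n` and `-n` to the operator of the infinitesimal rotation. -/
def rotTerm (n : ℤ) : Module.End ℂ M :=
  if 0 < n then (Complex.I / 2 * n) • ∑ a,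
    F.op (mode n (cxMk 1 (X a))) * F.op (mode (-n) (cxMk 1 (X a))) else 0

theorem rotTerm_apply {n : ℤ} (hn : 0 < n) (x : M) : F.rotTerm X n x =
    (Complex.I / 2 * n) • ∑ a,
      F.op (mode n (cxMk 1 (X a))) (F.op (mode (-n) (cxMk 1 (X a))) x) := by
  rw [rotTerm, if_pos hn, LinearMap.smul_apply, LinearMap.sum_apply]; rfl

theorem rotTerm_bddSupport (x : M) : BddSupport fun n => F.rotTerm X n x := by
  apply eventually_bddSupport
  · filter_upwards [F.eventually_op_mode x, eventually_gt_atTop 0] with n hn hn0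
    rw [rotTerm_apply _ _ hn0]
    simp only [hn, map_zero, Finset.sum_const_zero, smul_zero]
  · filter_upwards [eventually_gt_atTop 0] with n hn
    rw [rotTerm, if_neg (by omega), LinearMap.zero_apply]

/-- The operator of the infinitesimal rotation. -/
def rotOp : Module.End ℂ M := locSum (F.rotTerm X) (F.rotTerm_bddSupport X)

theorem eventually_rotOp (x : M) :
    ∀ᶠ N : ℤ in atTop, F.rotOp X x = ∑ n ∈ Finset.Icc (-N) N, F.rotTerm X n x :=
  eventually_locSum _ (F.rotTerm_bddSupport X) x

variable {X}

/-- Only `n = |m|` contributes: for `m > 0` by contracting the right factor, for `m < 0` the left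
one with a minus sign. Both give the eigenvalue `i m` of `∂_θ`. -/
theorem rotTerm_comm (hX : ∀ i j, B.form (X i) (X j) = if i = j then 1 else 0) (m n : ℤ)
    (Z : Cx 𝔤) (x : M) :
    F.rotTerm X n (F.op (mode m Z) x) - F.op (mode m Z) (F.rotTerm X n x) =
      (if n = |m| then Complex.I * m else 0) • F.op (mode m Z) x := by
  rcases lt_or_ge 0 n with hn | hn
  swap
  · rw [rotTerm, if_neg (by omega), LinearMap.zero_apply, LinearMap.zero_apply, map_zero, sub_zero]
    have : (if n = |m| then Complex.I * (m : ℂ) else 0) = 0 := by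
      split_ifs with h
      · have h1 : m = 0 := abs_nonpos_iff.mp (h ▸ hn)
        simp [h1]
      · rfl
    rw [this, zero_smul]
  rw [rotTerm_apply _ _ hn, rotTerm_apply _ _ hn, map_smul, map_sum, ← smul_sub,
    ← Finset.sum_sub_distrib]
  have h1 : ∀ a, F.op (mode n (cxMk 1 (X a))) (F.op (mode (-n) (cxMk 1 (X a)))
        (F.op (mode m Z) x)) - F.op (mode m Z) (F.op (mode n (cxMk 1 (X a)))
        (F.op (mode (-n) (cxMk 1 (X a))) x)) =
      (if n = m then 2 else 0 : ℂ) • B.cx (cxMk 1 (X a)) Z •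
        (F.op.flip x ∘ₗ modeHom n) (cxMk 1 (X a)) -
      (if n = -m then 2 else 0 : ℂ) • B.cx (cxMk 1 (X a)) Z •
        (F.op.flip x ∘ₗ modeHom (-n)) (cxMk 1 (X a)) := by
    intro a
    rw [comm_pair, modForm_mode_of_ne D B ε (by omega), modForm_mode_of_ne D B ε (by omega),
      B.loop_mode, B.loop_mode, smul_smul, smul_smul]
    change _ = _ • F.op (mode n (cxMk 1 (X a))) x - _ • F.op (mode (-n) (cxMk 1 (X a))) x
    congr 2
    · by_cases h : n = m
      · rw [if_pos h, if_pos (by omega)]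
      · rw [if_neg h, if_neg (by omega)]; simp
    · by_cases h : n = -m
      · rw [if_pos h, if_pos (by omega)]
      · rw [if_neg h, if_neg (by omega)]; simp
  rw [Finset.sum_congr rfl fun a _ => h1 a, Finset.sum_sub_distrib, ← Finset.smul_sum,
    ← Finset.smul_sum, sum_cx_smul_map hX, sum_cx_smul_map hX]
  change _ • (_ • F.op (mode n Z) x - _ • F.op (mode (-n) Z) x) = _
  rcases abs_cases m with ⟨h, h'⟩ | ⟨h, h'⟩
  · rw [if_neg (c := n = -m) (by omega), zero_smul, sub_zero, h]
    split_ifs with hnm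
    · subst hnm
      rw [smul_smul]; congr 1; ring
    · simp
  · rw [if_neg (c := n = m) (by omega), zero_smul, zero_sub, h]
    split_ifs with hnm
    · have : m = -n := by omega
      subst this
      rw [← neg_smul, smul_smul]; congr 1; push_cast; ring
    · simp

theorem rotOp_comm (hX : ∀ i j, B.form (X i) (X j) = if i = j then 1 else 0) (η : Loop 𝔤) (x : M) :
    F.rotOp X (F.op η x) = F.op (rot η) x + F.op η (F.rotOp X x) := by
  induction η using Loop.induct_mode with
  | h0 => simp
  | hadd a b ha hb => simp only [map_add, LinearMap.add_apply, ha, hb]; abel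
  | hmk m Z =>
    rw [← sub_eq_iff_eq_add]
    obtain ⟨N, h1, h2, h3⟩ := ((F.eventually_rotOp X (F.op (mode m Z) x)).and
      ((F.eventually_rotOp X x).and (eventually_ge_atTop |m|))).exists
    have := abs_nonneg m
    rw [h1, h2, map_sum, ← Finset.sum_sub_distrib,
      Finset.sum_congr rfl fun n _ => F.rotTerm_comm hX m n Z x, ← Finset.sum_smul,
      Finset.sum_ite_eq', if_pos (Finset.mem_Icc.mpr ⟨by omega, by omega⟩), rot_mode, map_smul,
      LinearMap.smul_apply]

/-- The eigenvalues `i n` and `-i n` of the two basis modes in each term cancel, so the commutator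
can be taken term by term without a central correction. -/
theorem rotOp_loopOp (hX : ∀ i j, B.form (X i) (X j) = if i = j then 1 else 0) (ξ : Loop 𝔤)
    (x : M) : F.rotOp X (F.loopOp X ξ x) = F.loopOp X (rot ξ) x + F.loopOp X ξ (F.rotOp X x) := by
  obtain ⟨N, h1, h2, h3⟩ := ((F.eventually_loopOp X ξ x).and
      ((F.eventually_loopOp X (rot ξ) x).and (F.eventually_loopOp X ξ (F.rotOp X x)))).exists
  rw [h1, h2, h3, map_sum, ← Finset.sum_add_distrib]
  refine Finset.sum_congr rfl fun n _ => ?_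
  rw [term_apply, term_apply, term_apply, map_smul, map_sum, ← smul_add, ← Finset.sum_add_distrib]
  congr 1
  refine Finset.sum_congr rfl fun a _ => ?_
  rw [F.rotOp_comm hX, F.rotOp_comm hX, rot_lie, rot_mode, rot_mode, map_add, lie_smul, map_smul,
    map_smul, LinearMap.add_apply, LinearMap.smul_apply, LinearMap.smul_apply, map_add, map_smul]
  push_cast
  module

/-- The correction terms in the commutator of two loop operators. -/
def crossTerm (X : Module.Basis ι ℝ 𝔤) (ξ η : Loop 𝔤) (n : ℤ) (x : M) : M :=
  (1 / 4 : ℂ) • ∑ a, F.op ⁅η, ⁅ξ, mode n (cxMk 1 (X a))⁆⁆ (F.op (mode (-n) (cxMk 1 (X a))) x)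

/-- The Jacobi identity splits the action on the left factor into the term of the bracket and a
cross term. Invariance of `∑ X_a ⊗ X_a` turns the action on the right factor into minus that cross
term, with index shifted by the degree `k`. -/
theorem loopOp_term (hX : ∀ i j, B.form (X i) (X j) = if i = j then 1 else 0) {k : ℤ} {Y : Cx 𝔤}
    (hY : mode k Y ∈ D.loopCentralizer ε) (η : Loop 𝔤) (n : ℤ) (x : M) :
    F.loopOp X (mode k Y) (F.term X n η x) = F.term X n η (F.loopOp X (mode k Y) x) +
      (F.term X n ⁅mode k Y, η⁆ x +
        (F.crossTerm X (mode k Y) η n x - F.crossTerm X (mode k Y) η (n - k) x)) := by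
  let f : Cx 𝔤 →ₗ[ℂ] Cx 𝔤 →ₗ[ℂ] M := LinearMap.mk₂ ℂ
    (fun P Q => F.op ⁅η, mode n P⁆ (F.op (mode (k - n) Q) x))
    (by intro P Q R; simp only [mode_add, lie_add, map_add, LinearMap.add_apply])
    (by intro c P Q; simp only [mode_smul, lie_smul, map_smul, LinearMap.smul_apply])
    (by intro P Q R; simp only [mode_add, map_add, LinearMap.add_apply])
    (by intro c P Q; simp only [mode_smul, map_smul, LinearMap.smul_apply])
  have h1 := sum_lie_right hX f Y
  have h2 : ∀ a, f (cxMk 1 (X a)) ⁅Y, cxMk 1 (X a)⁆ = F.op ⁅η, mode n (cxMk 1 (X a))⁆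
      (F.op ⁅mode k Y, mode (-n) (cxMk 1 (X a))⁆ x) := fun a => by
    rw [mode_lie, ← sub_eq_add_neg]; rfl
  have h3 : ∀ a, f ⁅Y, cxMk 1 (X a)⁆ (cxMk 1 (X a)) =
      F.op ⁅η, ⁅mode k Y, mode (n - k) (cxMk 1 (X a))⁆⁆ (F.op (mode (-(n - k)) (cxMk 1 (X a))) x) :=
    fun a => by
      rw [mode_lie, show k + (n - k) = n by ring, neg_sub]; rfl
  rw [Finset.sum_congr rfl fun a _ => h2 a, Finset.sum_congr rfl fun a _ => h3 a] at h1
  rw [sub_eq_add_neg, crossTerm, crossTerm, ← smul_neg, ← h1, term_apply, term_apply, term_apply,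
    map_smul, map_sum, ← smul_add, ← smul_add, ← smul_add, ← Finset.sum_add_distrib,
    ← Finset.sum_add_distrib, ← Finset.sum_add_distrib]
  congr 1
  refine Finset.sum_congr rfl fun a _ => ?_
  rw [F.loopOp_comm hX hY, F.loopOp_comm hX hY, leibniz_lie (mode k Y) η, map_add, map_add,
    LinearMap.add_apply]
  abel

/-- The commutator of the operators of two loops, with the central term. -/
theorem loopOp_lie (hX : ∀ i j, B.form (X i) (X j) = if i = j then 1 else 0) {c : ℝ}
    (hc : (-(1 / 2) : ℝ) • ∑ i, LieAlgebra.ad ℝ 𝔤 (X i) ∘ₗ LieAlgebra.ad ℝ 𝔤 (X i)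
      = c • LinearMap.id) {ξ η : Loop 𝔤} (hξ : ξ ∈ D.loopCentralizer ε)
    (hη : η ∈ D.loopCentralizer ε) (x : M) :
    F.loopOp X ξ (F.loopOp X η x) - F.loopOp X η (F.loopOp X ξ x) =
      F.loopOp X ⁅ξ, η⁆ x + (Complex.I * c * B.loop ξ (rot η)) • x := by
  refine loopCentralizer_induct (p := fun ξ => F.loopOp X ξ (F.loopOp X η x) -
    F.loopOp X η (F.loopOp X ξ x) = F.loopOp X ⁅ξ, η⁆ x + (Complex.I * c * B.loop ξ (rot η)) • x)
    hξ ?_ ?_ ?_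
  · simp
  · intro a b ha hb
    simp only [map_add, LinearMap.add_apply, add_lie, mul_add, add_smul]
    rw [add_sub_add_comm, ha, hb]; abel
  intro k Y hY
  refine loopCentralizer_induct (p := fun η => F.loopOp X (mode k Y) (F.loopOp X η x) -
    F.loopOp X η (F.loopOp X (mode k Y) x) = F.loopOp X ⁅mode k Y, η⁆ x +
      (Complex.I * c * B.loop (mode k Y) (rot η)) • x) hη ?_ ?_ ?_
  · simp
  · intro a b ha hb
    simp only [map_add, LinearMap.add_apply, lie_add, mul_add, add_smul]
    rw [add_sub_add_comm, ha, hb]; abel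
  intro l Z hZ
  have h0 : ∀ᶠ n : ℤ in atTop, F.crossTerm X (mode k Y) (mode l Z) n x = 0 := by
    filter_upwards [F.eventually_op_mode x] with n hn
    simp only [crossTerm, hn, map_zero, Finset.sum_const_zero, smul_zero]
  -- Unlike the terms of a loop operator, the cross terms do not die out at `-∞`: exchanging the
  -- factors leaves a scalar, which is a trace of `ad Z ad Y`.
  have h1 : ∀ᶠ n : ℤ in atTop, F.crossTerm X (mode k Y) (mode l Z) (-n) x =
      (if l + k = 0 then -c * B.cx Y Z else 0 : ℂ) • x := by
    filter_upwards [F.eventually_op_mode_add (l + k) x, eventually_gt_atTop 0] with n hn hn0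
    have h2 : ∀ a, F.op ⁅mode l Z, ⁅mode k Y, mode (-n) (cxMk 1 (X a))⁆⁆
        (F.op (mode (- -n) (cxMk 1 (X a))) x) = (2 * (if l + k = 0 then
          B.cx ⁅Z, ⁅Y, cxMk 1 (X a)⁆⁆ (cxMk 1 (X a)) else 0)) • x := by
      intro a
      rw [mode_lie, mode_lie, show l + (k + -n) = l + k - n by ring, F.swap, hn, map_zero, sub_zero,
        modForm_symm, modForm_mode_of_ne D B ε (by omega), B.loop_symm, B.loop_mode]
      congr 2
      by_cases h : l + k = 0
      · rw [if_pos h, if_pos (by omega)]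
      · rw [if_neg h, if_neg (by omega)]
    rw [crossTerm, Finset.sum_congr rfl fun a _ => h2 a, ← Finset.sum_smul, smul_smul,
      ← Finset.mul_sum]
    congr 1
    split_ifs
    -- The constant is `1/4 · 2 · (-2 c) = -c`.
    · rw [sum_cx_lie_lie hX hc]; ring
    · simp
  -- Neither half of the cross terms need be summable alone, so their differences are summed over a
  -- finite window.
  obtain ⟨N, e1, e2, e3, e4⟩ := ((F.eventually_loopOp X (mode l Z) x).and
    ((F.eventually_loopOp X (mode l Z) (F.loopOp X (mode k Y) x)).and
      ((F.eventually_loopOp X ⁅mode k Y, mode l Z⁆ x).and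
        (eventually_sum_sub_shift h0 h1 k)))).exists
  rw [e1, e2, e3, map_sum, Finset.sum_congr rfl fun n _ => F.loopOp_term hX hY (mode l Z) n x,
    Finset.sum_add_distrib, Finset.sum_add_distrib, e4, add_sub_cancel_left]
  congr 1
  rw [rot_mode, map_smul, B.loop_mode, ← Int.cast_smul_eq_zsmul ℂ, smul_smul, ← neg_smul, smul_eq_mul]
  congr 1
  by_cases h : l + k = 0
  · have hl : l = -k := by omega
    subst hl
    rw [if_pos (by ring), if_pos (by ring)]
    push_cast
    linear_combination (c * k * B.cx Y Z : ℂ) * Complex.I_mul_I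
  · rw [if_neg h, if_neg (by omega)]; simp

end SpinModule
end LoopSpin

/-! ### The number operator, vacuum vectors and the commutant. -/

namespace LoopSpin

open Filter CartanChoice

variable {𝔤 : Type*} [LieRing 𝔤] [LieAlgebra ℝ 𝔤] [FiniteDimensional ℝ 𝔤]

theorem loop_mode_neg (B : InvInner 𝔤) (n : ℤ) (Z : Cx 𝔤) (w : Loop 𝔤) :
    B.loop (mode (-n) Z) w = B.cx Z (fourier w n) := by
  induction w using Loop.induct_mode with
  | h0 => simp
  | hadd a b ha hb => simp only [map_add, Finsupp.add_apply, ha, hb]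
  | hmk k Y =>
    rw [B.loop_mode, fourier_mode, Finsupp.single_apply]
    by_cases h : k = n
    · rw [if_pos h, if_pos (by omega)]
    · rw [if_neg h, if_neg (by omega), map_zero]

namespace CartanChoice

variable (D : CartanChoice 𝔤) (B : InvInner 𝔤)

theorem projPlus_of_mem_nPlus {P : Cx 𝔤} (hP : P ∈ D.nPlus) : D.projPlus B P = P := by
  simp only [projPlus]
  exact Submodule.projection_apply_left (D.isCompl_nPlus B) ⟨P, hP⟩

theorem projTorus_of_mem_nPlus {P : Cx 𝔤} (hP : P ∈ D.nPlus) : D.projTorus B P = 0 := by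
  simp only [projTorus]
  exact (Submodule.projectionOnto_apply_eq_zero_iff _).mpr (Submodule.mem_sup_left hP)

theorem projPlus_of_mem_nMinus {N : Cx 𝔤} (hN : N ∈ D.nMinus) : D.projPlus B N = 0 := by
  simp only [projPlus]
  exact (Submodule.projection_apply_eq_zero_iff _).mpr (Submodule.mem_sup_right hN)

theorem projTorus_of_mem_nMinus {N : Cx 𝔤} (hN : N ∈ D.nMinus) : D.projTorus B N = 0 := by
  simp only [projTorus]
  exact (Submodule.projectionOnto_apply_eq_zero_iff _).mpr (Submodule.mem_sup_right hN)

theorem projPlus_of_mem_torusCx {T : Cx 𝔤} (hT : T ∈ D.torusCx) : D.projPlus B T = 0 := by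
  simp only [projPlus]
  exact (Submodule.projection_apply_eq_zero_iff _).mpr (Submodule.mem_sup_left hT)

theorem projTorus_of_mem_torusCx {T : Cx 𝔤} (hT : T ∈ D.torusCx) :
    (D.projTorus B T : Cx 𝔤) = T := by
  simp only [projTorus]
  exact congrArg Subtype.val (Submodule.projectionOnto_apply_left (D.isCompl_torusCx B) ⟨T, hT⟩)

theorem projLoop_of_mem {w : Loop 𝔤} (hw : w ∈ D.posLoops) : D.projLoop B w = w := by
  apply fourier.injective
  ext1 k
  rw [fourier_projLoop, projCoeff]
  rcases lt_trichotomy k 0 with h | h | h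
  · rw [if_neg (by omega), if_neg h.ne, hw.2 k h, map_zero]
  · subst h
    rw [if_neg (by omega), if_pos rfl, D.projPlus_of_mem_nPlus B hw.1]
  · rw [if_pos h, LinearMap.id_apply]

theorem loop_posLoops {w w' : Loop 𝔤} (hw : w ∈ D.posLoops) (hw' : w' ∈ D.posLoops) :
    B.loop w w' = 0 := by
  have h := D.loop_proj B w w'
  rw [D.projLoop_of_mem B hw, D.projLoop_of_mem B hw', D.projTorus_of_mem_nPlus B hw.1] at h
  simpa using h

theorem modForm_posLoops (ε : ℂ) {w w' : Loop 𝔤} (hw : w ∈ D.posLoops) (hw' : w' ∈ D.posLoops) :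
    D.modForm B ε w w' = 0 := by
  rw [modForm, D.loop_posLoops B hw hw', D.projTorus_of_mem_nPlus B hw.1]
  simp

/-- The negative part of a constant loop, and all of a loop of nonzero degree. -/
def negCoeff (n : ℤ) (Z : Cx 𝔤) : Cx 𝔤 :=
  if n = 0 then Z - D.projTorus B Z - D.projPlus B Z else Z

theorem negCoeff_zero_mem (Z : Cx 𝔤) : D.negCoeff B 0 Z ∈ D.nMinus := by
  obtain ⟨N, hN, hZ⟩ := D.exists_decomp B Z
  have : D.negCoeff B 0 Z = N := by
    rw [negCoeff, if_pos rfl]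
    nth_rewrite 1 [hZ]
    abel
  rwa [this]

theorem projTorus_negCoeff {n : ℤ} (Z : Cx 𝔤) :
    D.projTorus B (fourier (mode (-n) (D.negCoeff B n Z)) 0) = 0 := by
  rw [fourier_mode, Finsupp.single_apply]
  split_ifs with h
  · have : n = 0 := by omega
    subst this
    exact D.projTorus_of_mem_nMinus B (D.negCoeff_zero_mem B Z)
  · rw [map_zero]

theorem projLoop_negCoeff {n : ℤ} (hn : 0 ≤ n) (Z : Cx 𝔤) :
    D.projLoop B (mode (-n) (D.negCoeff B n Z)) = 0 := by
  rw [projLoop_mode, projCoeff, if_neg (by omega)]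
  split_ifs with h
  · have : n = 0 := by omega
    subst this
    rw [D.projPlus_of_mem_nMinus B (D.negCoeff_zero_mem B Z), mode_zero]
  · rw [LinearMap.zero_apply, mode_zero]

/-- The discarded parts in `𝔱_ℂ` and `𝔫_+` are orthogonal to `𝔫_+`, so the annihilation part alone
already detects the coefficients of a positive loop. -/
theorem modForm_negCoeff (ε : ℂ) (n : ℤ) (Z : Cx 𝔤) {w : Loop 𝔤} (hw : w ∈ D.posLoops) :
    D.modForm B ε (mode (-n) (D.negCoeff B n Z)) w = B.cx Z (fourier w n) := by
  rw [modForm, projTorus_negCoeff, loop_mode_neg]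
  have : B.cx (D.negCoeff B n Z) (fourier w n) = B.cx Z (fourier w n) := by
    rw [negCoeff]
    split_ifs with h
    · subst h
      rw [map_sub, map_sub, LinearMap.sub_apply, LinearMap.sub_apply,
        D.cx_torus_nPlus B (D.projTorus B Z).2 hw.1, D.cx_nPlus B (D.projPlus_mem B Z) hw.1,
        sub_zero, sub_zero]
    · rfl
  rw [this]; simp

end CartanChoice

namespace SpinModule

variable {D : CartanChoice 𝔤} {B : InvInner 𝔤} {ε : ℂ} {M : Type*} [AddCommGroup M] [Module ℂ M]
  (F : SpinModule D B ε M)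

variable {ι : Type*} [Fintype ι] [DecidableEq ι] (X : Module.Basis ι ℝ 𝔤)

/-- The number operator for the modes of degree at most `J`. -/
def numOp (J : ℤ) : Module.End ℂ M := (1 / 2 : ℂ) • ∑ n ∈ Finset.Icc 0 J, ∑ a,
  F.op (D.projLoop B (mode n (cxMk 1 (X a)))) * F.op (mode (-n) (D.negCoeff B n (cxMk 1 (X a))))

theorem numOp_apply (J : ℤ) (x : M) : F.numOp X J x = (1 / 2 : ℂ) • ∑ n ∈ Finset.Icc 0 J, ∑ a,
    F.op (D.projLoop B (mode n (cxMk 1 (X a))))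
      (F.op (mode (-n) (D.negCoeff B n (cxMk 1 (X a)))) x) := by
  simp only [numOp, LinearMap.smul_apply, LinearMap.sum_apply, Module.End.mul_apply]

theorem numOp_eq_zero (J : ℤ) {x : M} (hx : ∀ ξ, D.projLoop B ξ = 0 →
    D.projTorus B (fourier ξ 0) = 0 → F.op ξ x = 0) : F.numOp X J x = 0 := by
  rw [numOp_apply, Finset.sum_eq_zero, smul_zero]
  intro n hn
  refine Finset.sum_eq_zero fun a _ => ?_
  rw [hx _ (D.projLoop_negCoeff B (Finset.mem_Icc.mp hn).1 _) (D.projTorus_negCoeff B _), map_zero]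

variable {X}

/-- By `comm_pair` only the annihilation factor contracts with `w`, and summing over the basis
rebuilds the coefficients of `w`. The cutoff `J` keeps the operator a finite sum and must exceed all
degrees in `w`. -/
theorem numOp_comm (hX : ∀ i j, B.form (X i) (X j) = if i = j then 1 else 0) {w : Loop 𝔤}
    (hw : w ∈ D.posLoops) {J : ℤ} (hJ : ∀ k ∈ (fourier w).support, k ≤ J) (x : M) :
    F.numOp X J (F.op w x) = F.op w x + F.op w (F.numOp X J x) := by
  rw [← sub_eq_iff_eq_add, numOp_apply, numOp_apply, map_smul, ← smul_sub, map_sum,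
    ← Finset.sum_sub_distrib]
  have h1 : ∀ n ∈ Finset.Icc 0 J, ∑ a, F.op (D.projLoop B (mode n (cxMk 1 (X a))))
      (F.op (mode (-n) (D.negCoeff B n (cxMk 1 (X a)))) (F.op w x)) - F.op w (∑ a,
        F.op (D.projLoop B (mode n (cxMk 1 (X a))))
        (F.op (mode (-n) (D.negCoeff B n (cxMk 1 (X a)))) x)) =
      (2 : ℂ) • F.op (D.projLoop B (mode n (fourier w n))) x := by
    intro n hn
    rw [map_sum, ← Finset.sum_sub_distrib]
    have h2 : ∀ a, F.op (D.projLoop B (mode n (cxMk 1 (X a))))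
      (F.op (mode (-n) (D.negCoeff B n (cxMk 1 (X a)))) (F.op w x)) - F.op w (
        F.op (D.projLoop B (mode n (cxMk 1 (X a))))
        (F.op (mode (-n) (D.negCoeff B n (cxMk 1 (X a)))) x)) =
        (2 : ℂ) • (B.cx (cxMk 1 (X a)) (fourier w n) •
          (F.op.flip x ∘ₗ D.projLoop B ∘ₗ modeHom n) (cxMk 1 (X a))) := by
      intro a
      rw [comm_pair, D.modForm_posLoops B ε (D.projLoop_mem B _) hw, D.modForm_negCoeff B ε n _ hw,
        mul_zero, zero_smul, sub_zero, mul_smul]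
      rfl
    rw [Finset.sum_congr rfl fun a _ => h2 a, ← Finset.smul_sum, sum_cx_smul_map hX]
    rfl
  rw [Finset.sum_congr rfl h1, ← Finset.smul_sum, smul_smul]
  have h3 : ∑ n ∈ Finset.Icc 0 J, mode n (fourier w n) = w := by
    conv_rhs => rw [← sum_mode w]
    symm
    apply Finset.sum_subset
    · intro k hk
      refine Finset.mem_Icc.mpr ⟨?_, hJ k hk⟩
      by_contra hlt
      exact (Finsupp.mem_support_iff.mp hk) (hw.2 k (by omega))
    · intro k _ hk
      rw [Finsupp.notMem_support_iff.mp hk, mode_zero]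
  rw [← LinearMap.sum_apply, ← map_sum, ← map_sum, h3, D.projLoop_of_mem B hw]
  norm_num

variable (X) in
/-- The vacuum vectors and the sum of the eigenspaces of the number operator for positive
integers. -/
def numSum (J : ℤ) : Submodule ℂ M :=
  F.vac ⊔ ⨆ k : ℕ, (F.numOp X J).eigenspace ((k : ℂ) + 1)

/-- Each multiplication by a positive loop raises the particle number by one. The cutoff depends on
`x`, because a vector involves only finitely many loops. -/
theorem eventually_mem_numSum (hX : ∀ i j, B.form (X i) (X j) = if i = j then 1 else 0) (x : M) :
    ∀ᶠ J in atTop, x ∈ F.numSum X J := by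
  let p : Submodule ℂ M :=
    { carrier := {x | ∀ᶠ J in atTop, x ∈ F.numSum X J}
      add_mem' := fun hx hy => (hx.and hy).mono fun J h => add_mem h.1 h.2
      zero_mem' := Eventually.of_forall fun J => zero_mem _
      smul_mem' := fun c x hx => hx.mono fun J h => Submodule.smul_mem _ c h }
  have hp : p = ⊤ := by
    refine F.gen p (fun v hv => Eventually.of_forall fun J => Submodule.mem_sup_left hv) ?_
    intro w hw x hx
    obtain ⟨K, hK⟩ := (fourier w).support.bddAbove
    have hx : ∀ᶠ J in atTop, x ∈ F.numSum X J := hx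
    refine (hx.and (eventually_ge_atTop K)).mono fun J hJ => ?_
    have hc := F.numOp_comm hX hw (J := J) (fun k hk => (hK hk).trans hJ.2)
    have h1 : F.numSum X J ≤ (F.numSum X J).comap (F.op w) := by
      refine sup_le (fun v hv => ?_) (iSup_le fun k y hy => ?_)
      -- A vacuum vector is sent to particle number one, which is the index `0` in the supremum.
      · refine Submodule.mem_sup_right (Submodule.mem_iSup_of_mem 0 ?_)
        rw [Module.End.mem_eigenspace_iff, hc, F.numOp_eq_zero X J fun ξ h h' => F.annih ξ h h' v hv]
        simp
      · refine Submodule.mem_sup_right (Submodule.mem_iSup_of_mem (k + 1) ?_)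
        rw [Module.End.mem_eigenspace_iff] at hy ⊢
        rw [hc, hy, map_smul]
        push_cast
        module
    exact h1 hJ.1
  have : x ∈ p := by rw [hp]; trivial
  exact this

/-- A vector on which the Clifford multiplication by all negative affine root spaces is zero is a
vacuum vector. -/
theorem mem_vac (hX : ∀ i j, B.form (X i) (X j) = if i = j then 1 else 0) {x : M}
    (hx : ∀ ξ, D.projLoop B ξ = 0 → D.projTorus B (fourier ξ 0) = 0 → F.op ξ x = 0) :
    x ∈ F.vac := by
  obtain ⟨J, hJ⟩ := (F.eventually_mem_numSum hX x).exists
  obtain ⟨v, hv, y, hy, rfl⟩ := Submodule.mem_sup.mp hJ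
  have h1 := F.numOp_eq_zero X J hx
  rw [map_add, F.numOp_eq_zero X J fun ξ h h' => F.annih ξ h h' v hv, zero_add] at h1
  have h2 : y ∈ (F.numOp X J).eigenspace 0 := by
    rw [Module.End.mem_eigenspace_iff, h1, zero_smul]
  -- The part `y` outside the vacuum has number zero as well as positive numbers; independence of
  -- eigenspaces forces it to vanish.
  have h3 : (⨆ k : ℕ, (F.numOp X J).eigenspace ((k : ℂ) + 1)) ≤
      ⨆ j, ⨆ (_ : j ≠ 0), (F.numOp X J).eigenspace j :=
    iSup_le fun k => le_iSup₂_of_le ((k : ℂ) + 1) (by exact_mod_cast Nat.succ_ne_zero k) le_rfl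
  have h4 : y = 0 := by
    have := ((F.numOp X J).eigenspaces_iSupIndep 0).le_bot ⟨h2, h3 hy⟩
    simpa using this
  rw [h4, add_zero]
  exact hv

theorem commutant_vac (hX : ∀ i j, B.form (X i) (X j) = if i = j then 1 else 0)
    {T : Module.End ℂ M} (hT : ∀ ξ, D.projTorus B (fourier ξ 0) = 0 → ∀ x,
      T (F.op ξ x) = F.op ξ (T x)) {v : M} (hv : v ∈ F.vac) : T v ∈ F.vac :=
  F.mem_vac hX fun ξ h h' => by rw [← hT ξ h', F.annih ξ h h' v hv, map_zero]

/-- Where `T` agrees with a scalar is stable under the creation operators, and these generate the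
module from the vacuum. -/
theorem commutant_eq_smul {T : Module.End ℂ M} (hT : ∀ ξ, D.projTorus B (fourier ξ 0) = 0 → ∀ x,
      T (F.op ξ x) = F.op ξ (T x)) {r : ℂ} (hr : ∀ v ∈ F.vac, T v = r • v) : T = r • 1 := by
  have h : LinearMap.ker (T - r • 1) = ⊤ := by
    refine F.gen _ (fun v hv => ?_) fun w hw x hx => ?_
    · rw [LinearMap.mem_ker, LinearMap.sub_apply, hr v hv, LinearMap.smul_apply,
        Module.End.one_apply, sub_self]
    · rw [LinearMap.mem_ker, LinearMap.sub_apply, LinearMap.smul_apply, Module.End.one_apply,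
        sub_eq_zero] at hx ⊢
      rw [hT w (D.projTorus_of_mem_nPlus B hw.1), hx, map_smul]
  exact sub_eq_zero.mp (LinearMap.ker_eq_top.mp h)

end SpinModule

/-! ### Independence of the central charge from the lift. -/

section Uniqueness

variable {B : InvInner 𝔤} {V : Submodule ℂ (Loop 𝔤)} {S : Type*} [AddCommGroup S] [Module ℂ S]
  {c : CliffordAlgebra (B.quad V) →ₐ[ℂ] Module.End ℂ S}

/-- If the commutant of the Clifford algebra is scalar, all lifts agree on brackets. -/
theorem SpinLift.op_lie_eq
    (hc : ∀ T : Module.End ℂ S, (∀ v, T * c (CliffordAlgebra.ι _ v) = c (CliffordAlgebra.ι _ v) * T) →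
      ∃ r : ℂ, T = r • 1) (π π' : SpinLift c) (x y : stab B V) :
    π.op ⁅x, y⁆ = π'.op ⁅x, y⁆ := by
  -- The difference of two lifts of one element commutes with Clifford multiplication; such scalars
  -- drop out of commutators.
  have h : ∀ x, ∃ r : ℂ, π.op x = π'.op x + r • 1 := by
    intro x
    obtain ⟨r, hr⟩ := hc (π.op x - π'.op x) fun v => by
      have h1 := π.equivariant x v
      rw [← π'.equivariant x v] at h1
      rw [sub_mul, mul_sub, sub_eq_sub_iff_sub_eq_sub, h1]
    exact ⟨r, by rw [← hr]; abel⟩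
  obtain ⟨r, hr⟩ := h x
  obtain ⟨s, hs⟩ := h y
  rw [π.map_lie, π'.map_lie, hr, hs]
  simp only [add_mul, mul_add, smul_mul_assoc, mul_smul_comm, one_mul, mul_one]
  module

/-- The centre is reached by a bracket: `[H z, H z⁻¹] = -i ⟨H, H⟩ I`, and the coefficient is nonzero
by positivity. -/
theorem SpinLift.op_centre_eq
    (hc : ∀ T : Module.End ℂ S, (∀ v, T * c (CliffordAlgebra.ι _ v) = c (CliffordAlgebra.ι _ v) * T) →
      ∃ r : ℂ, T = r • 1) (π π' : SpinLift c) {H : 𝔤} (hH : H ≠ 0)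
    (hst : ∀ k, (⟨0, mode k (cxMk 1 H), 0⟩ : Affine B) ∈ stab B V) :
    π.op (centre B V) = π'.op (centre B V) := by
  have hne : (-Complex.I * B.form H H : ℂ) ≠ 0 :=
    mul_ne_zero (neg_ne_zero.mpr Complex.I_ne_zero) (by exact_mod_cast (B.pos H hH).ne')
  have h1 : ⁅(⟨_, hst 1⟩ : stab B V), (⟨_, hst (-1)⟩ : stab B V)⁆ =
      (-Complex.I * B.form H H : ℂ) • centre B V := by
    apply Subtype.ext
    apply Affine.ext
    · change (0 : ℂ) = _ * 0
      rw [mul_zero]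
    · change ⁅mode 1 (cxMk 1 H), mode (-1) (cxMk 1 H)⁆ + (0 : ℂ) • rot _ - (0 : ℂ) • rot _ =
        (-Complex.I * B.form H H : ℂ) • (0 : Loop 𝔤)
      rw [mode_lie, lie_self, mode_zero]; simp
    · change B.loop (mode 1 (cxMk 1 H)) (rot (mode (-1) (cxMk 1 H))) = _ * 1
      rw [rot_mode, map_smul, B.loop_mode, if_pos (by norm_num), B.cx_mk]
      simp
  have h2 := π.op_lie_eq hc π' ⟨_, hst 1⟩ ⟨_, hst (-1)⟩
  rw [h1, map_smul, map_smul] at h2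
  exact smul_right_injective _ hne h2

end Uniqueness

/-! ### The lift of the extended Lie algebra with its central charge. -/

namespace SpinModule

variable {D : CartanChoice 𝔤} {B : InvInner 𝔤} {ε : ℂ} {M : Type*} [AddCommGroup M] [Module ℂ M]
  (F : SpinModule D B ε M) {ι : Type*} [Fintype ι] [DecidableEq ι] {X : Module.Basis ι ℝ 𝔤}

variable (X) in
/-- The operators of the extended Lie algebra with central charge `h`. -/
def affineOp (h : ℝ) : Affine B →ₗ[ℂ] Module.End ℂ M where
  toFun x := x.rotPart • F.rotOp X + F.loopOp X x.loopPart + (Complex.I * h * x.centPart) • 1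
  map_add' x y := by
    simp only [Affine.add_rotPart, Affine.add_loopPart, Affine.add_centPart, map_add]
    module
  map_smul' r x := by
    simp only [Affine.smul_rotPart, Affine.smul_loopPart, Affine.smul_centPart, map_smul,
      RingHom.id_apply]
    module

theorem affineOp_apply (h : ℝ) (x : Affine B) (v : M) : F.affineOp X h x v =
    x.rotPart • F.rotOp X v + F.loopOp X x.loopPart v + (Complex.I * h * x.centPart) • v := rfl

/-- The spin representation of the extended Lie algebra. -/
def lift (hX : ∀ i j, B.form (X i) (X j) = if i = j then 1 else 0) {h : ℝ}
    (hh : (-(1 / 2) : ℝ) • ∑ i, LieAlgebra.ad ℝ 𝔤 (X i) ∘ₗ LieAlgebra.ad ℝ 𝔤 (X i)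
      = h • LinearMap.id) {V : Submodule ℂ (Loop 𝔤)}
    (c : CliffordAlgebra (B.quad V) →ₐ[ℂ] Module.End ℂ M)
    (hc : ∀ v, c (CliffordAlgebra.ι _ v) = F.op v)
    (hV : ∀ x ∈ stab B V, x.loopPart ∈ D.loopCentralizer ε) : SpinLift c where
  op := F.affineOp X h ∘ₗ (stab B V).toSubmodule.subtype
  map_lie := by
    rintro ⟨x, hx⟩ ⟨y, hy⟩
    ext1 v
    change F.affineOp X h ⁅x, y⁆ v =
      F.affineOp X h x (F.affineOp X h y v) - F.affineOp X h y (F.affineOp X h x v)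
    simp only [affineOp_apply, map_add, map_smul, Affine.lie_rotPart, Affine.lie_loopPart,
      Affine.lie_centPart, map_sub, LinearMap.add_apply, LinearMap.sub_apply, LinearMap.smul_apply,
      F.rotOp_loopOp hX]
    -- The anomaly matches the action of the central part of the bracket exactly when `I` acts by `i
    -- h`.
    have h1 := sub_eq_iff_eq_add.mp (F.loopOp_lie hX hh (hV x hx) (hV y hy) v)
    rw [h1]
    module
  equivariant := by
    rintro ⟨x, hx⟩ v
    rw [hc, hc]
    ext1 m
    change F.affineOp X h x (F.op v m) - F.op v (F.affineOp X h x m) = F.op (x.act v) m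
    simp only [affineOp_apply, map_add, map_smul, F.rotOp_comm hX, F.loopOp_comm hX (hV x hx),
      Affine.act, LinearMap.add_apply, LinearMap.smul_apply]
    module

theorem hasCentralCharge (hX : ∀ i j, B.form (X i) (X j) = if i = j then 1 else 0) {h : ℝ}
    (hh : (-(1 / 2) : ℝ) • ∑ i, LieAlgebra.ad ℝ 𝔤 (X i) ∘ₗ LieAlgebra.ad ℝ 𝔤 (X i)
      = h • LinearMap.id) {V : Submodule ℂ (Loop 𝔤)}
    (c : CliffordAlgebra (B.quad V) →ₐ[ℂ] Module.End ℂ M)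
    (hc : ∀ v, c (CliffordAlgebra.ι _ v) = F.op v)
    (hV : ∀ x ∈ stab B V, x.loopPart ∈ D.loopCentralizer ε)
    (hs : ∀ T : Module.End ℂ M,
      (∀ v, T * c (CliffordAlgebra.ι _ v) = c (CliffordAlgebra.ι _ v) * T) → ∃ r : ℂ, T = r • 1)
    {H : 𝔤} (hH : H ≠ 0) (hst : ∀ k, (⟨0, mode k (cxMk 1 H), 0⟩ : Affine B) ∈ stab B V) :
    HasCentralCharge c h := by
  refine ⟨⟨F.lift hX hh c hc hV⟩, fun π => ?_⟩
  rw [π.op_centre_eq hs (F.lift hX hh c hc hV) hH hst]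
  ext1 v
  change F.affineOp X h ⟨0, 0, 1⟩ v = _
  rw [affineOp_apply]
  simp

end SpinModule

end LoopSpin

namespace LoopSpin

/-! ### Schur's lemma for Clifford modules of a finite-dimensional space. -/

section Schur

variable {V : Type*} [AddCommGroup V] [Module ℂ V] {Q : QuadraticForm ℂ V}
  {S : Type*} [AddCommGroup S] [Module ℂ S] [Module (CliffordAlgebra Q) S]
  [IsScalarTower ℂ (CliffordAlgebra Q) S]

/-- The Clifford submodule on a subspace stable under Clifford multiplication by vectors. -/
def cliffordSubmodule (P : Submodule ℂ S) (h : ∀ v, ∀ s ∈ P, CliffordAlgebra.ι Q v • s ∈ P) :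
    Submodule (CliffordAlgebra Q) S where
  carrier := P
  add_mem' := P.add_mem
  zero_mem' := P.zero_mem
  smul_mem' := by
    intro a
    induction a using CliffordAlgebra.induction with
    | algebraMap r =>
      intro s hs
      rw [algebraMap_smul]
      exact P.smul_mem r hs
    | ι v => exact fun {s} hs => h v s hs
    | mul a b ha hb => exact fun {s} hs => by rw [mul_smul]; exact ha (hb hs)
    | add a b ha hb => exact fun {s} hs => by rw [add_smul]; exact P.add_mem (ha hs) (hb hs)

theorem mem_cliffordSubmodule (P : Submodule ℂ S)
    (h : ∀ v, ∀ s ∈ P, CliffordAlgebra.ι Q v • s ∈ P) (s : S) :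
    s ∈ cliffordSubmodule P h ↔ s ∈ P := Iff.rfl

theorem eq_top_of_clifford_stable [IsSimpleModule (CliffordAlgebra Q) S] (P : Submodule ℂ S)
    (h : ∀ v, ∀ s ∈ P, CliffordAlgebra.ι Q v • s ∈ P) {s₀ : S} (h0 : s₀ ∈ P) (hne : s₀ ≠ 0) :
    P = ⊤ := by
  rcases eq_bot_or_eq_top (cliffordSubmodule P h) with hb | ht
  · have h1 := (mem_cliffordSubmodule P h s₀).mpr h0
    rw [hb, Submodule.mem_bot] at h1
    exact absurd h1 hne
  · rw [eq_top_iff]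
    intro s _
    rw [← mem_cliffordSubmodule P h, ht]
    trivial

/-- Vectors are added one at a time: if `P` is stable under `t`, the Clifford relations make `P + u
P` stable under `u` and `t`. This yields finite dimension of irreducible modules without a basis of
the Clifford algebra. -/
theorem exists_finite_stable (t : Finset V) (s₀ : S) : ∃ P : Submodule ℂ S, FiniteDimensional ℂ P ∧
    s₀ ∈ P ∧ ∀ v ∈ t, ∀ s ∈ P, CliffordAlgebra.ι Q v • s ∈ P := by
  classical
  induction t using Finset.induction_on with
  | empty =>
    exact ⟨Submodule.span ℂ {s₀}, inferInstance, Submodule.mem_span_singleton_self s₀, by simp⟩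
  | insert u t _ ih =>
    obtain ⟨P, hP, h0, hst⟩ := ih
    let f : S →ₗ[ℂ] S := Algebra.lsmul ℂ ℂ S (CliffordAlgebra.ι Q u)
    refine ⟨P ⊔ P.map f, inferInstance, Submodule.mem_sup_left h0, ?_⟩
    intro v hv s hs
    obtain ⟨p, hp, _, ⟨q, hq, rfl⟩, rfl⟩ := Submodule.mem_sup.mp hs
    change CliffordAlgebra.ι Q v • (p + CliffordAlgebra.ι Q u • q) ∈ _
    rw [smul_add]
    rcases Finset.mem_insert.mp hv with rfl | hv
    · refine add_mem (Submodule.mem_sup_right ⟨p, hp, rfl⟩) (Submodule.mem_sup_left ?_)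
      rw [smul_smul, CliffordAlgebra.ι_sq_scalar, algebraMap_smul]
      exact P.smul_mem _ hq
    · refine add_mem (Submodule.mem_sup_left (hst v hv p hp)) ?_
      rw [smul_smul, CliffordAlgebra.ι_mul_ι_comm, sub_smul, mul_smul, algebraMap_smul]
      exact sub_mem (Submodule.mem_sup_left (P.smul_mem _ hq))
        (Submodule.mem_sup_right ⟨_, hst v hv q hq, rfl⟩)

variable (Q) in
theorem finiteDimensional_of_isSimpleModule [FiniteDimensional ℂ V]
    [IsSimpleModule (CliffordAlgebra Q) S] : FiniteDimensional ℂ S := by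
  have := IsSimpleModule.nontrivial (CliffordAlgebra Q) S
  obtain ⟨s₀, hne⟩ := exists_ne (0 : S)
  obtain ⟨t, ht⟩ := Module.Finite.fg_top (R := ℂ) (M := V)
  obtain ⟨P, hP, h0, hst⟩ := exists_finite_stable (Q := Q) t s₀
  have h : ∀ v, ∀ s ∈ P, CliffordAlgebra.ι Q v • s ∈ P := by
    intro v s hs
    have hv : v ∈ Submodule.span ℂ (t : Set V) := by rw [ht]; trivial
    induction hv using Submodule.span_induction with
    | mem v hv => exact hst v hv s hs
    | zero => rw [map_zero, zero_smul]; exact zero_mem _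
    | add v w _ _ hv hw => rw [map_add, add_smul]; exact add_mem hv hw
    | smul c v _ hv => rw [map_smul, smul_assoc]; exact P.smul_mem c hv
  have hP' := eq_top_of_clifford_stable P h h0 hne
  subst hP'
  exact Module.finite_def.mpr ((Submodule.fg_top _).mp (Module.finite_def.mp hP))

/-- Schur's lemma for irreducible modules of the Clifford algebra of a finite-dimensional space. -/
theorem exists_eq_smul_of_commute [FiniteDimensional ℂ V] [IsSimpleModule (CliffordAlgebra Q) S]
    (T : Module.End ℂ S) (hT : ∀ v s, T (CliffordAlgebra.ι Q v • s) = CliffordAlgebra.ι Q v • T s) :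
    ∃ r : ℂ, ∀ s, T s = r • s := by
  have := finiteDimensional_of_isSimpleModule (S := S) Q
  have := IsSimpleModule.nontrivial (CliffordAlgebra Q) S
  -- Finite dimension is needed only here, for an eigenvalue; the eigenspace is stable under
  -- Clifford multiplication, hence everything.
  obtain ⟨r, hr⟩ := Module.End.exists_eigenvalue T
  obtain ⟨s₀, hs₀⟩ := hr.exists_hasEigenvector
  refine ⟨r, fun s => ?_⟩
  have h := eq_top_of_clifford_stable (Q := Q) (T.eigenspace r) (fun v s hs => by
    rw [Module.End.mem_eigenspace_iff] at hs ⊢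
    rw [hT, hs, smul_algebra_smul_comm]) hs₀.1 hs₀.2
  rw [← Module.End.mem_eigenspace_iff, h]
  trivial

end Schur

/-! ### The two spin representations as positive energy modules. -/

variable {𝔤 : Type*} [LieRing 𝔤] [LieAlgebra ℝ 𝔤] [FiniteDimensional ℝ 𝔤]

namespace CartanChoice

variable (D : CartanChoice 𝔤) (B : InvInner 𝔤)

theorem fockOp_one {ξ : Loop 𝔤} (hξ : D.projLoop B ξ = 0) : D.fockOp B ξ 1 = 0 := by
  have h1 : (⟨D.projLoop B ξ, D.projLoop_mem B ξ⟩ : D.posLoops) = 0 := Subtype.ext hξ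
  have h2 : CliffordAlgebra.contractLeft (B.loop ξ ∘ₗ D.posLoops.subtype) (1 : D.Fock) = 0 :=
    CliffordAlgebra.contractLeft_one (Q := 0) _
  rw [fockOp_apply, h1, h2, map_zero, zero_mul, smul_zero, add_zero]

theorem fockOp_posLoops (w : D.posLoops) (x : D.Fock) :
    D.fockOp B w x = ExteriorAlgebra.ι ℂ w * x := by
  have h1 : (⟨D.projLoop B w, D.projLoop_mem B w⟩ : D.posLoops) = w :=
    Subtype.ext (D.projLoop_of_mem B w.2)
  have h2 : B.loop (w : Loop 𝔤) ∘ₗ D.posLoops.subtype = 0 :=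
    LinearMap.ext fun w' => D.loop_posLoops B w.2 w'.2
  rw [fockOp_apply, h1, h2, map_zero, LinearMap.zero_apply, smul_zero, add_zero]

/-- Induction on the exterior algebra by multiplication with vectors. -/
theorem fock_induct {p : D.Fock → Prop} (x : D.Fock) (h1 : p 1) (hs : ∀ (r : ℂ) x, p x → p (r • x))
    (hadd : ∀ x y, p x → p y → p (x + y)) (hι : ∀ w x, p x → p (ExteriorAlgebra.ι ℂ w * x)) :
    p x := by
  induction x using CliffordAlgebra.left_induction with
  | algebraMap r => rw [Algebra.algebraMap_eq_smul_one]; exact hs r 1 h1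
  | add x y hx hy => exact hadd x y hx hy
  | ι_mul x m hx => exact hι m x hx

/-- The exterior algebra as a positive energy module. -/
def fockModule : SpinModule D B 1 D.Fock where
  op := D.fockOp B
  sq ξ x := by
    rw [fockOp_sq, modForm, one_mul, ← D.two_mul_loop_proj B ξ, add_sub_cancel_right]
  vac := Submodule.span ℂ {1}
  annih ξ hξ _ v hv := by
    obtain ⟨r, rfl⟩ := Submodule.mem_span_singleton.mp hv
    rw [map_smul, D.fockOp_one B hξ, smul_zero]
  gen p hp hst := by
    rw [eq_top_iff]
    intro x _
    refine D.fock_induct (p := fun x => x ∈ p) x (hp (Submodule.mem_span_singleton_self 1))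
      (fun r x hx => p.smul_mem r hx) (fun x y hx hy => p.add_mem hx hy) fun w x hx => ?_
    rw [← D.fockOp_posLoops B]
    exact hst w w.2 x hx

section Full

variable (S : Type*) [AddCommGroup S] [Module ℂ S] [Module (CliffordAlgebra (D.torusQuad B)) S]
  [IsScalarTower ℂ (CliffordAlgebra (D.torusQuad B)) S]

/-- The vectors `s ⊗ 1`. -/
def tmulOne : S →ₗ[ℂ] S ⊗[ℂ] D.Fock := (TensorProduct.mk ℂ S D.Fock).flip 1

theorem tmulOne_apply (s : S) : D.tmulOne S s = s ⊗ₜ 1 := rfl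

/-- The tensor product of a Clifford module of `𝔱_ℂ` and the exterior algebra as a positive energy
module. -/
def fullModule : SpinModule D B 0 (S ⊗[ℂ] D.Fock) where
  op := D.fullOp B S
  sq ξ x := by rw [fullOp_sq, modForm, zero_mul, sub_zero]
  vac := LinearMap.range (D.tmulOne S)
  annih ξ hξ ht v hv := by
    obtain ⟨s, rfl⟩ := hv
    rw [tmulOne_apply, fullOp_tmul, ht, D.fockOp_one B hξ, map_zero, LinearMap.zero_apply,
      TensorProduct.zero_tmul, TensorProduct.tmul_zero, add_zero]
  gen p hp hst := by
    have h : ∀ x : D.Fock, ∀ s : S, s ⊗ₜ[ℂ] x ∈ p := by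
      intro x
      refine D.fock_induct (p := fun x => ∀ s : S, s ⊗ₜ[ℂ] x ∈ p) x (fun s => hp ⟨s, rfl⟩)
        (fun r x hx s => ?_) (fun x y hx hy s => ?_) fun w x hx s => ?_
      · rw [TensorProduct.tmul_smul]; exact p.smul_mem r (hx s)
      · rw [TensorProduct.tmul_add]; exact p.add_mem (hx s) (hy s)
      · have h1 := hst w w.2 _ (hx s)
        rwa [fullOp_tmul, D.projTorus_of_mem_nPlus B w.2.1, map_zero, LinearMap.zero_apply,
          TensorProduct.zero_tmul, zero_add, fockOp_posLoops] at h1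
    rw [eq_top_iff]
    intro x _
    induction x using TensorProduct.induction_on with
    | zero => exact zero_mem _
    | tmul s x => exact h x s
    | add x y hx hy => exact add_mem (hx trivial) (hy trivial)

/-- The coefficient of `1`. -/
def vacPart : S ⊗[ℂ] D.Fock →ₗ[ℂ] S :=
  (TensorProduct.rid ℂ S).toLinearMap ∘ₗ
    (ExteriorAlgebra.algebraMapInv (R := ℂ) (M := D.posLoops)).toLinearMap.lTensor S

theorem vacPart_tmulOne (s : S) : D.vacPart S (D.tmulOne S s) = s := by
  simp [vacPart, tmulOne_apply]

/-- The constant loops in `𝔱_ℂ` act on the vacuum `S ⊗ 1` as on `S` itself, which brings Schur's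
lemma for `S` to bear on the full module. -/
theorem fullOp_torus (T : D.torusCx) (s : S) :
    D.fullOp B S (mode 0 (T : Cx 𝔤)) (D.tmulOne S s) =
      D.tmulOne S (CliffordAlgebra.ι (D.torusQuad B) T • s) := by
  have h1 : D.projTorus B (fourier (mode 0 (T : Cx 𝔤)) 0) = T := by
    rw [fourier_mode, Finsupp.single_eq_same]
    exact Subtype.ext (D.projTorus_of_mem_torusCx B T.2)
  have h2 : D.projLoop B (mode 0 (T : Cx 𝔤)) = 0 := by
    rw [projLoop_mode, projCoeff, if_neg (lt_irrefl _), if_pos rfl,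
      D.projPlus_of_mem_torusCx B T.2, mode_zero]
  have h3 : D.parity 1 = 1 :=
    map_one (CliffordAlgebra.involute (Q := (0 : QuadraticForm ℂ D.posLoops)))
  rw [tmulOne_apply, fullOp_tmul, h1, D.fockOp_one B h2, TensorProduct.tmul_zero, add_zero, h3]
  rfl

end Full

theorem mem_loopModTorus {ξ : Loop 𝔤} :
    ξ ∈ D.loopModTorus B ↔ D.projTorus B (fourier ξ 0) = 0 := by
  constructor
  · intro h
    apply Subtype.ext
    refine D.torusCx_nondegenerate B (D.projTorus B _).2 fun H => ?_
    have h1 := h H H.2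
    have h2 := D.cx_projTorus_right B (cxMk 1 (H : 𝔤)) (fourier ξ 0)
    have h3 := D.cx_projTorus_right B (fourier ξ 0) (cxMk 1 (H : 𝔤))
    rw [D.projTorus_of_mem_torusCx B (D.cxMk_mem_torusCx H)] at h2 h3
    rw [h3, B.cx_symm, ← loop_const, h1]
  · intro h H hH
    have h3 := D.cx_projTorus_right B (fourier ξ 0) (cxMk 1 H)
    rw [h, D.projTorus_of_mem_torusCx B (D.cxMk_mem_torusCx ⟨H, hH⟩)] at h3
    rw [loop_const, B.cx_symm, ← h3]
    simp

/-- The subalgebra of the extended Lie algebra that preserves the complement of `𝔱` has its loop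
parts in the loops in `𝔱_ℂ`. -/
theorem stab_loopModTorus {x : Affine B} (hx : x ∈ stab B (D.loopModTorus B)) :
    x.loopPart ∈ D.loopCentralizer 1 := by
  have h1 : ∀ η ∈ D.loopModTorus B, ∀ H ∈ D.torus,
      B.loop ⁅x.loopPart, mode 0 (cxMk 1 H)⁆ η = 0 := by
    intro η hη H hH
    have h2 : B.loop (mode 0 (cxMk 1 H)) (x.act η) = 0 := hx η hη H hH
    have h3 : B.loop (mode 0 (cxMk 1 H)) (rot η) = 0 := by
      rw [← neg_eq_zero, ← B.loop_rot, rot_mode]; simp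
    rw [Affine.act, map_add, map_smul, h3, smul_zero, zero_add] at h2
    rw [B.loop_inv, h2, neg_zero]
  have h2 : ∀ k, ∀ H ∈ D.torus, ⁅fourier x.loopPart k, cxMk 1 H⁆ = 0 := by
    intro k H hH
    apply B.cx_nondegenerate
    intro Z
    set U : Cx 𝔤 := if k = 0 then (D.projTorus B Z : Cx 𝔤) else 0 with hU
    have hUt : U ∈ D.torusCx := by
      rw [hU]; split_ifs
      · exact (D.projTorus B Z).2
      · exact zero_mem _
    -- Stability makes `[x, H]` orthogonal to the complement of `𝔱`. Removing the `𝔱_ℂ`-part `U`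
    -- puts the test loop there, and `U` itself pairs to zero because `𝔱` is abelian.
    have h3 : mode (-k) (Z - U) ∈ D.loopModTorus B := by
      rw [mem_loopModTorus, fourier_mode, Finsupp.single_apply]
      split_ifs with h
      · have : k = 0 := by omega
        rw [hU, if_pos this, map_sub, sub_eq_zero]
        exact Subtype.ext (D.projTorus_of_mem_torusCx B (D.projTorus B Z).2).symm
      · rw [map_zero]
    have h4 := h1 _ h3 H hH
    rw [B.loop_symm, loop_mode_neg, fourier_lie_mode, sub_zero, B.cx_symm, map_sub] at h4
    rw [sub_eq_zero.mp h4, ← lie_skew, map_neg, LinearMap.neg_apply, B.cx_inv,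
      D.torusCx_abelian (D.cxMk_mem_torusCx ⟨H, hH⟩) hUt, map_zero, neg_zero, neg_zero]
  intro k T hT
  rw [one_smul]
  induction hT using Submodule.span_induction with
  | zero => simp
  | add _ _ _ _ ha hb => rw [lie_add, ha, hb, add_zero]
  | smul c _ _ ha => rw [lie_smul, ha, smul_zero]
  | mem _ hT =>
    obtain ⟨H, hH, rfl⟩ := hT
    exact h2 k H hH

theorem mode_mem_stab_top (k : ℤ) (H : 𝔤) :
    (⟨0, mode k (cxMk 1 H), 0⟩ : Affine B) ∈ stab B (⊤ : Submodule ℂ (Loop 𝔤)) :=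
  fun _ _ => trivial

theorem mode_mem_stab_loopModTorus (k : ℤ) (H : D.torus) :
    (⟨0, mode k (cxMk 1 (H : 𝔤)), 0⟩ : Affine B) ∈ stab B (D.loopModTorus B) := by
  intro η _ K hK
  rw [Affine.act, zero_smul, zero_add]
  have h := B.loop_inv (mode k (cxMk 1 (H : 𝔤))) (mode 0 (cxMk 1 K)) η
  rw [mode_lie, D.torusCx_abelian (D.cxMk_mem_torusCx H) (D.cxMk_mem_torusCx ⟨K, hK⟩), mode_zero,
    map_zero, LinearMap.zero_apply] at h
  exact neg_eq_zero.mp h.symm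

variable {ι : Type*} [Fintype ι] [DecidableEq ι] {X : Module.Basis ι ℝ 𝔤}

/-- The vacuum is the line spanned by `1`, so a commuting operator acts on it by a scalar and no
further irreducibility argument is needed. -/
theorem spinModTorus_hasCentralCharge [LieAlgebra.IsSimple ℝ 𝔤]
    (hX : ∀ i j, B.form (X i) (X j) = if i = j then 1 else 0) {h : ℝ}
    (hh : (-(1 / 2) : ℝ) • ∑ i, LieAlgebra.ad ℝ 𝔤 (X i) ∘ₗ LieAlgebra.ad ℝ 𝔤 (X i)
      = h • LinearMap.id) : HasCentralCharge (D.spinModTorus B) h := by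
  obtain ⟨H, hH⟩ := D.exists_torus_ne_zero
  have hι : ∀ v, D.spinModTorus B (CliffordAlgebra.ι _ v) = D.fockOp B v := fun v =>
    CliffordAlgebra.lift_ι_apply _ _ _
  refine (D.fockModule B).hasCentralCharge hX hh _ hι (fun x hx => D.stab_loopModTorus B hx) ?_ hH
    fun k => D.mode_mem_stab_loopModTorus B k H
  intro T hT
  have hT' : ∀ ξ, D.projTorus B (fourier ξ 0) = 0 → ∀ x,
      T ((D.fockModule B).op ξ x) = (D.fockModule B).op ξ (T x) := by
    intro ξ hξ x
    have := hT ⟨ξ, (D.mem_loopModTorus B).mpr hξ⟩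
    rw [hι] at this
    exact LinearMap.congr_fun this x
  obtain ⟨r, hr⟩ := Submodule.mem_span_singleton.mp
    ((D.fockModule B).commutant_vac hX hT' (Submodule.mem_span_singleton_self 1))
  refine ⟨r, (D.fockModule B).commutant_eq_smul hT' fun v hv => ?_⟩
  obtain ⟨s, rfl⟩ := Submodule.mem_span_singleton.mp hv
  rw [map_smul, ← hr, smul_comm]

/-- A commuting operator preserves `S ⊗ 1` and induces there an endomorphism of the irreducible
Clifford module `S`, a scalar by Schur's lemma. -/
theorem spinFull_hasCentralCharge [LieAlgebra.IsSimple ℝ 𝔤]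
    (hX : ∀ i j, B.form (X i) (X j) = if i = j then 1 else 0) {h : ℝ}
    (hh : (-(1 / 2) : ℝ) • ∑ i, LieAlgebra.ad ℝ 𝔤 (X i) ∘ₗ LieAlgebra.ad ℝ 𝔤 (X i)
      = h • LinearMap.id) (S : Type*) [AddCommGroup S] [Module ℂ S]
    [Module (CliffordAlgebra (D.torusQuad B)) S]
    [IsScalarTower ℂ (CliffordAlgebra (D.torusQuad B)) S]
    [IsSimpleModule (CliffordAlgebra (D.torusQuad B)) S] :
    HasCentralCharge (D.spinFull B S) h := by
  obtain ⟨H, hH⟩ := D.exists_torus_ne_zero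
  have hι : ∀ v, D.spinFull B S (CliffordAlgebra.ι _ v) = D.fullOp B S v := fun v =>
    CliffordAlgebra.lift_ι_apply _ _ _
  refine (D.fullModule B S).hasCentralCharge hX hh _ hι
    -- For `ε = 0` the centralizer condition is empty, so all loops are admitted.
    (fun x hx k T hT => by rw [zero_smul]) ?_ hH fun k => mode_mem_stab_top B k (H : 𝔤)
  intro T hT
  have hT' : ∀ ξ, ∀ x, T (D.fullOp B S ξ x) = D.fullOp B S ξ (T x) := by
    intro ξ x
    have := hT ⟨ξ, trivial⟩
    rw [hι] at this
    exact LinearMap.congr_fun this x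
  have hvac : ∀ s, T (D.tmulOne S s) = D.tmulOne S (D.vacPart S (T (D.tmulOne S s))) := by
    intro s
    obtain ⟨t, ht⟩ := (D.fullModule B S).commutant_vac hX (fun ξ _ => hT' ξ)
      (v := D.tmulOne S s) ⟨s, rfl⟩
    rw [← ht, vacPart_tmulOne]
  obtain ⟨r, hr⟩ := exists_eq_smul_of_commute (Q := D.torusQuad B)
    (D.vacPart S ∘ₗ T ∘ₗ D.tmulOne S) fun K s => by
      change D.vacPart S (T (D.tmulOne S _)) = _ • D.vacPart S (T (D.tmulOne S s))
      rw [← fullOp_torus, hT', hvac s, fullOp_torus, vacPart_tmulOne, vacPart_tmulOne]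
  refine ⟨r, (D.fullModule B S).commutant_eq_smul (fun ξ _ => hT' ξ) ?_⟩
  rintro _ ⟨s, rfl⟩
  have h1 : D.vacPart S (T (D.tmulOne S s)) = r • s := hr s
  rw [hvac s, h1, map_smul]

end CartanChoice

end LoopSpin

end

theorem mainTheorem6 {𝔤 : Type*} [LieRing 𝔤] [LieAlgebra ℝ 𝔤] [FiniteDimensional ℝ 𝔤]
    [LieAlgebra.IsSimple ℝ 𝔤] (B : LoopSpin.InvInner 𝔤) (D : LoopSpin.CartanChoice 𝔤)
    (θ : Module.Dual ℝ D.torus) (hθ : D.IsHighestRoot θ) (hB : D.dualInner B θ θ = 2)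
    {ι : Type*} [Fintype ι] [DecidableEq ι] (X : Module.Basis ι ℝ 𝔤)
    (hX : ∀ i j, B.form (X i) (X j) = if i = j then 1 else 0) :
    ∃ c : ℝ,
      LoopSpin.HasCentralCharge (D.spinModTorus B) c ∧
      (∀ (S : Type*) [AddCommGroup S] [Module ℂ S] [Module (CliffordAlgebra (D.torusQuad B)) S]
        [IsScalarTower ℂ (CliffordAlgebra (D.torusQuad B)) S]
        [IsSimpleModule (CliffordAlgebra (D.torusQuad B)) S],
        LoopSpin.HasCentralCharge (D.spinFull B S) c) ∧
      (-(1 / 2) : ℝ) • ∑ i, LieAlgebra.ad ℝ 𝔤 (X i) ∘ₗ LieAlgebra.ad ℝ 𝔤 (X i)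
        = c • LinearMap.id ∧
      c = D.dualInner B (D.rho B) θ + 1 := by
  have h := D.casimir_eq B hθ hB hX
  exact ⟨_, D.spinModTorus_hasCentralCharge B hX h,
    fun S _ _ _ _ _ => D.spinFull_hasCentralCharge B hX h S, h, rfl⟩
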